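/- Let $g_2,g_3\in\mathbb C$ with $g_2\neq 0$, $g_2^3\ne 27g_3^2$, so that $$H=\{w^2=-\tfrac14(4z^3-9g_2z-27g_3)(z^2-3g_2)\}$$ has genus 2 (the 3:1 case). Put $G_2=\frac{27}{16}(g_2^3+9g_3^2)$, $G_3=\frac{243}{32}\,g_3\,(g_2^3-3g_3^2)$ and let $\mathcal E_2=\{\mathcal W^2=\mathcal Z^3-G_2\mathcal Z-G_3\}$, which is covered 3:1 by $H$ through $\mathcal Z=-\frac14(4z^3-9g_2z-9g_3)$, $\mathcal W=-w(z^2-\frac34g_2)$. $\mathrm{Jac}$ of a curve $y^2=f(x)$, $\deg f=2g+1$, is $\mathbb C^g$ modulo the periods of $x^{k}dx/y$, $0\le k<g$. For $\rho\in\mathbb C$ let $E_{\rho\pm}=(\rho,\pm\sqrt{\rho^3-G_2\rho-G_3})\in\mathcal E_2$ and let $\mathcal I_\rho=\int_{E_{\rho-}}^{E_{\rho+}}d\mathcal Z/\mathcal W$; call $m\,\mathcal I_\rho$ neutral if it is $0$ in $\mathrm{Jac}(\mathcal E_2)$. Consider the two equations $$3\rho^4-6G_2\rho^2-12G_3\rho-G_2^2=0,\qquad(\mathrm{cond3})$$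 $$\begin{aligned}&-\rho^{12}+22G_2\rho^{10}+220G_3\rho^9+165G_2^2\rho^8+528G_2G_3\rho^7+(1776G_3^2-92G_2^3)\rho^6+264G_2^2G_3\rho^5\\&+(185G_2^4-960G_2G_3^2)\rho^4+(80G_2^3G_3-320G_3^3)\rho^3+(624G_2^2G_3^2-90G_2^5)\rho^2\\&+(896G_2G_3^3-132G_2^4G_3)\rho+512G_3^4+3G_2^6-96G_2^3G_3^2=0.\qquad(\mathrm{cond4})\end{aligned}$$ (1) Let $a_1,a_2,a_3,c\in\mathbb C\setminus\{0\}$ and let $\beta$ be such that the five roots of the polynomial defining $H$ are $\beta$, $1/a_i+\beta$, $1/c+\beta$; that is, $\lambda=1/(z-\beta)$ identifies $H$ with the curve $\Gamma=\{\mu^2=-\lambda(\lambda-a_1)(\lambda-a_2)(\lambda-a_3)(\lambda-c)\}$ of the geodesics on the quadric $Q=\{\sum X_i^2/a_i=1\}$ with caustic parameter $c$. These (closed) geodesics are represented by the trajectories $u_2=\mathrm{const}$ on $\mathrm{Jac}(\Gamma)$, where $u_1,u_2$ are the coordinates given by $d\lambda/\mu$, $\lambda\,d\lambda/\mu$. Let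 $d\notin\{0,a_1,a_2,a_3,c\}$, $E_{d\pm}\in\Gamma$ the two points over $\lambda=d$, and $\Theta_{d\pm}\subset\mathrm{Jac}(\Gamma)$ the set of the classes $\int_\infty^{P}+\int_\infty^{E_{d\pm}}$, $P\in\Gamma$. The (many-valued) billiard map on $\Theta_{d+}$ moves a point along its $u_1$-trajectory to a point of $\Theta_{d-}$ (next impact on the confocal quadric $Q_d$) and then adds $\int_{E_{d-}}^{E_{d+}}$ (elastic reflection), returning to $\Theta_{d+}$. It induces a well-defined one-to-one map $\mathcal F_{c,d}$ of the set of these geodesics onto itself. Put $\delta=1/d+\beta$ and $\rho=-(\delta^3-\frac94g_2\delta-\frac94g_3)$. If $m\,\mathcal I_\rho$ is neutral for an integer $m\ge1$, then $\mathcal F_{c,d}$ is periodic, $\mathcal F_{c,d}^{\,m}=\mathrm{id}$; in particular $\mathcal F_{c,d}^{\,3}=\mathrm{id}$ if $\rho$ is a root of (cond3) or of (cond4). (2) Let $\rho^3-G_2\rho-G_3\ne0$ and let $\sqrt{\mathcal Z^3-G_2\mathcal Z-G_3}=S_0+S_1(\mathcal Z-\rho)+S_2(\mathcal Z-\rho)^2+\cdots$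 be either expansion at $\rho$. Then $$3\,\mathcal I_\rho\ \text{is neutral}\iff \mathrm{rank}\begin{pmatrix}S_4&S_3\\S_5&S_4\end{pmatrix}<2\iff \rho\ \text{satisfies (cond3) or (cond4)}.$$ (3) Equations (cond3) and (cond4) have together exactly 16 distinct roots $\rho_j$. The points $E_{\rho_j\pm}$ are 32 distinct points of $\mathcal E_2$, with $E_{\rho_j+}\ne E_{\rho_j-}$. For every Weierstrass point $\mathcal O$ of $\mathcal E_2$ (a branch point of $\mathcal Z$, finite or at infinity), the map $\mathcal A(P)=\int_{\mathcal O}^P d\mathcal Z/\mathcal W$ is a bijection of the set of these 32 points onto the set of all $x\in\mathrm{Jac}(\mathcal E_2)$ with $6x=0$, $2x\neq0$, that is, the 36 points with $6x=0$ without the four points with $2x=0$. -/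

import Mathlib

open Polynomial

noncomputable section

/-! ## Compact (hyper)elliptic curves, Abelian integrals, Jacobians -/

/-- The points of the compact curve `y ^ 2 = f x`, for `f` of odd degree `2 g + 1`:
the affine points and the single point at infinity. -/
inductive HPoint (f : ℂ[X]) : Type
  | aff (x y : ℂ) (h : y ^ 2 = f.eval x) : HPoint f
  | inf : HPoint f

/-- The hyperelliptic involution `(x, y) ↦ (x, -y)`. -/
def HPoint.neg {f : ℂ[X]} : HPoint f → HPoint f
  | .aff x y h => .aff x (-y) (by rw [neg_sq]; exact h)
  | .inf => .inf

/-- The Weierstrass points are the fixed points of the involution: the points `(e, 0)` with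
`f e = 0`, and the point at infinity. -/
def HPoint.IsWeierstrass {f : ℂ[X]} (P : HPoint f) : Prop := P.neg = P

/-- `(x, y)` are the affine coordinates of `P`. -/
def HPoint.InAffineChart {f : ℂ[X]} (P : HPoint f) (x y : ℂ) : Prop :=
  match P with
  | .aff a b _ => x = a ∧ y = b
  | .inf => False

/-- `(ξ, η)` are the coordinates of `P` in the chart `ξ = 1 / x`, `η = y / x ^ (g + 1)`, in which
the curve of genus `g` is `η ^ 2 = ξ * f.reverse ξ` and the point at infinity is `(0, 0)`. -/
def HPoint.InInfiniteChart (g : ℕ) {f : ℂ[X]} (P : HPoint f) (ξ η : ℂ) : Prop :=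
  match P with
  | .aff a b _ => a ≠ 0 ∧ ξ = 1 / a ∧ η = b / a ^ (g + 1)
  | .inf => ξ = 0 ∧ η = 0

/-- `t ↦ (x t, y t)`, `0 ≤ t ≤ 1`, is a `C¹` path on the smooth affine curve `y ^ 2 = F x`, and
`v dt` is the pull-back to it of the differential `dx / y = 2 dy / F' x` (regular on the whole
affine curve, also where `y = 0`). -/
def IsChartPath (F : ℂ[X]) (x y v : ℝ → ℂ) : Prop :=
  ContinuousOn v (Set.Icc 0 1) ∧ ∀ t ∈ Set.Icc (0 : ℝ) 1,
    y t ^ 2 = F.eval (x t) ∧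
    HasDerivWithinAt x (y t * v t) (Set.Icc 0 1) t ∧
    HasDerivWithinAt y (F.derivative.eval (x t) / 2 * v t) (Set.Icc 0 1) t

/-- `PathIntegral g f P Q I`: there is a piecewise `C¹` path from `P` to `Q` on the compact curve
`y ^ 2 = f x` of genus `g`, along which the integrals of the holomorphic differentials
`x ^ k dx / y`, `k = 0, …, g - 1`, are the components `I k`.  The path is a concatenation of
pieces, each lying in one of the two charts; in the chart at infinity
`x ^ k dx / y = - ξ ^ (g - 1 - k) dξ / η`. -/
inductive PathIntegral (g : ℕ) (f : ℂ[X]) : HPoint f → HPoint f → (Fin g → ℂ) → Prop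
  | affine (P Q : HPoint f) (x y v : ℝ → ℂ) (h : IsChartPath f x y v)
      (hP : P.InAffineChart (x 0) (y 0)) (hQ : Q.InAffineChart (x 1) (y 1)) :
      PathIntegral g f P Q (fun k => ∫ t in (0 : ℝ)..1, x t ^ (k : ℕ) * v t)
  | infinite (P Q : HPoint f) (ξ η v : ℝ → ℂ) (h : IsChartPath (X * f.reverse) ξ η v)
      (hP : P.InInfiniteChart g (ξ 0) (η 0)) (hQ : Q.InInfiniteChart g (ξ 1) (η 1)) :
      PathIntegral g f P Q (fun k => -∫ t in (0 : ℝ)..1, ξ t ^ (k.rev : ℕ) * v t)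
  | trans (P Q R : HPoint f) (I J : Fin g → ℂ) (hI : PathIntegral g f P Q I)
      (hJ : PathIntegral g f Q R J) : PathIntegral g f P R (I + J)

/-- The period lattice: the group of the integrals along closed paths. -/
def periodLattice (g : ℕ) (f : ℂ[X]) : AddSubgroup (Fin g → ℂ) :=
  AddSubgroup.closure {I | ∃ P, PathIntegral g f P P I}

/-- The Jacobian variety `ℂ ^ g / periods`. -/
abbrev Jac (g : ℕ) (f : ℂ[X]) : Type := (Fin g → ℂ) ⧸ periodLattice g f

open Classical in
/-- The class in the Jacobian of the vector of integrals `∫_P^Q x ^ k dx / y` along any path from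
`P` to `Q`; by `abelInt_eq` it does not depend on the path. -/
def abelInt (g : ℕ) (f : ℂ[X]) (P Q : HPoint f) : Jac g f :=
  if h : ∃ I, PathIntegral g f P Q I then QuotientAddGroup.mk h.choose else 0

lemma IsChartPath.reverse {F : ℂ[X]} {x y v : ℝ → ℂ} (h : IsChartPath F x y v) :
    IsChartPath F (fun t => x (1 - t)) (fun t => y (1 - t)) (fun t => -v (1 - t)) := by
  have hm : Set.MapsTo (fun t : ℝ => 1 - t) (Set.Icc 0 1) (Set.Icc 0 1) := fun t ht =>
    ⟨by linarith [ht.2], by linarith [ht.1]⟩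
  have hd (t : ℝ) : HasDerivWithinAt (fun t : ℝ => 1 - t) (-1) (Set.Icc 0 1) t := by
    simpa using ((hasDerivAt_id t).const_sub 1).hasDerivWithinAt
  refine ⟨(h.1.comp (by fun_prop) hm).neg, fun t ht => ?_⟩
  obtain ⟨h1, h2, h3⟩ := h.2 _ (hm ht)
  refine ⟨h1, ?_, ?_⟩
  · have := HasDerivWithinAt.scomp t h2 (hd t) hm
    exact this.congr_deriv (by simp)
  · have := HasDerivWithinAt.scomp t h3 (hd t) hm
    exact this.congr_deriv (by simp)

lemma PathIntegral.symm {g : ℕ} {f : ℂ[X]} {P Q : HPoint f} {I : Fin g → ℂ}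
    (h : PathIntegral g f P Q I) : PathIntegral g f Q P (-I) := by
  induction h with
  | affine P Q x y v h hP hQ =>
    have := PathIntegral.affine (g := g) Q P _ _ _ h.reverse (by simpa using hQ)
      (by simpa using hP)
    convert this using 1
    funext k
    have := intervalIntegral.integral_comp_sub_left (a := 0) (b := 1)
      (fun t : ℝ => x t ^ (k : ℕ) * v t) 1
    simp_all
  | infinite P Q ξ η v h hP hQ =>
    have := PathIntegral.infinite (g := g) Q P _ _ _ h.reverse (by simpa using hQ)
      (by simpa using hP)
    convert this using 1
    funext k
    have := intervalIntegral.integral_comp_sub_left (a := 0) (b := 1)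
      (fun t : ℝ => ξ t ^ (k.rev : ℕ) * v t) 1
    simp_all
  | trans P Q R I J _ _ hI hJ =>
    rw [neg_add_rev]
    exact .trans _ _ _ _ _ hJ hI

lemma abelInt_eq {g : ℕ} {f : ℂ[X]} {P Q : HPoint f} {I : Fin g → ℂ}
    (h : PathIntegral g f P Q I) : abelInt g f P Q = QuotientAddGroup.mk I := by
  have h' : ∃ I, PathIntegral g f P Q I := ⟨I, h⟩
  rw [abelInt, dif_pos h', QuotientAddGroup.eq]
  exact AddSubgroup.subset_closure ⟨Q, .trans _ _ _ _ _ h'.choose_spec.symm h⟩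

/-! ## Geodesics on the quadric, the billiard, the induced map on geodesics -/

/-- The polynomial of the genus 2 curve
`Γ : μ ^ 2 = - λ (λ - a₁) (λ - a₂) (λ - a₃) (λ - c)` of the geodesics on
`Q : ∑ X_i ^ 2 / a_i = 1` that are tangent to the confocal quadric (caustic) `Q_c`. -/
def polyGamma (a : Fin 3 → ℂ) (c : ℂ) : ℂ[X] :=
  -(X * (∏ i, (X - C (a i))) * (X - C c))

/-- The `u₁`-direction in the Jacobian of a genus 2 curve, `u₁, u₂` being the coordinates
given by the differentials `dλ / μ`, `λ dλ / μ`. -/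
def u1Flow (f : ℂ[X]) : ℂ →+ Jac 2 f :=
  (QuotientAddGroup.mk' (periodLattice 2 f)).comp (AddMonoidHom.single (fun _ : Fin 2 => ℂ) 0)

/-- The geodesics with a given caustic, which are linearised as the trajectories
`u₁ = s + const`, `u₂ = const` of the `u₁`-flow on the Jacobian. -/
abbrev Geodesic (f : ℂ[X]) : Type := Jac 2 f ⧸ (u1Flow f).range

/-- The translate of the theta-divisor consisting of the images `∫_∞^P + ∫_∞^E` under the
Abel–Jacobi map of the degree 2 divisors `P + E` with fixed `E`. -/
def thetaDivisor (f : ℂ[X]) (E : HPoint f) : Set (Jac 2 f) :=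
  {u | ∃ P : HPoint f, u = abelInt 2 f .inf P + abelInt 2 f .inf E}

/-- The (many-valued) billiard map `u ↦ u'` on the theta-divisor `Θ_{d+}`, with `E = E_{d+}` and
`E.neg = E_{d-}` the points of `Γ` over `λ = d`. The geodesic motion goes from `u ∈ Θ_{d+}` along
the `u₁`-flow to a point of `Θ_{d-}` (the next impact on `Q ∩ Q_d`, with the ingoing velocity),
and the elastic reflection is the jump from `Θ_{d-}` back to `Θ_{d+}` by `∫_{E_{d-}}^{E_{d+}}`,
which replaces `E_{d-}` by `E_{d+}` in the divisor. -/
def BilliardStep (f : ℂ[X]) (E : HPoint f) (u u' : Jac 2 f) : Prop :=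
  u ∈ thetaDivisor f E ∧ u' ∈ thetaDivisor f E ∧
    ∃ s : ℂ, u + u1Flow f s ∈ thetaDivisor f E.neg ∧
      u' = u + u1Flow f s + abelInt 2 f E.neg E

/-- The billiard takes the geodesic `γ` to the geodesic `γ'`: some billiard step starts on `γ`
and ends on `γ'`. -/
def BilliardOnGeodesics (f : ℂ[X]) (E : HPoint f) (γ γ' : Geodesic f) : Prop :=
  ∃ u u' : Jac 2 f, BilliardStep f E u u' ∧
    QuotientAddGroup.mk u = γ ∧ QuotientAddGroup.mk u' = γ'

/-! ## The 3:1 covering and the second elliptic curve -/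

/-- The polynomial of the genus 2 curve
`H : w ^ 2 = - (1 / 4) (4 z ^ 3 - 9 g₂ z - 27 g₃) (z ^ 2 - 3 g₂)`. -/
def polyH (g2 g3 : ℂ) : ℂ[X] :=
  C (-1 / 4) * (4 * X ^ 3 - C (9 * g2) * X - C (27 * g3)) * (X ^ 2 - C (3 * g2))

/-- The curve `Γ` of the parameters `a`, `c` is obtained from `H` by the birational transformation
`λ = 1 / (z - β)` (and `μ = const * w / (z - β) ^ 3`), `(β, 0)` being a Weierstrass point of `H`:
the roots of the polynomial of `H` are `β`, `1 / a i + β` and `1 / c + β`. -/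
def IsThreeToOneCase (g2 g3 β : ℂ) (a : Fin 3 → ℂ) (c : ℂ) : Prop :=
  (∀ i, a i ≠ 0) ∧ c ≠ 0 ∧
    polyH g2 g3 = -((X - C β) * (∏ i, (X - C (1 / a i + β))) * (X - C (1 / c + β)))

/-- The modulus `G₂` of the second elliptic curve. -/
def modG2 (g2 g3 : ℂ) : ℂ := 27 / 16 * (g2 ^ 3 + 9 * g3 ^ 2)

/-- The modulus `G₃` of the second elliptic curve. -/
def modG3 (g2 g3 : ℂ) : ℂ := 243 / 32 * g3 * (g2 ^ 3 - 3 * g3 ^ 2)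

/-- The polynomial of the elliptic curve `W ^ 2 = Z ^ 3 - G₂ Z - G₃`. -/
def polyE2 (G2 G3 : ℂ) : ℂ[X] := X ^ 3 - C G2 * X - C G3

/-- The covering of the second elliptic curve by `H` on the first coordinate:
`Z = - (1 / 4) (4 z ^ 3 - 9 g₂ z - 9 g₃)`. -/
def coverZ (g2 g3 z : ℂ) : ℂ := -(z ^ 3 - 9 / 4 * g2 * z - 9 / 4 * g3)

/-- The class in `Jac(ℰ₂)` of the elliptic integral `∫ dZ / W` from `(ρ, -σ)` to `(ρ, σ)`. -/
def intRho (G2 G3 ρ σ : ℂ) (h : σ ^ 2 = (polyE2 G2 G3).eval ρ) : Jac 1 (polyE2 G2 G3) :=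
  abelInt 1 (polyE2 G2 G3) (HPoint.aff ρ σ h).neg (HPoint.aff ρ σ h)

/-- `S` is the expansion `S₀ + S₁ (Z - ρ) + …` of a branch of `√f` at `ρ`. -/
def IsSqrtExpansion (f : ℂ[X]) (ρ : ℂ) (S : PowerSeries ℂ) : Prop :=
  S ^ 2 = ((Polynomial.taylor ρ f : ℂ[X]) : PowerSeries ℂ)

/-- The matrix of the Cayley-type condition for genus 1 and `m = 3`. -/
def cayleyMatrix (S : PowerSeries ℂ) : Matrix (Fin 2) (Fin 2) ℂ :=
  !![S.coeff 4, S.coeff 3; S.coeff 5, S.coeff 4]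

/-- The quartic condition. -/
def Cond3 (G2 G3 ρ : ℂ) : Prop :=
  3 * ρ ^ 4 - 6 * G2 * ρ ^ 2 - 12 * G3 * ρ - G2 ^ 2 = 0

/-- The condition of degree 12. -/
def Cond4 (G2 G3 ρ : ℂ) : Prop :=
  -ρ ^ 12 + 22 * G2 * ρ ^ 10 + 220 * G3 * ρ ^ 9 + 165 * G2 ^ 2 * ρ ^ 8
    + 528 * G2 * G3 * ρ ^ 7 + (1776 * G3 ^ 2 - 92 * G2 ^ 3) * ρ ^ 6
    + 264 * G2 ^ 2 * G3 * ρ ^ 5 + (185 * G2 ^ 4 - 960 * G2 * G3 ^ 2) * ρ ^ 4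
    + (80 * G2 ^ 3 * G3 - 320 * G3 ^ 3) * ρ ^ 3
    + (624 * G2 ^ 2 * G3 ^ 2 - 90 * G2 ^ 5) * ρ ^ 2
    + (896 * G2 * G3 ^ 3 - 132 * G2 ^ 4 * G3) * ρ
    + 512 * G3 ^ 4 + 3 * G2 ^ 6 - 96 * G2 ^ 3 * G3 ^ 2 = 0

/-- The points `(ρ, ±√(ρ ^ 3 - G₂ ρ - G₃))` over the roots `ρ` of the two equations. -/
def rootPoints (G2 G3 : ℂ) : Set (HPoint (polyE2 G2 G3)) :=
  {P | ∃ ρ σ h, P = HPoint.aff ρ σ h ∧ (Cond3 G2 G3 ρ ∨ Cond4 G2 G3 ρ)}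

end

/-! On the set of geodesics, Jac(Γ) modulo the u₁-direction, only the second coordinate survives.
Motion along a geodesic is invisible there, so the billiard acts as translation by the class of ∫
from E_{d-} to E_{d+} (`billiardOnGeodesics_iff`), and `F ^ m = 1` follows once m times the integral
of λ dλ/μ is the second component of a period. The covering pulls dZ/W back to -3κ λ dλ/μ, where κ²
= a₁a₂a₃c (`cover_eq_add`), and only λ = 0 lies over the point at infinity of ℰ₂ (`cover_eq_zero`).
Hence, if m𝓘_ρ is neutral, a path on Γ from (0, 0) with the prescribed second integral has its
endpoint over infinity as well, so it is closed and its integral is the required period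
(`nsmul_geodesic_shift_eq_zero`).

To use the group law, the Jacobian defined by path integrals is identified with the group of points.
Moving P along the flow of dx/y and the point at infinity along the opposite flow leaves the sum
constant; this yields a homomorphism Φ from ℂ to the curve with Q = P + Φ(∫_P^Q dx/y)
(`IsExp.toEll_eq`). The kernel of Φ consists of the periods, because every complex number is the
integral along some path from a given point (`exists_pathIntegral_apply_eq`, by the open mapping
theorem and compactness) and a path from infinity with integral in the kernel is closed.

As E_{ρ-} = -E_{ρ+}, neutrality of 3𝓘_ρ means 6E_{ρ+} = 0. The equation (cond3) expresses 3P = 0 and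
(cond4) expresses, away from (cond3), that 3P has ordinate 0 (`six_nsmul_ellPt_eq_zero_iff`); the
determinant of the Cayley matrix is their product divided by (2S₀)¹⁴. Finally there are 4 · 9 = 36
points with 6P = 0, and the 32 of them with 2P ≠ 0 lie in pairs over the roots. This gives the 16
roots without any discriminant of the equation of degree 12. -/

section AbelianIntegrals

open Filter Topology Metric

/-! ## Local parametrisations of smooth affine curves -/

lemma exists_analytic_local_inverse {f : ℂ → ℂ} {a : ℂ} (hf : AnalyticAt ℂ f a)
    (hd : deriv f a ≠ 0) :
    ∃ g : ℂ → ℂ, AnalyticAt ℂ g (f a) ∧ g (f a) = a ∧ (∀ᶠ w in 𝓝 (f a), f (g w) = w) ∧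
      ∀ᶠ z in 𝓝 a, g (f z) = z :=
  ⟨hf.hasStrictDerivAt.localInverse _ _ _ hd, hf.analyticAt_localInverse hd,
    HasStrictFDerivAt.localInverse_apply_image .., hf.hasStrictDerivAt.eventually_right_inverse hd,
    hf.hasStrictDerivAt.eventually_left_inverse hd⟩

/-- `(x, y)` is a holomorphic parametrisation, defined on the disc of radius `r`, of the curve
`y ^ 2 = F x` near the point `(x 0, y 0)`, the differential `dx / y` is `h τ dτ`, and the
parameter of a nearby point `q` of the curve is `T q`. -/
structure IsLocalParam (F : ℂ[X]) (r : ℝ) (x y h : ℂ → ℂ) (T : ℂ × ℂ → ℂ) : Prop where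
  pos : 0 < r
  diff : DifferentiableOn ℂ h (ball 0 r)
  ne_zero : ∀ τ ∈ ball (0 : ℂ) r, h τ ≠ 0
  eqn : ∀ τ ∈ ball (0 : ℂ) r, y τ ^ 2 = F.eval (x τ)
  deriv_x : ∀ τ ∈ ball (0 : ℂ) r, HasDerivAt x (y τ * h τ) τ
  deriv_y : ∀ τ ∈ ball (0 : ℂ) r, HasDerivAt y (F.derivative.eval (x τ) / 2 * h τ) τ
  diff_T : Differentiable ℂ T
  T_zero : T (x 0, y 0) = 0
  inv : ∀ᶠ q in 𝓝 (x 0, y 0), q.2 ^ 2 = F.eval q.1 → q = (x (T q), y (T q))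

/-- Away from the branch points the parameter is `x - x₀`, and y comes from a local inverse of
squaring. -/
lemma exists_isLocalParam_of_ne_zero {F : ℂ[X]} {x₀ y₀ : ℂ} (h₀ : y₀ ^ 2 = F.eval x₀)
    (hy : y₀ ≠ 0) :
    ∃ r x y h T, IsLocalParam F r x y h T ∧ x 0 = x₀ ∧ y 0 = y₀ := by
  obtain ⟨g, hga, hg0, hgr, hgl⟩ := exists_analytic_local_inverse (f := fun y : ℂ => y ^ 2)
    (a := y₀) (by fun_prop) (by simp [hy])
  have hF : Tendsto (fun τ : ℂ => F.eval (x₀ + τ)) (𝓝 0) (𝓝 (y₀ ^ 2)) := by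
    have : Continuous (fun τ : ℂ => F.eval (x₀ + τ)) := by fun_prop
    simpa [h₀] using this.tendsto 0
  set y : ℂ → ℂ := fun τ => g (F.eval (x₀ + τ)) with hydef
  have hya : ∀ᶠ τ in 𝓝 (0 : ℂ), DifferentiableAt ℂ y τ := by
    filter_upwards [hF.eventually hga.eventually_analyticAt] with τ hτ
    have h1 : DifferentiableAt ℂ (fun τ : ℂ => F.eval (x₀ + τ)) τ := by
      have : Differentiable ℂ (fun z => F.eval z) := F.differentiable
      fun_prop
    exact hτ.differentiableAt.comp τ h1
  have hy0 : y 0 = y₀ := by simp [hydef, ← h₀, hg0]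
  have hyn : ∀ᶠ τ in 𝓝 (0 : ℂ), y τ ≠ 0 :=
    (hya.self_of_nhds.continuousAt).eventually_ne (by rwa [hy0])
  have hev : ∀ᶠ τ in 𝓝 (0 : ℂ), y τ ^ 2 = F.eval (x₀ + τ) := hF.eventually hgr
  obtain ⟨r, hr, hball⟩ := Metric.eventually_nhds_iff_ball.1 ((hya.and hyn).and hev)
  have hd : ∀ τ ∈ ball (0 : ℂ) r, HasDerivAt y (F.derivative.eval (x₀ + τ) / 2 * (y τ)⁻¹) τ := by
    intro τ hτ
    have h1 := (hball τ hτ).1.1.hasDerivAt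
    have h2 := h1.pow 2
    have h3 : HasDerivAt (fun τ => F.eval (x₀ + τ)) (F.derivative.eval (x₀ + τ)) τ := by
      simpa using (F.hasDerivAt (x₀ + τ)).comp_const_add x₀ τ
    have h4 : (y ^ 2) =ᶠ[𝓝 τ] (fun τ => F.eval (x₀ + τ)) := by
      filter_upwards [isOpen_ball.mem_nhds hτ] with t ht using (hball t ht).2
    have h5 := h2.unique (h3.congr_of_eventuallyEq h4)
    refine h1.congr_deriv ?_
    have := (hball τ hτ).1.2
    rw [← h5]
    field_simp
    simp
  refine ⟨r, fun τ => x₀ + τ, y, fun τ => (y τ)⁻¹, fun q => q.1 - x₀, ⟨hr, ?_, ?_, ?_, ?_, hd,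
    by fun_prop, by simp, ?_⟩, by simp, hy0⟩
  · intro τ hτ
    exact ((hball τ hτ).1.1.inv (hball τ hτ).1.2).differentiableWithinAt
  · intro τ hτ
    exact inv_ne_zero (hball τ hτ).1.2
  · intro τ hτ
    exact (hball τ hτ).2
  · intro τ hτ
    have := (hball τ hτ).1.2
    simpa [this] using (hasDerivAt_id τ).const_add x₀
  · rw [hy0]
    have : Tendsto (fun q : ℂ × ℂ => q.2) (𝓝 (x₀ + 0, y₀)) (𝓝 y₀) := continuous_snd.tendsto _
    filter_upwards [this.eventually hgl] with q hq hc
    ext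
    · simp
    · simp [hydef, ← hc, hq]

/-- At a branch point the parameter is y itself: F is locally invertible at a simple root, so x is
the inverse of F at τ², and dx/y = 2 dτ / F'(x). -/
lemma exists_isLocalParam_of_eq_zero {F : ℂ[X]} {x₀ : ℂ} (h₀ : F.eval x₀ = 0)
    (hF' : F.derivative.eval x₀ ≠ 0) :
    ∃ r x y h T, IsLocalParam F r x y h T ∧ x 0 = x₀ ∧ y 0 = 0 := by
  obtain ⟨g, hga, hg0, hgr, hgl⟩ := exists_analytic_local_inverse (f := fun z => F.eval z)
    (a := x₀) (F.differentiable.analyticAt _) (by simpa using hF')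
  simp only [h₀] at hga hg0 hgr hgl
  have hF : Tendsto (fun τ : ℂ => τ ^ 2) (𝓝 0) (𝓝 0) := by
    have : Continuous (fun τ : ℂ => τ ^ 2) := by fun_prop
    simpa using this.tendsto 0
  set x : ℂ → ℂ := fun τ => g (τ ^ 2) with hxdef
  have hxa : ∀ᶠ τ in 𝓝 (0 : ℂ), DifferentiableAt ℂ x τ := by
    filter_upwards [hF.eventually hga.eventually_analyticAt] with τ hτ
    exact hτ.differentiableAt.comp τ (by fun_prop)
  have hx0 : x 0 = x₀ := by simp [hxdef, hg0]
  have hxn : ∀ᶠ τ in 𝓝 (0 : ℂ), F.derivative.eval (x τ) ≠ 0 :=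
    ContinuousAt.eventually_ne (g := fun τ => F.derivative.eval (x τ))
      (F.derivative.continuous.continuousAt.comp hxa.self_of_nhds.continuousAt)
      (by simpa only [hx0])
  have hev : ∀ᶠ τ in 𝓝 (0 : ℂ), τ ^ 2 = F.eval (x τ) :=
    (hF.eventually hgr).mono fun τ h => h.symm
  obtain ⟨r, hr, hball⟩ := Metric.eventually_nhds_iff_ball.1 ((hxa.and hxn).and hev)
  refine ⟨r, x, fun τ => τ, fun τ => 2 / F.derivative.eval (x τ), fun q => q.2,
    ⟨hr, ?_, ?_, ?_, ?_, ?_, by fun_prop, by simp, ?_⟩, hx0, rfl⟩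
  · intro τ hτ
    have := (hball τ hτ).1.2
    have h1 := (hball τ hτ).1.1
    have h2 : DifferentiableAt ℂ (fun τ => F.derivative.eval (x τ)) τ :=
      (F.derivative.differentiable.differentiableAt).comp τ h1
    exact ((differentiableAt_const _).div h2 this).differentiableWithinAt
  · intro τ hτ
    have := (hball τ hτ).1.2
    simp [this]
  · intro τ hτ
    exact (hball τ hτ).2
  · intro τ hτ
    have h1 := (hball τ hτ).1.1.hasDerivAt
    have hne := (hball τ hτ).1.2
    have h2 := (F.hasDerivAt (x τ)).comp τ h1
    have h3 : HasDerivAt (fun τ : ℂ => τ ^ 2) (2 * τ) τ := by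
      simpa using hasDerivAt_pow 2 τ
    have h4 : ((fun z => F.eval z) ∘ x) =ᶠ[𝓝 τ] (fun τ => τ ^ 2) := by
      filter_upwards [isOpen_ball.mem_nhds hτ] with t ht using (hball t ht).2.symm
    have h5 := h2.unique (h3.congr_of_eventuallyEq h4)
    refine h1.congr_deriv ?_
    field_simp
    rw [mul_comm, h5, mul_comm]
  · intro τ hτ
    have := (hball τ hτ).1.2
    exact (hasDerivAt_id' τ).congr_deriv (by simp [this])
  · rw [hx0]
    have : Tendsto (fun q : ℂ × ℂ => q.1) (𝓝 (x₀, 0)) (𝓝 x₀) := continuous_fst.tendsto _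
    filter_upwards [this.eventually hgl] with q hq hc
    ext
    · simp [hxdef, hc, hq]
    · simp

lemma exists_isLocalParam {F : ℂ[X]} {x₀ y₀ : ℂ} (h₀ : y₀ ^ 2 = F.eval x₀)
    (hs : F.eval x₀ = 0 → F.derivative.eval x₀ ≠ 0) :
    ∃ r x y h T, IsLocalParam F r x y h T ∧ x 0 = x₀ ∧ y 0 = y₀ := by
  by_cases hy : y₀ = 0
  · have : F.eval x₀ = 0 := by rw [← h₀, hy]; simp
    obtain rfl := hy
    exact exists_isLocalParam_of_eq_zero this (hs this)
  · exact exists_isLocalParam_of_ne_zero h₀ hy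

namespace IsLocalParam

variable {F : ℂ[X]} {r : ℝ} {x y h : ℂ → ℂ} {T : ℂ × ℂ → ℂ}

lemma zero_mem (hp : IsLocalParam F r x y h T) : (0 : ℂ) ∈ ball (0 : ℂ) r :=
  mem_ball_self hp.pos

lemma exists_primitive (hp : IsLocalParam F r x y h T) :
    ∃ G : ℕ → ℂ → ℂ, (∀ k, G k 0 = 0) ∧
      ∀ k, ∀ τ ∈ ball (0 : ℂ) r, HasDerivAt (G k) (x τ ^ k * h τ) τ := by
  have (k : ℕ) : ∃ G : ℂ → ℂ, G 0 = 0 ∧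
      ∀ τ ∈ ball (0 : ℂ) r, HasDerivAt G (x τ ^ k * h τ) τ := by
    have hd : DifferentiableOn ℂ (fun τ => x τ ^ k * h τ) (ball 0 r) := fun τ hτ =>
      ((hp.deriv_x τ hτ).differentiableAt.pow k).differentiableWithinAt.mul (hp.diff τ hτ)
    exact hd.isExactOn_ball.with_val_at 0 0
  choose G h1 h2 using this
  exact ⟨G, h1, h2⟩

lemma exists_isChartPath (hp : IsLocalParam F r x y h T) {G : ℕ → ℂ → ℂ}
    (hG : ∀ k, ∀ τ ∈ ball (0 : ℂ) r, HasDerivAt (G k) (x τ ^ k * h τ) τ)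
    {a b : ℂ} (ha : a ∈ ball (0 : ℂ) r) (hb : b ∈ ball (0 : ℂ) r) :
    ∃ X Y v : ℝ → ℂ, IsChartPath F X Y v ∧ X 0 = x a ∧ Y 0 = y a ∧ X 1 = x b ∧ Y 1 = y b ∧
      ∀ k : ℕ, ∫ t in (0 : ℝ)..1, X t ^ k * v t = G k b - G k a := by
  set τ : ℝ → ℂ := fun t => a + t * (b - a) with hτ
  have hm : ∀ t ∈ Set.Icc (0 : ℝ) 1, τ t ∈ ball (0 : ℂ) r := by
    intro t ht
    have := (convex_ball (0 : ℂ) r).add_smul_sub_mem ha hb ht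
    simpa [hτ] using this
  have hd (t : ℝ) : HasDerivAt τ (b - a) t := by
    exact (((Complex.ofRealCLM.hasDerivAt (x := t)).mul_const (b - a)).const_add a).congr_deriv
      (by simp)
  have hτc : Continuous τ := continuous_iff_continuousAt.2 fun t => (hd t).continuousAt
  have hhc : ContinuousOn (fun t => h (τ t)) (Set.Icc 0 1) :=
    hp.diff.continuousOn.comp hτc.continuousOn hm
  have hxc : ContinuousOn (fun t => x (τ t)) (Set.Icc 0 1) := fun t ht =>
    ((hp.deriv_x _ (hm t ht)).continuousAt.comp hτc.continuousAt).continuousWithinAt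
  refine ⟨fun t => x (τ t), fun t => y (τ t), fun t => h (τ t) * (b - a), ⟨?_, ?_⟩, ?_, ?_, ?_, ?_,
    ?_⟩
  · exact hhc.mul continuousOn_const
  · intro t ht
    refine ⟨hp.eqn _ (hm t ht), ?_, ?_⟩
    · exact ((hp.deriv_x _ (hm t ht)).comp t (hd t)).hasDerivWithinAt.congr_deriv (by ring)
    · exact ((hp.deriv_y _ (hm t ht)).comp t (hd t)).hasDerivWithinAt.congr_deriv (by ring)
  · simp [hτ]
  · simp [hτ]
  · simp [hτ]
  · simp [hτ]
  · intro k
    have h1 : ∀ t ∈ Set.uIcc (0 : ℝ) 1,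
        HasDerivAt (fun t => G k (τ t)) (x (τ t) ^ k * (h (τ t) * (b - a))) t := by
      intro t ht
      rw [Set.uIcc_of_le zero_le_one] at ht
      exact ((hG k _ (hm t ht)).comp t (hd t)).congr_deriv (by ring)
    rw [intervalIntegral.integral_eq_sub_of_hasDerivAt h1]
    · simp [hτ]
    · apply ContinuousOn.intervalIntegrable
      rw [Set.uIcc_of_le zero_le_one]
      exact (hxc.pow k).mul (hhc.mul continuousOn_const)

/-- The open mapping theorem is needed rather than the inverse function theorem, since `x ^ k dx /
y` may vanish at the centre. If the primitive were constant, then x would vanish identically, hence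
so would y, and the derivative of y would force F' = 0 at a root of F. -/
lemma nhds_le_map (hp : IsLocalParam F r x y h T)
    (hs : F.eval (x 0) = 0 → F.derivative.eval (x 0) ≠ 0) {G : ℕ → ℂ → ℂ} (h0 : ∀ k, G k 0 = 0)
    (hG : ∀ k, ∀ τ ∈ ball (0 : ℂ) r, HasDerivAt (G k) (x τ ^ k * h τ) τ) (k : ℕ) :
    𝓝 0 ≤ map (G k) (𝓝 0) := by
  have hball : ball (0 : ℂ) r ∈ 𝓝 0 := isOpen_ball.mem_nhds hp.zero_mem
  have han : AnalyticAt ℂ (G k) 0 := by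
    refine DifferentiableOn.analyticAt (s := ball 0 r) (fun τ hτ => ?_) hball
    exact (hG k τ hτ).differentiableAt.differentiableWithinAt
  rcases han.eventually_constant_or_nhds_le_map_nhds with hc | hc
  · exfalso
    have hx : ∀ᶠ τ in 𝓝 (0 : ℂ), x τ = 0 := by
      filter_upwards [hc.eventually_nhds, hball] with τ h1 h2
      have h3 := (hG k τ h2).unique ((hasDerivAt_const τ (G k 0)).congr_of_eventuallyEq h1)
      exact eq_zero_of_pow_eq_zero ((mul_eq_zero.1 h3).resolve_right (hp.ne_zero τ h2))
    have hy : ∀ᶠ τ in 𝓝 (0 : ℂ), y τ = 0 := by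
      filter_upwards [hx.eventually_nhds, hball] with τ h1 h2
      have h3 := (hp.deriv_x τ h2).unique ((hasDerivAt_const τ 0).congr_of_eventuallyEq h1)
      exact (mul_eq_zero.1 h3).resolve_right (hp.ne_zero τ h2)
    have h3 := (hp.deriv_y 0 hp.zero_mem).unique
      ((hasDerivAt_const 0 0).congr_of_eventuallyEq hy)
    have h4 := (mul_eq_zero.1 h3).resolve_right (hp.ne_zero 0 hp.zero_mem)
    have h5 := hp.eqn 0 hp.zero_mem
    rw [hy.self_of_nhds] at h5
    exact hs (by rw [← h5]; simp) (by simpa using h4)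
  · rwa [h0] at hc

lemma tendsto_T (hp : IsLocalParam F r x y h T) : Tendsto T (𝓝 (x 0, y 0)) (𝓝 0) := by
  have := hp.diff_T.continuous.tendsto (x 0, y 0)
  rwa [hp.T_zero] at this

end IsLocalParam

/-- The point of the statement is uniformity: one `ε` serves all starting points q near the given
one, which is what a compactness argument can use. -/
lemma exists_isChartPath_of_small_integral {F : ℂ[X]} {x₀ y₀ : ℂ} (h₀ : y₀ ^ 2 = F.eval x₀)
    (hs : F.eval x₀ = 0 → F.derivative.eval x₀ ≠ 0) (k : ℕ) :
    ∃ ε > 0, ∀ᶠ q in 𝓝 (x₀, y₀), q.2 ^ 2 = F.eval q.1 → ∀ c : ℂ, ‖c‖ < ε →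
      ∃ x y v : ℝ → ℂ, IsChartPath F x y v ∧ (x 0, y 0) = q ∧
        ∫ t in (0 : ℝ)..1, x t ^ k * v t = c := by
  obtain ⟨r, x, y, h, T, hp, rfl, rfl⟩ := exists_isLocalParam h₀ hs
  obtain ⟨G, h0, hG⟩ := hp.exists_primitive
  have hle := hp.nhds_le_map hs h0 hG k
  have hball : ball (0 : ℂ) r ∈ 𝓝 0 := isOpen_ball.mem_nhds hp.zero_mem
  obtain ⟨ε, hε, hsub⟩ := Metric.mem_nhds_iff.1 (hle (image_mem_map hball))
  -- One half of `ε` absorbs the value of the primitive at the starting point q, the other half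
  -- absorbs c.
  refine ⟨ε / 2, half_pos hε, ?_⟩
  have hGc : Tendsto (G k) (𝓝 0) (𝓝 0) := by
    have := (hG k 0 hp.zero_mem).continuousAt.tendsto
    rwa [h0] at this
  have h1 := hp.tendsto_T.eventually (hGc.eventually (ball_mem_nhds 0 (half_pos hε)))
  filter_upwards [hp.inv, hp.tendsto_T.eventually hball, h1] with q hq hb hg he c hc
  have hmem : G k (T q) + c ∈ ball (0 : ℂ) ε := by
    rw [dist_zero_right] at hg
    rw [mem_ball_zero_iff]
    linarith [norm_add_le (G k (T q)) c]
  obtain ⟨b, hb', hbc⟩ := hsub hmem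
  obtain ⟨X, Y, v, hc, hX0, hY0, -, -, hint⟩ := hp.exists_isChartPath hG hb hb'
  refine ⟨X, Y, v, hc, ?_, ?_⟩
  · rw [hq he, hX0, hY0, ← hq he]
  · rw [hint, hbc]; ring

lemma exists_isChartPath_to_nearby {F : ℂ[X]} {x₀ y₀ : ℂ} (h₀ : y₀ ^ 2 = F.eval x₀)
    (hs : F.eval x₀ = 0 → F.derivative.eval x₀ ≠ 0) :
    ∀ᶠ q in 𝓝 (x₀, y₀), q.2 ^ 2 = F.eval q.1 →
      ∃ x y v : ℝ → ℂ, IsChartPath F x y v ∧ (x 0, y 0) = (x₀, y₀) ∧ (x 1, y 1) = q := by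
  obtain ⟨r, x, y, h, T, hp, rfl, rfl⟩ := exists_isLocalParam h₀ hs
  obtain ⟨G, h0, hG⟩ := hp.exists_primitive
  have hball : ball (0 : ℂ) r ∈ 𝓝 0 := isOpen_ball.mem_nhds hp.zero_mem
  filter_upwards [hp.inv, hp.tendsto_T.eventually hball] with q hq hb he
  obtain ⟨X, Y, v, hc, hX0, hY0, hX1, hY1, -⟩ := hp.exists_isChartPath hG hp.zero_mem hb
  exact ⟨X, Y, v, hc, by rw [hX0, hY0], by rw [hX1, hY1, ← hq he]⟩

/-- `y ^ 2 = f x` is a smooth model of odd degree `2 g + 1`. -/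
structure IsSmoothOdd (g : ℕ) (f : ℂ[X]) : Prop where
  natDegree_eq : f.natDegree = 2 * g + 1
  smooth : ∀ x, f.eval x = 0 → f.derivative.eval x ≠ 0

/-! ### The chart at infinity of a smooth model of odd degree -/

section Infinity

variable {g : ℕ} {f : ℂ[X]}

lemma IsSmoothOdd.eval_infinite (hf : IsSmoothOdd g f) {ξ : ℂ} (hξ : ξ ≠ 0) :
    (X * f.reverse).eval ξ = f.eval (1 / ξ) * ξ ^ (2 * g + 2) := by
  let := invertibleOfNonzero (inv_ne_zero hξ)
  have h := eval₂_reverse_mul_pow (RingHom.id ℂ) (ξ⁻¹) f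
  rw [hf.natDegree_eq, invOf_eq_inv, inv_inv] at h
  simp only [eval₂_id] at h
  rw [eval_mul, eval_X, one_div, ← h, pow_succ ξ (2 * g + 1), inv_pow]
  field_simp

lemma IsSmoothOdd.infinite_smooth (hf : IsSmoothOdd g f) :
    (X * f.reverse).derivative.eval 0 ≠ 0 := by
  have h0 : f ≠ 0 := by
    rintro rfl
    simpa using hf.natDegree_eq
  simpa [← coeff_zero_eq_eval_zero, coeff_zero_reverse] using h0

lemma IsSmoothOdd.exists_inInfiniteChart (hf : IsSmoothOdd g f) {ξ η : ℂ}
    (h : η ^ 2 = (X * f.reverse).eval ξ) : ∃ P : HPoint f, P.InInfiniteChart g ξ η := by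
  by_cases hξ : ξ = 0
  · subst hξ
    refine ⟨.inf, rfl, ?_⟩
    simpa using h
  · rw [hf.eval_infinite hξ] at h
    refine ⟨.aff (1 / ξ) (η / ξ ^ (g + 1)) ?_, ?_, ?_, ?_⟩
    · rw [div_pow, h]
      field_simp
      ring
    · simpa using hξ
    · simp
    · rw [one_div, inv_pow, div_inv_eq_mul]
      field_simp

lemma IsSmoothOdd.infinite_eqn (hf : IsSmoothOdd g f) {P : HPoint f} {ξ η : ℂ}
    (h : P.InInfiniteChart g ξ η) : η ^ 2 = (X * f.reverse).eval ξ := by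
  cases P with
  | inf =>
    obtain ⟨rfl, rfl⟩ := h
    simp
  | aff a b hab =>
    obtain ⟨ha, rfl, rfl⟩ := h
    rw [hf.eval_infinite (by simpa using ha), one_div_one_div, div_pow, hab, one_div, inv_pow,
      ← pow_mul, div_eq_mul_inv]
    ring_nf

lemma HPoint.exists_inAffineChart {x y : ℂ} (h : y ^ 2 = f.eval x) :
    ∃ P : HPoint f, P.InAffineChart x y := ⟨.aff x y h, rfl, rfl⟩

end Infinity

/-! ### Existence of paths and additivity of their integrals -/

section Paths

variable {g : ℕ} {f : ℂ[X]}

lemma IsSmoothOdd.infinite_smooth_of_eq (hf : IsSmoothOdd g f) :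
    (X * f.reverse).eval 0 = 0 → (X * f.reverse).derivative.eval 0 ≠ 0 :=
  fun _ => hf.infinite_smooth

/-- On the curve a small ξ forces a small η, because η² is a polynomial in ξ without constant term.
-/
lemma tendsto_inv_of_inInfiniteChart (hf : IsSmoothOdd g f) {U : Set (ℂ × ℂ)}
    (hU : U ∈ 𝓝 ((0 : ℂ), (0 : ℂ))) :
    ∃ δ > 0, ∀ (P : HPoint f) (ξ η : ℂ), P.InInfiniteChart g ξ η → ‖ξ‖ < δ → (ξ, η) ∈ U := by
  obtain ⟨ε, hε, hb⟩ := Metric.mem_nhds_iff.1 hU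
  have hc : Tendsto (fun ξ => (X * f.reverse).eval ξ) (𝓝 0) (𝓝 0) := by
    have := (X * f.reverse).continuous.tendsto (0 : ℂ)
    simpa using this
  obtain ⟨δ, hδ, hd⟩ := Metric.eventually_nhds_iff.1
    (hc.eventually (ball_mem_nhds 0 (pow_pos hε 2)))
  refine ⟨min δ ε, lt_min hδ hε, fun P ξ η hP hξ => hb ?_⟩
  have h1 := hd (y := ξ) (by rw [dist_zero_right]; exact hξ.trans_le (min_le_left _ _))
  rw [← hf.infinite_eqn hP, dist_zero_right, norm_pow] at h1
  have h2 := lt_of_pow_lt_pow_left₀ 2 hε.le h1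
  rw [mem_ball, Prod.dist_eq, max_lt_iff, dist_zero_right, dist_zero_right]
  exact ⟨hξ.trans_le (min_le_right _ _), h2⟩

/-- The affine points `(x, y)` with `‖x‖ ≤ R` form a compact set. -/
lemma isCompact_affine (f : ℂ[X]) (R : ℝ) :
    IsCompact {q : ℂ × ℂ | ‖q.1‖ ≤ R ∧ q.2 ^ 2 = f.eval q.1} := by
  obtain ⟨M, hM⟩ := (isCompact_closedBall (0 : ℂ) R).exists_bound_of_continuousOn
    f.continuous.continuousOn
  have hsub : {q : ℂ × ℂ | ‖q.1‖ ≤ R ∧ q.2 ^ 2 = f.eval q.1} ⊆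
      closedBall (0 : ℂ) R ×ˢ closedBall (0 : ℂ) (M + 1) := by
    rintro ⟨x, y⟩ ⟨hx, hy⟩
    simp only at hx hy
    have h1 := hM x (by simpa using hx)
    have h0 : 0 ≤ M := (norm_nonneg _).trans h1
    rw [← hy, norm_pow] at h1
    refine ⟨by simpa using hx, ?_⟩
    rw [mem_closedBall_zero_iff]
    nlinarith [norm_nonneg y]
  refine ((isCompact_closedBall _ _).prod (isCompact_closedBall _ _)).of_isClosed_subset ?_ hsub
  exact (isClosed_le continuous_fst.norm continuous_const).inter
    (isClosed_eq (continuous_snd.pow 2) (f.continuous.comp continuous_fst))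

/-- The compact curve is covered by a neighbourhood of infinity and the compact set `‖x‖ ≤ 2 / δ`;
finitely many local bounds then have a positive minimum. -/
lemma exists_uniform_pathIntegral (hf : IsSmoothOdd g f) (k : Fin g) :
    ∃ ε > 0, ∀ (P : HPoint f) (c : ℂ), ‖c‖ < ε → ∃ Q I, PathIntegral g f P Q I ∧ I k = c := by
  obtain ⟨ε₁, hε₁, h1⟩ := exists_isChartPath_of_small_integral (F := X * f.reverse) (x₀ := 0)
    (y₀ := 0) (by simp) hf.infinite_smooth_of_eq k.rev
  obtain ⟨δ, hδ, h2⟩ := tendsto_inv_of_inInfiniteChart hf h1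
  obtain ⟨ε₂, hε₂, h3⟩ : ∃ ε > 0, ∀ q ∈ {q : ℂ × ℂ | ‖q.1‖ ≤ 2 / δ ∧ q.2 ^ 2 = f.eval q.1},
      ∀ c : ℂ, ‖c‖ < ε → ∃ x y v : ℝ → ℂ, IsChartPath f x y v ∧ (x 0, y 0) = q ∧
        ∫ t in (0 : ℝ)..1, x t ^ (k : ℕ) * v t = c := by
    refine (isCompact_affine f (2 / δ)).induction_on
      (p := fun s => ∃ ε > 0, ∀ q ∈ s, ∀ c : ℂ, ‖c‖ < ε → ∃ x y v : ℝ → ℂ,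
        IsChartPath f x y v ∧ (x 0, y 0) = q ∧ ∫ t in (0 : ℝ)..1, x t ^ (k : ℕ) * v t = c)
      ⟨1, one_pos, by simp⟩ ?_ ?_ ?_
    · rintro s t hst ⟨ε, hε, h⟩
      exact ⟨ε, hε, fun q hq => h q (hst hq)⟩
    · rintro s t ⟨ε, hε, h⟩ ⟨ε', hε', h'⟩
      refine ⟨min ε ε', lt_min hε hε', ?_⟩
      rintro q (hq | hq) c hc
      · exact h q hq c (hc.trans_le (min_le_left _ _))
      · exact h' q hq c (hc.trans_le (min_le_right _ _))
    · rintro ⟨x₀, y₀⟩ ⟨-, hq⟩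
      obtain ⟨ε, hε, h⟩ := exists_isChartPath_of_small_integral hq (hf.smooth x₀) k
      exact ⟨_, inter_mem (mem_nhdsWithin_of_mem_nhds h) self_mem_nhdsWithin, ε, hε,
        fun q hq => hq.1 hq.2.2⟩
  refine ⟨min ε₁ ε₂, lt_min hε₁ hε₂, fun P c hc => ?_⟩
  have hinf (ξ η : ℂ) (hP : P.InInfiniteChart g ξ η) (hξ : ‖ξ‖ < δ) :
      ∃ Q I, PathIntegral g f P Q I ∧ I k = c := by
    -- The value -c compensates for the sign of the differential in the chart at infinity.
    obtain ⟨x, y, v, hp, h0, hi⟩ := h2 P ξ η hP hξ (hf.infinite_eqn hP) (-c)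
      (by rw [norm_neg]; exact hc.trans_le (min_le_left _ _))
    obtain ⟨Q, hQ⟩ := hf.exists_inInfiniteChart (hp.2 1 (by simp)).1
    rw [Prod.mk.injEq] at h0
    refine ⟨Q, _, .infinite P Q x y v hp (by rwa [h0.1, h0.2]) hQ, ?_⟩
    simp only [hi, neg_neg]
  cases P with
  | inf => exact hinf 0 0 ⟨rfl, rfl⟩ (by simpa using hδ)
  | aff a b hab =>
    by_cases ha : ‖a‖ ≤ 2 / δ
    · obtain ⟨x, y, v, hp, h0, hi⟩ := h3 (a, b) ⟨ha, hab⟩ c (hc.trans_le (min_le_right _ _))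
      obtain ⟨Q, hQ⟩ := HPoint.exists_inAffineChart (hp.2 1 (by simp)).1
      rw [Prod.mk.injEq] at h0
      exact ⟨Q, _, .affine _ Q x y v hp ⟨h0.1, h0.2⟩ hQ, hi⟩
    · rw [not_le] at ha
      have h0 : 0 < ‖a‖ := (by positivity : 0 < 2 / δ).trans ha
      refine hinf (1 / a) (b / a ^ (g + 1)) ⟨by simpa using h0, rfl, rfl⟩ ?_
      rw [norm_div, norm_one, div_lt_iff₀ h0]
      rw [div_lt_iff₀ hδ] at ha
      linarith

/-- From every point, every complex number is the value of the `k`-th integral along some path. -/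
theorem exists_pathIntegral_apply_eq (hf : IsSmoothOdd g f) (k : Fin g) (P : HPoint f) (c : ℂ) :
    ∃ Q I, PathIntegral g f P Q I ∧ I k = c := by
  obtain ⟨ε, hε, h⟩ := exists_uniform_pathIntegral hf k
  obtain ⟨n, hn⟩ := exists_nat_gt (‖c‖ / ε)
  have hn0 : (0 : ℝ) < n := (by positivity : 0 ≤ ‖c‖ / ε).trans_lt hn
  have hc : ‖c / n‖ < ε := by
    rw [norm_div, Complex.norm_natCast, div_lt_iff₀ hn0]
    rwa [div_lt_iff₀ hε, mul_comm] at hn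
  -- Since `ε` does not depend on the point, pieces of integral `c / n` can be concatenated; `m + 1`
  -- of them are used, to avoid an empty path.
  have key (m : ℕ) : ∃ Q I, PathIntegral g f P Q I ∧ I k = (m + 1) * (c / n) := by
    induction m with
    | zero => simpa using h P _ hc
    | succ m ih =>
      obtain ⟨Q, I, hI, hk⟩ := ih
      obtain ⟨R, J, hJ, hk'⟩ := h Q _ hc
      refine ⟨R, _, hI.trans _ _ _ _ _ hJ, ?_⟩
      rw [Pi.add_apply, hk, hk']
      push_cast
      ring
  obtain ⟨m, rfl⟩ : ∃ m, n = m + 1 := Nat.exists_eq_succ_of_ne_zero (by rintro rfl; simp at hn0)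
  obtain ⟨Q, I, hI, hk⟩ := key m
  refine ⟨Q, I, hI, hk.trans ?_⟩
  have : ((m + 1 : ℕ) : ℂ) ≠ 0 := by exact_mod_cast hn0.ne'
  push_cast at this ⊢
  field_simp

lemma IsChartPath.neg {F : ℂ[X]} {x y v : ℝ → ℂ} (h : IsChartPath F x y v) :
    IsChartPath F x (fun t => -y t) (fun t => -v t) := by
  refine ⟨h.1.neg, fun t ht => ?_⟩
  obtain ⟨h1, h2, h3⟩ := h.2 t ht
  exact ⟨by rw [neg_sq, h1], h2.congr_deriv (by ring), h3.neg.congr_deriv (by ring)⟩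

lemma HPoint.InAffineChart.neg {P : HPoint f} {x y : ℂ} (h : P.InAffineChart x y) :
    P.neg.InAffineChart x (-y) := by
  cases P with
  | inf => exact h
  | aff a b hab =>
    obtain ⟨rfl, rfl⟩ := h
    exact ⟨rfl, rfl⟩

lemma HPoint.InInfiniteChart.neg {P : HPoint f} {x y : ℂ} (h : P.InInfiniteChart g x y) :
    P.neg.InInfiniteChart g x (-y) := by
  cases P with
  | inf =>
    obtain ⟨rfl, rfl⟩ := h
    exact ⟨rfl, neg_zero⟩
  | aff a b hab =>
    obtain ⟨h0, rfl, rfl⟩ := h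
    exact ⟨h0, rfl, (neg_div _ _).symm⟩

lemma PathIntegral.neg {P Q : HPoint f} {I : Fin g → ℂ} (h : PathIntegral g f P Q I) :
    PathIntegral g f P.neg Q.neg (-I) := by
  induction h with
  | affine P Q x y v h hP hQ =>
    convert PathIntegral.affine (g := g) _ _ _ _ _ h.neg hP.neg hQ.neg using 1
    funext k
    simp
  | infinite P Q x y v h hP hQ =>
    convert PathIntegral.infinite (g := g) _ _ _ _ _ h.neg hP.neg hQ.neg using 1
    funext k
    simp
  | trans P Q R I J _ _ hI hJ =>
    rw [neg_add]
    exact .trans _ _ _ _ _ hI hJ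

/-- Every point over an `x` near `x₀` is joined to some point over `x₀`. -/
lemma exists_pathIntegral_to_fibre (hf : IsSmoothOdd g f) (x₀ : ℂ) :
    ∀ᶠ x in 𝓝 x₀, ∀ (y : ℂ) (h : y ^ 2 = f.eval x), ∃ (y₀ : ℂ) (h₀ : y₀ ^ 2 = f.eval x₀) (I : _),
      PathIntegral g f (.aff x₀ y₀ h₀) (.aff x y h) I := by
  obtain ⟨y₀, hy₀⟩ := IsAlgClosed.exists_pow_nat_eq (f.eval x₀) (n := 2) two_pos
  have h1 := exists_isChartPath_to_nearby hy₀ (hf.smooth x₀)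
  have h2 := exists_isChartPath_to_nearby (y₀ := -y₀) (by rwa [neg_sq]) (hf.smooth x₀)
  obtain ⟨δ, hδ, h1⟩ := Metric.eventually_nhds_iff.1 h1
  obtain ⟨δ', hδ', h2⟩ := Metric.eventually_nhds_iff.1 h2
  set ε := min δ δ' with hε
  have hε0 : 0 < ε := lt_min hδ hδ'
  have hc : Tendsto (fun x => f.eval x) (𝓝 x₀) (𝓝 (f.eval x₀)) := f.continuous.tendsto x₀
  filter_upwards [hc.eventually (ball_mem_nhds _ (pow_pos hε0 2)), ball_mem_nhds x₀ hε0]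
    with x hx hxε y hy
  rw [dist_eq_norm, ← hy, ← hy₀, sq_sub_sq, norm_mul, sq] at hx
  rw [mem_ball] at hxε
  -- The product of `y - y₀` and `y + y₀` has norm below ε², so one factor has norm below ε: the
  -- point is near one of the two points over `x₀`.
  have hor : ‖y - y₀‖ < ε ∨ ‖y + y₀‖ < ε := by
    by_contra! hcon
    exact absurd hx (not_lt.2 (mul_le_mul hcon.2 hcon.1 hε0.le (norm_nonneg _)))
  have fin (y₁ : ℂ) (h₁ : y₁ ^ 2 = f.eval x₀) (hp : ∃ X Y v : ℝ → ℂ, IsChartPath f X Y v ∧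
      (X 0, Y 0) = (x₀, y₁) ∧ (X 1, Y 1) = (x, y)) :
      ∃ (y₀ : ℂ) (h₀ : y₀ ^ 2 = f.eval x₀) (I : _),
        PathIntegral g f (.aff x₀ y₀ h₀) (.aff x y hy) I := by
    obtain ⟨X, Y, v, hp, h0, h1⟩ := hp
    rw [Prod.mk.injEq] at h0 h1
    exact ⟨y₁, h₁, _, .affine _ _ X Y v hp h0 h1⟩
  rcases hor with h | h
  · refine fin y₀ hy₀ (h1 ?_ hy)
    rw [Prod.dist_eq, max_lt_iff, dist_eq_norm y]
    exact ⟨hxε.trans_le (min_le_left _ _), h.trans_le (min_le_left _ _)⟩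
  · refine fin (-y₀) (by rwa [neg_sq]) (h2 ?_ hy)
    rw [Prod.dist_eq, max_lt_iff, dist_eq_norm y, sub_neg_eq_add]
    exact ⟨hxε.trans_le (min_le_right _ _), h.trans_le (min_le_right _ _)⟩

/-- The abscissae over which some point can be reached from infinity form a nonempty clopen subset
of ℂ. The involution fixes infinity, so reaching one point of a fibre means reaching both. -/
lemma exists_pathIntegral_inf (hf : IsSmoothOdd g f) (P : HPoint f) :
    ∃ I, PathIntegral g f .inf P I := by
  have hneg {P : HPoint f} (h : ∃ I, PathIntegral g f .inf P I) :
      ∃ I, PathIntegral g f .inf P.neg I := h.imp' _ fun _ h => h.neg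
  have hfib {x y y' : ℂ} {h : y ^ 2 = f.eval x} (h' : y' ^ 2 = f.eval x)
      (hI : ∃ I, PathIntegral g f .inf (.aff x y h) I) :
      ∃ I, PathIntegral g f .inf (.aff x y' h') I := by
    rcases sq_eq_sq_iff_eq_or_eq_neg.1 (h'.trans h.symm) with rfl | rfl
    · exact hI
    · exact hneg hI
  set S : Set ℂ := {x | ∃ y h I, PathIntegral g f .inf (.aff x y h) I} with hS
  have hopen : IsOpen S := by
    rw [isOpen_iff_eventually]
    rintro x₀ ⟨y₀, h₀, I, hI⟩
    filter_upwards [exists_pathIntegral_to_fibre hf x₀] with x hx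
    obtain ⟨y, hy⟩ := IsAlgClosed.exists_pow_nat_eq (f.eval x) (n := 2) two_pos
    obtain ⟨y₁, h₁, J, hJ⟩ := hx y hy
    obtain ⟨K, hK⟩ := hfib h₁ ⟨I, hI⟩
    exact ⟨y, hy, _, hK.trans _ _ _ _ _ hJ⟩
  have hclosed : IsClosed S := by
    rw [← isOpen_compl_iff, isOpen_iff_eventually]
    intro x₀ hx₀
    filter_upwards [exists_pathIntegral_to_fibre hf x₀] with x hx
    rintro ⟨y, hy, I, hI⟩
    obtain ⟨y₁, h₁, J, hJ⟩ := hx y hy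
    exact hx₀ ⟨y₁, h₁, _, hI.trans _ _ _ _ _ hJ.symm⟩
  have hne : S.Nonempty := by
    obtain ⟨δ, hδ, h⟩ := tendsto_inv_of_inInfiniteChart hf (exists_isChartPath_to_nearby
      (F := X * f.reverse) (x₀ := 0) (y₀ := 0) (by simp) hf.infinite_smooth_of_eq)
    set ξ : ℂ := ((δ / 2 : ℝ) : ℂ) with hξ
    have hξ0 : ξ ≠ 0 := by
      rw [hξ]
      exact_mod_cast (half_pos hδ).ne'
    obtain ⟨η, hη⟩ := IsAlgClosed.exists_pow_nat_eq ((X * f.reverse).eval ξ) (n := 2) two_pos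
    obtain ⟨P, hP⟩ := hf.exists_inInfiniteChart hη
    obtain ⟨x, y, v, hp, h0, h1⟩ := h P ξ η hP (by
      rw [hξ, Complex.norm_real, Real.norm_eq_abs, abs_of_pos (half_pos hδ)]
      linarith) hη
    rw [Prod.mk.injEq] at h0 h1
    cases P with
    | inf => exact absurd hP.1 hξ0
    | aff a b hab =>
      exact ⟨a, b, hab, _, .infinite _ _ x y v hp h0 (by rwa [h1.1, h1.2])⟩
  have huniv : S = Set.univ := IsClopen.eq_univ ⟨hclosed, hopen⟩ hne
  cases P with
  | inf =>
    obtain ⟨x, y, h, I, hI⟩ := hne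
    exact ⟨_, hI.trans _ _ _ _ _ hI.symm⟩
  | aff a b hab =>
    obtain ⟨y, h, hI⟩ : a ∈ S := by rw [huniv]; trivial
    exact hfib hab hI

/-- The curve is path connected. -/
theorem exists_pathIntegral (hf : IsSmoothOdd g f) (P Q : HPoint f) :
    ∃ I, PathIntegral g f P Q I := by
  obtain ⟨I, hI⟩ := exists_pathIntegral_inf hf P
  obtain ⟨J, hJ⟩ := exists_pathIntegral_inf hf Q
  exact ⟨_, hI.symm.trans _ _ _ _ _ hJ⟩

theorem abelInt_add_abelInt (hf : IsSmoothOdd g f) (P Q R : HPoint f) :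
    abelInt g f P Q + abelInt g f Q R = abelInt g f P R := by
  obtain ⟨I, hI⟩ := exists_pathIntegral hf P Q
  obtain ⟨J, hJ⟩ := exists_pathIntegral hf Q R
  rw [abelInt_eq hI, abelInt_eq hJ, abelInt_eq (hI.trans _ _ _ _ _ hJ), QuotientAddGroup.mk_add]

end Paths

/-! ## The elliptic curve and its group law -/

/-- The elliptic curve `y ^ 2 = x ^ 3 - A x - B`. -/
noncomputable def ellCurve (A B : ℂ) : WeierstrassCurve.Affine ℂ :=
  { a₁ := 0, a₂ := 0, a₃ := 0, a₄ := -A, a₆ := -B }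

section Elliptic

variable {A B : ℂ}

lemma ellCurve_nonsingular (hΔ : 4 * A ^ 3 ≠ 27 * B ^ 2) {x y : ℂ}
    (h : y ^ 2 = x ^ 3 - A * x - B) : (ellCurve A B).Nonsingular x y := by
  rw [WeierstrassCurve.Affine.nonsingular_iff, WeierstrassCurve.Affine.equation_iff]
  simp only [ellCurve]
  refine ⟨by linear_combination h, ?_⟩
  by_contra! hc
  obtain ⟨h1, h2⟩ := hc
  have hy : y = 0 := by linear_combination h2 / 2
  subst hy
  have h3 : 3 * x ^ 2 = A := by linear_combination -h1
  have h4 : B = -2 * x ^ 3 := by linear_combination h + x * h3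
  exact hΔ (by rw [h4, ← h3]; ring)

lemma ellCurve_nonsingular_iff (hΔ : 4 * A ^ 3 ≠ 27 * B ^ 2) {x y : ℂ} :
    (ellCurve A B).Nonsingular x y ↔ y ^ 2 = x ^ 3 - A * x - B := by
  refine ⟨fun h => ?_, ellCurve_nonsingular hΔ⟩
  have := ((WeierstrassCurve.Affine.nonsingular_iff ..).1 h).1
  rw [WeierstrassCurve.Affine.equation_iff] at this
  simp only [ellCurve] at this
  linear_combination this

open Classical in
/-- The point `(x, y)`. -/
noncomputable def ellPt (A B x y : ℂ) : (ellCurve A B).Point :=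
  if h : (ellCurve A B).Nonsingular x y then .some x y h else 0

open Classical in
/-- The point with the coordinates `ξ = 1 / x`, `η = y / x ^ 2`. -/
noncomputable def ellPtInf (A B ξ η : ℂ) : (ellCurve A B).Point :=
  if ξ = 0 then 0 else ellPt A B (1 / ξ) (η / ξ ^ 2)

lemma ellPt_eq_some (hΔ : 4 * A ^ 3 ≠ 27 * B ^ 2) {x y : ℂ} (h : y ^ 2 = x ^ 3 - A * x - B) :
    ellPt A B x y = .some x y (ellCurve_nonsingular hΔ h) :=
  dif_pos _

@[simp] lemma ellPtInf_zero (η : ℂ) : ellPtInf A B 0 η = 0 := if_pos rfl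

lemma ellPtInf_of_ne_zero {ξ : ℂ} (h : ξ ≠ 0) (η : ℂ) :
    ellPtInf A B ξ η = ellPt A B (1 / ξ) (η / ξ ^ 2) := if_neg h

lemma infinite_eqn_iff {ξ η : ℂ} (hξ : ξ ≠ 0) :
    (η / ξ ^ 2) ^ 2 = (1 / ξ) ^ 3 - A * (1 / ξ) - B ↔ η ^ 2 = ξ - A * ξ ^ 3 - B * ξ ^ 4 := by
  field_simp

lemma neg_ellPt (hΔ : 4 * A ^ 3 ≠ 27 * B ^ 2) {x y : ℂ} (h : y ^ 2 = x ^ 3 - A * x - B) :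
    -ellPt A B x y = ellPt A B x (-y) := by
  rw [ellPt_eq_some hΔ h, ellPt_eq_some hΔ (by rwa [neg_sq]), WeierstrassCurve.Affine.Point.neg_some]
  simp [ellCurve, WeierstrassCurve.Affine.negY]

lemma neg_ellPtInf (hΔ : 4 * A ^ 3 ≠ 27 * B ^ 2) {ξ η : ℂ}
    (h : η ^ 2 = ξ - A * ξ ^ 3 - B * ξ ^ 4) : -ellPtInf A B ξ η = ellPtInf A B ξ (-η) := by
  by_cases hξ : ξ = 0
  · subst hξ
    simp
  · rw [ellPtInf_of_ne_zero hξ, ellPtInf_of_ne_zero hξ,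
      neg_ellPt hΔ ((infinite_eqn_iff hξ).2 h), neg_div]

/-- The slope enters through its defining equation, so that simplified expressions for it may be
supplied. The curve equation of the sum is returned as well, since `ellPt` is 0 by default off the
curve. -/
lemma ellPt_add_of_X_ne (hΔ : 4 * A ^ 3 ≠ 27 * B ^ 2) {x₁ y₁ x₂ y₂ : ℂ}
    (h₁ : y₁ ^ 2 = x₁ ^ 3 - A * x₁ - B) (h₂ : y₂ ^ 2 = x₂ ^ 3 - A * x₂ - B) (hx : x₁ ≠ x₂)
    {l x₃ y₃ : ℂ} (hl : l * (x₁ - x₂) = y₁ - y₂) (hx₃ : x₃ = l ^ 2 - x₁ - x₂)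
    (hy₃ : y₃ = -(l * (x₃ - x₁) + y₁)) :
    y₃ ^ 2 = x₃ ^ 3 - A * x₃ - B ∧ ellPt A B x₁ y₁ + ellPt A B x₂ y₂ = ellPt A B x₃ y₃ := by
  have hl' : (ellCurve A B).slope x₁ x₂ y₁ y₂ = l := by
    rw [WeierstrassCurve.Affine.slope_of_X_ne hx, div_eq_iff (sub_ne_zero.2 hx), hl]
  have hns := WeierstrassCurve.Affine.nonsingular_add (ellCurve_nonsingular hΔ h₁)
    (ellCurve_nonsingular hΔ h₂) (fun h => hx h.1)
  have e := WeierstrassCurve.Affine.Point.add_of_X_ne (h₁ := ellCurve_nonsingular hΔ h₁)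
    (h₂ := ellCurve_nonsingular hΔ h₂) hx
  rw [ellPt_eq_some hΔ h₁, ellPt_eq_some hΔ h₂, e]
  have hX : (ellCurve A B).addX x₁ x₂ l = x₃ := by
    simp [WeierstrassCurve.Affine.addX, ellCurve, hx₃]
  have hY : (ellCurve A B).addY x₁ x₂ y₁ l = y₃ := by
    rw [WeierstrassCurve.Affine.addY, WeierstrassCurve.Affine.negAddY, hX, hy₃]
    simp [WeierstrassCurve.Affine.negY, ellCurve]
  rw [hl', hX, hY] at hns
  refine ⟨(ellCurve_nonsingular_iff hΔ).1 hns, ?_⟩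
  rw [ellPt_eq_some hΔ ((ellCurve_nonsingular_iff hΔ).1 hns)]
  simp only [hl', hX, hY]

lemma ellPt_add_self (hΔ : 4 * A ^ 3 ≠ 27 * B ^ 2) {x₁ y₁ : ℂ}
    (h₁ : y₁ ^ 2 = x₁ ^ 3 - A * x₁ - B) (hy : y₁ ≠ 0)
    {l x₃ y₃ : ℂ} (hl : l * (2 * y₁) = 3 * x₁ ^ 2 - A) (hx₃ : x₃ = l ^ 2 - x₁ - x₁)
    (hy₃ : y₃ = -(l * (x₃ - x₁) + y₁)) :
    y₃ ^ 2 = x₃ ^ 3 - A * x₃ - B ∧ ellPt A B x₁ y₁ + ellPt A B x₁ y₁ = ellPt A B x₃ y₃ := by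
  have hy' : y₁ ≠ (ellCurve A B).negY x₁ y₁ := by
    simpa [WeierstrassCurve.Affine.negY, ellCurve, eq_neg_iff_add_eq_zero, ← two_mul] using hy
  have hl' : (ellCurve A B).slope x₁ x₁ y₁ y₁ = l := by
    rw [WeierstrassCurve.Affine.slope_of_Y_ne rfl hy', div_eq_iff (sub_ne_zero.2 hy')]
    simp only [WeierstrassCurve.Affine.negY, ellCurve]
    linear_combination -hl
  have hns := WeierstrassCurve.Affine.nonsingular_add (ellCurve_nonsingular hΔ h₁)
    (ellCurve_nonsingular hΔ h₁) (fun h => hy' h.2)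
  have e := WeierstrassCurve.Affine.Point.add_self_of_Y_ne (h₁ := ellCurve_nonsingular hΔ h₁) hy'
  rw [ellPt_eq_some hΔ h₁, e]
  have hX : (ellCurve A B).addX x₁ x₁ l = x₃ := by
    simp [WeierstrassCurve.Affine.addX, ellCurve, hx₃]
  have hY : (ellCurve A B).addY x₁ x₁ y₁ l = y₃ := by
    rw [WeierstrassCurve.Affine.addY, WeierstrassCurve.Affine.negAddY, hX, hy₃]
    simp [WeierstrassCurve.Affine.negY, ellCurve]
  rw [hl', hX, hY] at hns
  refine ⟨(ellCurve_nonsingular_iff hΔ).1 hns, ?_⟩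
  rw [ellPt_eq_some hΔ ((ellCurve_nonsingular_iff hΔ).1 hns)]
  simp only [hl', hX, hY]

/-- Numerator of the first coordinate of `ellPt x y + ellPtInf ξ η`, the denominator being
`(1 - x ξ) ^ 2`. -/
noncomputable def addNumX (A B x y ξ η : ℂ) : ℂ :=
  (x - A * ξ) * (1 + x * ξ) - 2 * B * ξ ^ 2 - 2 * y * η

/-- Numerator of the second coordinate of `ellPt x y + ellPtInf ξ η`, the denominator being
`(1 - x ξ) ^ 3`. -/
noncomputable def addNumY (A B x y ξ η : ℂ) : ℂ :=
  -(x * y * ξ ^ 3 * A) + x ^ 3 * ξ * η - 4 * y * ξ ^ 3 * B + x * ξ * η * A - 3 * y * ξ ^ 2 * A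
    - 2 * y ^ 2 * ξ * η + 3 * x * y * ξ - 3 * x ^ 2 * η + 2 * ξ * η * B + η * A + y

/-- Mixing the two charts gives an addition formula that stays regular at `ξ = 0`, so it can be
differentiated while the second point passes through infinity. -/
lemma ellPt_add_ellPtInf (hΔ : 4 * A ^ 3 ≠ 27 * B ^ 2) {x y ξ η : ℂ}
    (h : y ^ 2 = x ^ 3 - A * x - B) (h' : η ^ 2 = ξ - A * ξ ^ 3 - B * ξ ^ 4)
    (hD : 1 - x * ξ ≠ 0) :
    ellPt A B x y + ellPtInf A B ξ η =
      ellPt A B (addNumX A B x y ξ η / (1 - x * ξ) ^ 2) (addNumY A B x y ξ η / (1 - x * ξ) ^ 3) := by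
  by_cases hξ : ξ = 0
  · subst hξ
    have hη : η = 0 := by simpa using h'
    simp [hη, addNumX, addNumY]
  · rw [ellPtInf_of_ne_zero hξ]
    refine (ellPt_add_of_X_ne hΔ h ((infinite_eqn_iff hξ).2 h') (l := (η / ξ - y * ξ) / (1 - x * ξ))
      ?_ ?_ ?_ ?_).2
    · contrapose! hD
      rw [hD]
      field_simp
      simp
    · rw [div_mul_eq_mul_div, div_eq_iff hD]
      field_simp
      ring
    · rw [addNumX]
      field_simp
      linear_combination (-ξ ^ 4) * h - h'
    · rw [addNumY, addNumX]
      field_simp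
      linear_combination (-2 * y) * h'

end Elliptic

/-! ## The exponential map of the elliptic curve -/

/-- The extension is 2ⁿ φ(u / 2ⁿ) for n large; local additivity makes it independent of n, and a
common n for u, v and u + v gives additivity. -/
lemma exists_addMonoidHom_of_locally_additive {G : Type*} [AddCommGroup G] {φ : ℂ → G} {r : ℝ}
    (hr : 0 < r) (h : ∀ u v, ‖u‖ < r → ‖v‖ < r → φ (u + v) = φ u + φ v) :
    ∃ Φ : ℂ →+ G, ∀ u, ‖u‖ < r → Φ u = φ u := by
  have hhalf (u : ℂ) (hu : ‖u‖ < r) : φ u = 2 • φ (u / 2) := by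
    have h2 : ‖u / 2‖ < r := by
      rw [norm_div, Complex.norm_two]
      linarith [norm_nonneg u]
    rw [two_nsmul, ← h _ _ h2 h2, add_halves]
  have hnorm (u : ℂ) (n : ℕ) : ‖u / 2 ^ n‖ = ‖u‖ / 2 ^ n := by simp
  have hstep (u : ℂ) (n k : ℕ) (hu : ‖u / 2 ^ n‖ < r) :
      2 ^ (n + k) • φ (u / 2 ^ (n + k)) = 2 ^ n • φ (u / 2 ^ n) := by
    induction k with
    | zero => rfl
    | succ k ih =>
      have : ‖u / 2 ^ (n + k)‖ < r := by
        refine lt_of_le_of_lt ?_ hu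
        rw [hnorm, hnorm]
        exact div_le_div_of_nonneg_left (norm_nonneg _) (by positivity)
          (pow_le_pow_right₀ one_le_two (Nat.le_add_right _ _))
      rw [← ih, hhalf _ this, smul_smul, ← pow_succ, div_div, ← pow_succ, add_assoc]
  have hex (u : ℂ) : ∃ n : ℕ, ‖u / 2 ^ n‖ < r := by
    obtain ⟨n, hn⟩ := pow_unbounded_of_one_lt (‖u‖ / r) (one_lt_two (α := ℝ))
    refine ⟨n, ?_⟩
    rw [hnorm, div_lt_iff₀ (by positivity)]
    rwa [div_lt_iff₀ hr, mul_comm] at hn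
  choose N hN using hex
  have hmono (u : ℂ) (n m : ℕ) (hnm : n ≤ m) (hu : ‖u / 2 ^ n‖ < r) : ‖u / 2 ^ m‖ < r := by
    refine lt_of_le_of_lt ?_ hu
    rw [hnorm, hnorm]
    exact div_le_div_of_nonneg_left (norm_nonneg _) (by positivity)
      (pow_le_pow_right₀ one_le_two hnm)
  have heq (u : ℂ) (n : ℕ) (hu : ‖u / 2 ^ n‖ < r) :
      2 ^ N u • φ (u / 2 ^ N u) = 2 ^ n • φ (u / 2 ^ n) := by
    rw [← hstep u (N u) n (hN u), ← hstep u n (N u) hu, add_comm n]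
  refine ⟨AddMonoidHom.mk' (fun u => 2 ^ N u • φ (u / 2 ^ N u)) fun u v => ?_, fun u hu => ?_⟩
  · set n := max (N (u + v)) (max (N u) (N v)) with hn
    have h1 := hmono (u + v) _ n (by simp [hn]) (hN _)
    have h2 := hmono u _ n (by simp [hn]) (hN _)
    have h3 := hmono v _ n (by simp [hn]) (hN _)
    change 2 ^ N (u + v) • φ ((u + v) / 2 ^ N (u + v)) = _
    rw [heq (u + v) n h1, heq u n h2, heq v n h3, add_div, h _ _ h2 h3, smul_add]
  · have := heq u 0 (by simpa using hu)
    simpa using this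

lemma eq_of_eventually_const {α : Type*} {D : ℝ → α}
    (h : ∀ t₀ ∈ Set.Icc (0 : ℝ) 1, ∀ᶠ t in 𝓝[Set.Icc 0 1] t₀, D t = D t₀) : D 1 = D 0 := by
  have : IsLocallyConstant fun t : Set.Icc (0 : ℝ) 1 => D t := by
    rw [IsLocallyConstant.iff_eventually_eq]
    intro t
    exact (eventually_nhds_subtype_iff _ t fun t' => D t' = D t).2 (h t t.2)
  exact this.apply_eq_of_preconnectedSpace ⟨1, by simp⟩ ⟨0, by simp⟩

lemma eventually_eq_of_hasDerivWithinAt_zero {f : ℝ → ℂ} {t₀ : ℝ} (h₀ : t₀ ∈ Set.Icc (0 : ℝ) 1)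
    (h : ∀ᶠ t in 𝓝[Set.Icc 0 1] t₀, HasDerivWithinAt f 0 (Set.Icc 0 1) t) :
    ∀ᶠ t in 𝓝[Set.Icc 0 1] t₀, f t = f t₀ := by
  obtain ⟨ε, hε, hb⟩ := Metric.mem_nhdsWithin_iff.1 h
  have hconv : Convex ℝ (ball t₀ ε ∩ Set.Icc 0 1) := (convex_ball _ _).inter (convex_Icc _ _)
  filter_upwards [inter_mem (mem_nhdsWithin_of_mem_nhds (ball_mem_nhds t₀ hε))
    self_mem_nhdsWithin] with t ht
  have := hconv.norm_image_sub_le_of_norm_hasDerivWithin_le (f := f) (f' := fun _ => 0) (C := 0)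
    (fun t ht => (hb ht).mono Set.inter_subset_right) (by simp) ⟨mem_ball_self hε, h₀⟩ ht
  rw [zero_mul] at this
  exact sub_eq_zero.1 (norm_le_zero_iff.1 this)

/-- Near `t` in `[0, 1]`, `(x, y)` moves on the elliptic curve with `dx / y = v dt`. -/
structure IsAffineFlow (A B : ℂ) (x y v : ℝ → ℂ) (t : ℝ) : Prop where
  eqn : y t ^ 2 = x t ^ 3 - A * x t - B
  deriv_x : HasDerivWithinAt x (y t * v t) (Set.Icc 0 1) t
  deriv_y : HasDerivWithinAt y ((3 * x t ^ 2 - A) / 2 * v t) (Set.Icc 0 1) t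

/-- Near `t` in `[0, 1]`, the point `ξ = 1 / x`, `η = y / x ^ 2` moves on the elliptic curve with
`dx / y = v dt`. -/
structure IsInfiniteFlow (A B : ℂ) (ξ η v : ℝ → ℂ) (t : ℝ) : Prop where
  eqn : η t ^ 2 = ξ t - A * ξ t ^ 3 - B * ξ t ^ 4
  deriv_x : HasDerivWithinAt ξ (-η t * v t) (Set.Icc 0 1) t
  deriv_y : HasDerivWithinAt η (-(1 - 3 * A * ξ t ^ 2 - 4 * B * ξ t ^ 3) / 2 * v t)
    (Set.Icc 0 1) t

/-- `u ↦ (ξ u, η u)` is the local uniformisation of the elliptic curve at the point at infinity. -/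
structure IsLocalExp (A B : ℂ) (ξ η : ℂ → ℂ) : Prop where
  xi_zero : ξ 0 = 0
  eta_zero : η 0 = 0
  flow : ∀ᶠ u in 𝓝 (0 : ℂ), η u ^ 2 = ξ u - A * ξ u ^ 3 - B * ξ u ^ 4 ∧
    HasDerivAt ξ (-η u) u ∧ HasDerivAt η (-(1 - 3 * A * ξ u ^ 2 - 4 * B * ξ u ^ 3) / 2) u
  unique : ∀ (t₀ : ℝ) (X Y v σ : ℝ → ℂ), t₀ ∈ Set.Icc (0 : ℝ) 1 → X t₀ = 0 →
    (∀ᶠ t in 𝓝[Set.Icc 0 1] t₀, IsInfiniteFlow A B X Y v t ∧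
      HasDerivWithinAt σ (v t) (Set.Icc 0 1) t) →
    ∀ᶠ t in 𝓝[Set.Icc 0 1] t₀, X t = ξ (σ t - σ t₀) ∧ Y t = η (σ t - σ t₀)

/-- The polynomial of the elliptic curve in the chart at infinity. -/
noncomputable def infPoly (A B : ℂ) : ℂ[X] := X - C A * X ^ 3 - C B * X ^ 4

lemma eval_infPoly (A B ξ : ℂ) : (infPoly A B).eval ξ = ξ - A * ξ ^ 3 - B * ξ ^ 4 := by
  simp [infPoly]

lemma eval_derivative_infPoly (A B ξ : ℂ) :
    (infPoly A B).derivative.eval ξ = 1 - 3 * A * ξ ^ 2 - 4 * B * ξ ^ 3 := by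
  simp [infPoly]
  ring

lemma infPoly_smooth {A B : ℂ} (hΔ : 4 * A ^ 3 ≠ 27 * B ^ 2) {ξ : ℂ}
    (h : (infPoly A B).eval ξ = 0) : (infPoly A B).derivative.eval ξ ≠ 0 := by
  rw [eval_infPoly] at h
  rw [eval_derivative_infPoly]
  intro h'
  have hξ : ξ ≠ 0 := by
    rintro rfl
    simp at h'
  have h1 : 1 - A * ξ ^ 2 - B * ξ ^ 3 = 0 := by
    refine (mul_eq_zero.1 (?_ : ξ * _ = 0)).resolve_left hξ
    linear_combination h
  have h2 : A * ξ ^ 2 = 3 := by linear_combination h' - 4 * h1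
  have h3 : B * ξ ^ 3 = -2 := by linear_combination -h1 - h2
  refine hΔ (mul_right_cancel₀ (pow_ne_zero 6 hξ) ?_)
  linear_combination 4 * ((A * ξ ^ 2) ^ 2 + 3 * (A * ξ ^ 2) + 9) * h2
    - 27 * (B * ξ ^ 3 - 2) * h3

/-- The local uniformisation inverts a primitive H of the differential in a local parameter at
infinity. For uniqueness, H of the parameter plus σ has derivative zero along any flow, so the flow
is determined by the increment of σ. -/
lemma exists_isLocalExp {A B : ℂ} (hΔ : 4 * A ^ 3 ≠ 27 * B ^ 2) :
    ∃ ξ η, IsLocalExp A B ξ η := by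
  obtain ⟨r, x, y, h, T, hp, hx0, hy0⟩ := exists_isLocalParam (F := infPoly A B) (x₀ := 0) (y₀ := 0)
    (by simp [eval_infPoly]) (infPoly_smooth hΔ)
  obtain ⟨G, hG0, hG⟩ := hp.exists_primitive
  set H := G 0 with hH
  have hH0 : H 0 = 0 := hG0 0
  have hHd : ∀ τ ∈ ball (0 : ℂ) r, HasDerivAt H (h τ) τ := fun τ hτ => by
    simpa using hG 0 τ hτ
  have hball : ball (0 : ℂ) r ∈ 𝓝 0 := isOpen_ball.mem_nhds hp.zero_mem
  have han : AnalyticAt ℂ H 0 := DifferentiableOn.analyticAt (s := ball 0 r)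
    (fun τ hτ => (hHd τ hτ).differentiableAt.differentiableWithinAt) hball
  obtain ⟨g, hga, hg0, hgr, hgl⟩ := exists_analytic_local_inverse han
    (by rw [(hHd 0 hp.zero_mem).deriv]; exact hp.ne_zero 0 hp.zero_mem)
  rw [hH0] at hga hg0 hgr
  have hgt : Tendsto g (𝓝 0) (𝓝 0) := by
    have := hga.continuousAt.tendsto
    rwa [hg0] at this
  have hgd : ∀ᶠ w in 𝓝 (0 : ℂ), g w ∈ ball (0 : ℂ) r ∧ HasDerivAt g (h (g w))⁻¹ w := by
    filter_upwards [hgt.eventually hball, hga.eventually_analyticAt, hgr.eventually_nhds]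
      with w h1 h2 h3
    refine ⟨h1, ?_⟩
    have h4 := (hHd _ h1).comp w h2.differentiableAt.hasDerivAt
    have h5 := h4.unique ((hasDerivAt_id w).congr_of_eventuallyEq h3)
    refine h2.differentiableAt.hasDerivAt.congr_deriv (eq_inv_of_mul_eq_one_right h5)
  have hneg : Tendsto (fun u : ℂ => -u) (𝓝 0) (𝓝 0) := by
    simpa using (continuous_neg (G := ℂ)).tendsto 0
  -- The argument is -u because dx/y becomes -dξ/η in the chart at infinity.
  refine ⟨fun u => x (g (-u)), fun u => y (g (-u)), ⟨by simp [hg0, hx0], by simp [hg0, hy0], ?_, ?_⟩⟩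
  · filter_upwards [hneg.eventually hgd] with u hu
    obtain ⟨hu, hd⟩ := hu
    have hne := hp.ne_zero _ hu
    have hd' : HasDerivAt (fun u => g (-u)) (-(h (g (-u)))⁻¹) u :=
      (hd.comp u (hasDerivAt_neg u)).congr_deriv (by simp)
    refine ⟨?_, ?_, ?_⟩
    · rw [hp.eqn _ hu, eval_infPoly]
    · exact (HasDerivAt.comp u (h₂ := x) (hp.deriv_x _ hu) hd').congr_deriv (by field_simp)
    · refine (HasDerivAt.comp u (h₂ := y) (hp.deriv_y _ hu) hd').congr_deriv ?_
      rw [eval_derivative_infPoly]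
      field_simp
  · intro t₀ X Y v σ ht₀ hX0 hev
    have h0 := (hev.self_of_nhdsWithin ht₀)
    have hY0 : Y t₀ = 0 := by
      have := h0.1.eqn
      rw [hX0] at this
      simpa using this
    have hXY : Tendsto (fun t => (X t, Y t)) (𝓝[Set.Icc 0 1] t₀) (𝓝 (x 0, y 0)) := by
      have h1 := h0.1.deriv_x.continuousWithinAt.tendsto
      have h2 := h0.1.deriv_y.continuousWithinAt.tendsto
      rw [hx0, hy0]
      rw [hX0] at h1
      rw [hY0] at h2
      exact h1.prodMk_nhds h2
    set τ : ℝ → ℂ := fun t => T (X t, Y t) with hτ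
    have hτ0 : τ t₀ = 0 := by
      have := hp.T_zero
      rw [hx0, hy0] at this
      simp only [hτ, hX0, hY0, this]
    have hτt : Tendsto τ (𝓝[Set.Icc 0 1] t₀) (𝓝 0) := hp.tendsto_T.comp hXY
    have heq : ∀ᶠ t in 𝓝[Set.Icc 0 1] t₀, X t = x (τ t) ∧ Y t = y (τ t) := by
      filter_upwards [hXY.eventually hp.inv, hev] with t h1 h2
      have := h1 (by rw [eval_infPoly]; exact h2.1.eqn)
      rwa [Prod.mk.injEq] at this
    have hder : ∀ᶠ t in 𝓝[Set.Icc 0 1] t₀,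
        HasDerivWithinAt (fun t => H (τ t) + σ t) 0 (Set.Icc 0 1) t := by
      filter_upwards [hev, eventually_eventually_nhdsWithin.2 heq, heq,
        hτt.eventually hball, self_mem_nhdsWithin] with t h1 h2 h3 h4 ht
      have hu : UniqueDiffWithinAt ℝ (Set.Icc (0 : ℝ) 1) t := uniqueDiffOn_Icc zero_lt_one t ht
      obtain ⟨τ', hτ'⟩ : ∃ τ', HasDerivWithinAt τ τ' (Set.Icc 0 1) t := by
        have e1 := ((hp.diff_T (X t, Y t)).restrictScalars ℝ)
        have e2 := h1.1.deriv_x.differentiableWithinAt.prodMk h1.1.deriv_y.differentiableWithinAt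
        exact ⟨_, (DifferentiableAt.comp_differentiableWithinAt (g := T)
          (f := fun t => (X t, Y t)) t e1 e2).hasDerivWithinAt⟩
      have e3 := hu.eq_deriv _ (h1.1.deriv_x.congr_of_eventuallyEq_of_mem
        (h2.mono fun t h => h.1.symm) ht) ((hp.deriv_x _ h4).comp_hasDerivWithinAt t hτ')
      have e4 := hu.eq_deriv _ (h1.1.deriv_y.congr_of_eventuallyEq_of_mem
        (h2.mono fun t h => h.2.symm) ht) ((hp.deriv_y _ h4).comp_hasDerivWithinAt t hτ')
      rw [eval_derivative_infPoly, ← h3.1] at e4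
      rw [← h3.2] at e3
      refine ((hHd _ h4).comp_hasDerivWithinAt t hτ' |>.add h1.2).congr_deriv ?_
      -- The velocity of the parameter is read off from the equation for X where Y ≠ 0, and
      -- otherwise from the equation for Y, whose coefficient is nonzero by smoothness.
      by_cases hY : Y t = 0
      · have hs := infPoly_smooth hΔ (ξ := X t) (by
          rw [eval_infPoly, ← h1.1.eqn, hY]; simp)
        rw [eval_derivative_infPoly] at hs
        refine mul_left_cancel₀ hs ?_
        linear_combination -2 * e4
      · refine mul_left_cancel₀ hY ?_
        linear_combination -e3
    filter_upwards [eventually_eq_of_hasDerivWithinAt_zero ht₀ hder, heq,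
      hτt.eventually hgl] with t h1 h2 h3
    rw [hτ0, hH0, zero_add] at h1
    have h4 : g (-(σ t - σ t₀)) = τ t := by
      rw [← h3]
      congr 1
      linear_combination -h1
    rw [h4]
    exact h2

/-! ### The flow of the invariant differential and the exponential map -/

section Flow

variable {A B : ℂ} {x y ξ η v σ : ℝ → ℂ} {t t₀ : ℝ}

lemma IsInfiniteFlow.toAffine (h : IsInfiniteFlow A B ξ η v t) (h0 : ξ t ≠ 0) :
    IsAffineFlow A B (fun t => 1 / ξ t) (fun t => η t / ξ t ^ 2) v t := by
  have hd := h.deriv_x.inv h0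
  refine ⟨(infinite_eqn_iff h0).2 h.eqn, ?_, ?_⟩
  · simp only [one_div]
    refine hd.congr_deriv ?_
    field_simp
  · refine (h.deriv_y.div (h.deriv_x.pow 2) (pow_ne_zero 2 h0)).congr_deriv ?_
    simp only [Pi.pow_apply]
    field_simp
    push_cast
    linear_combination 4 * ξ t * v t * h.eqn

/-- Moving a point of the curve along the flow, and the point at infinity along the opposite flow,
does not change the sum. -/
lemma eventually_ellPt_add_ellPtInf (hΔ : 4 * A ^ 3 ≠ 27 * B ^ 2) (ht₀ : t₀ ∈ Set.Icc (0 : ℝ) 1)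
    (h : ∀ᶠ t in 𝓝[Set.Icc 0 1] t₀, IsAffineFlow A B x y v t)
    (h' : ∀ᶠ t in 𝓝[Set.Icc 0 1] t₀, IsInfiniteFlow A B ξ η (fun t => -v t) t)
    (hξ : ξ t₀ = 0) :
    ∀ᶠ t in 𝓝[Set.Icc 0 1] t₀,
      ellPt A B (x t) (y t) + ellPtInf A B (ξ t) (η t) = ellPt A B (x t₀) (y t₀) := by
  have hη : η t₀ = 0 := by
    simpa [hξ] using (h'.self_of_nhdsWithin ht₀).eqn
  have hD : ∀ᶠ t in 𝓝[Set.Icc 0 1] t₀, 1 - x t * ξ t ≠ 0 := by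
    have hc : ContinuousWithinAt (fun t => 1 - x t * ξ t) (Set.Icc 0 1) t₀ :=
      continuousWithinAt_const.sub
        ((h.self_of_nhdsWithin ht₀).deriv_x.continuousWithinAt.mul
          (h'.self_of_nhdsWithin ht₀).deriv_x.continuousWithinAt)
    exact hc.eventually_ne (by simp [hξ])
  -- Both coordinates of the sum are first integrals: the numerator of the derivative is a
  -- combination of the two curve equations, with the cofactors given at the end.
  have hX : ∀ᶠ t in 𝓝[Set.Icc 0 1] t₀, HasDerivWithinAt
      (fun t => addNumX A B (x t) (y t) (ξ t) (η t) / (1 - x t * ξ t) ^ 2) 0 (Set.Icc 0 1) t := by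
    filter_upwards [h, h', hD] with t h h' hD
    have dx := h.deriv_x
    have dy := h.deriv_y
    have dξ := h'.deriv_x
    have dη := h'.deriv_y
    have dD := ((dx.mul dξ).const_sub 1).pow 2
    have dN := ((((dx.sub (dξ.const_mul A)).mul ((dx.mul dξ).const_add 1)).sub
      ((dξ.pow 2).const_mul (2 * B))).sub ((dy.const_mul 2).mul dη))
    refine (dN.div dD (pow_ne_zero 2 hD)).congr_deriv ?_
    rw [div_eq_zero_iff]
    left
    simp only [Pi.pow_apply, Pi.mul_apply, Pi.sub_apply]
    push_cast
    linear_combination v t * (1 - x t * ξ t) *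
      (-4 * ξ t * η t * h.eqn - 4 * x t * y t * h'.eqn)
  have hY : ∀ᶠ t in 𝓝[Set.Icc 0 1] t₀, HasDerivWithinAt
      (fun t => addNumY A B (x t) (y t) (ξ t) (η t) / (1 - x t * ξ t) ^ 3) 0 (Set.Icc 0 1) t := by
    filter_upwards [h, h', hD] with t h h' hD
    have dx := h.deriv_x
    have dy := h.deriv_y
    have dξ := h'.deriv_x
    have dη := h'.deriv_y
    have dD := ((dx.mul dξ).const_sub 1).pow 3
    have dN := ((((((((((((dx.mul dy).mul (dξ.pow 3)).mul_const A).neg.add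
      (((dx.pow 3).mul dξ).mul dη)).sub (((dy.const_mul 4).mul (dξ.pow 3)).mul_const B)).add
      (((dx.mul dξ).mul dη).mul_const A)).sub (((dy.const_mul 3).mul (dξ.pow 2)).mul_const A)).sub
      ((((dy.pow 2).const_mul 2).mul dξ).mul dη)).add (((dx.const_mul 3).mul dy).mul dξ)).sub
      (((dx.pow 2).const_mul 3).mul dη)).add (((dξ.const_mul 2).mul dη).mul_const B)).add
      (dη.mul_const A)).add dy
    refine (dN.div dD (pow_ne_zero 3 hD)).congr_deriv ?_
    rw [div_eq_zero_iff]
    left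
    simp only [Pi.pow_apply, Pi.mul_apply, Pi.sub_apply, Pi.add_apply, Pi.neg_apply]
    push_cast
    linear_combination v t * (1 - x t * ξ t) ^ 2 *
      ((-4 * x t * ξ t ^ 5 * B - 5 * x t * ξ t ^ 4 * A - 8 * ξ t ^ 4 * B - 4 * x t * ξ t * η t ^ 2
        - 6 * y t * ξ t ^ 2 * η t - 7 * ξ t ^ 3 * A + 7 * x t * ξ t ^ 2 - 2 * η t ^ 2 + 5 * ξ t)
        * h.eqn + (-2 * x t ^ 4 * ξ t + 6 * x t ^ 2 * ξ t * A + 8 * x t * ξ t * B - 10 * x t ^ 3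
        + 6 * x t * A + 4 * B) * h'.eqn)
  filter_upwards [eventually_eq_of_hasDerivWithinAt_zero ht₀ hX,
    eventually_eq_of_hasDerivWithinAt_zero ht₀ hY, h, h', hD] with t h1 h2 h3 h4 h5
  rw [ellPt_add_ellPtInf hΔ h3.eqn h4.eqn h5, h1, h2]
  simp [hξ, hη, addNumX, addNumY]

variable {ξ₀ η₀ : ℂ → ℂ}

lemma tendsto_sub_self_of_hasDerivWithinAt {σ' : ℂ} {s : Set ℝ} (h : HasDerivWithinAt σ σ' s t₀) :
    Tendsto (fun t => σ t - σ t₀) (𝓝[s] t₀) (𝓝 0) := by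
  have := h.continuousWithinAt.tendsto.sub_const (σ t₀)
  rwa [sub_self] at this

/-- The local exponential with its sign of η reversed runs backwards from infinity, and is the
negative of the forward one; constancy of the sum then gives the displacement of the point. -/
lemma IsAffineFlow.eventually_eq_add (hΔ : 4 * A ^ 3 ≠ 27 * B ^ 2) (he : IsLocalExp A B ξ₀ η₀)
    (ht₀ : t₀ ∈ Set.Icc (0 : ℝ) 1)
    (h : ∀ᶠ t in 𝓝[Set.Icc 0 1] t₀, IsAffineFlow A B x y v t ∧
      HasDerivWithinAt σ (v t) (Set.Icc 0 1) t) :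
    ∀ᶠ t in 𝓝[Set.Icc 0 1] t₀, ellPt A B (x t) (y t) = ellPt A B (x t₀) (y t₀) +
      ellPtInf A B (ξ₀ (σ t - σ t₀)) (η₀ (σ t - σ t₀)) := by
  have hσ := tendsto_sub_self_of_hasDerivWithinAt (h.self_of_nhdsWithin ht₀).2
  have hi : ∀ᶠ t in 𝓝[Set.Icc 0 1] t₀, IsInfiniteFlow A B (fun t => ξ₀ (σ t - σ t₀))
      (fun t => -η₀ (σ t - σ t₀)) (fun t => -v t) t := by
    filter_upwards [h, hσ.eventually he.flow] with t h1 h2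
    obtain ⟨h2, h3, h4⟩ := h2
    refine ⟨by rw [neg_sq, h2], ?_, ?_⟩
    · exact (h3.comp_hasDerivWithinAt t (h1.2.sub_const _)).congr_deriv (by ring)
    · exact (h4.comp_hasDerivWithinAt t (h1.2.sub_const _)).neg.congr_deriv (by ring)
  filter_upwards [eventually_ellPt_add_ellPtInf hΔ ht₀ (h.mono fun t h => h.1) hi
    (by simp [he.xi_zero]), hσ.eventually he.flow] with t h1 h2
  rw [← h1, ← neg_ellPtInf hΔ h2.1, add_assoc, neg_add_cancel, add_zero]

/-- If the flow passes through infinity, it is the local exponential by uniqueness; otherwise it is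
an affine flow nearby. -/
lemma IsInfiniteFlow.eventually_eq_add (hΔ : 4 * A ^ 3 ≠ 27 * B ^ 2) (he : IsLocalExp A B ξ₀ η₀)
    (ht₀ : t₀ ∈ Set.Icc (0 : ℝ) 1)
    (h : ∀ᶠ t in 𝓝[Set.Icc 0 1] t₀, IsInfiniteFlow A B ξ η v t ∧
      HasDerivWithinAt σ (v t) (Set.Icc 0 1) t) :
    ∀ᶠ t in 𝓝[Set.Icc 0 1] t₀, ellPtInf A B (ξ t) (η t) = ellPtInf A B (ξ t₀) (η t₀) +
      ellPtInf A B (ξ₀ (σ t - σ t₀)) (η₀ (σ t - σ t₀)) := by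
  by_cases h0 : ξ t₀ = 0
  · filter_upwards [he.unique t₀ ξ η v σ ht₀ h0 h] with t h1
    rw [h1.1, h1.2, h0, ellPtInf_zero, zero_add]
  · have hne := (h.self_of_nhdsWithin ht₀).1.deriv_x.continuousWithinAt.eventually_ne h0
    filter_upwards [hne, IsAffineFlow.eventually_eq_add hΔ he ht₀
      ((h.and hne).mono fun t h => ⟨h.1.1.toAffine h.2, h.1.2⟩)] with t h1 h2
    rw [ellPtInf_of_ne_zero h1, ellPtInf_of_ne_zero h0, h2]

/-- The exponential map of the elliptic curve, for the differential `dx / y`. -/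
structure IsExp (A B : ℂ) (ξ₀ η₀ : ℂ → ℂ) (Φ : ℂ →+ (ellCurve A B).Point) : Prop where
  localExp : IsLocalExp A B ξ₀ η₀
  eventually_eq : ∀ᶠ u in 𝓝 (0 : ℂ), Φ u = ellPtInf A B (ξ₀ u) (η₀ u)

theorem exists_isExp (hΔ : 4 * A ^ 3 ≠ 27 * B ^ 2) : ∃ ξ₀ η₀ Φ, IsExp A B ξ₀ η₀ Φ := by
  obtain ⟨ξ₀, η₀, he⟩ := exists_isLocalExp hΔ
  obtain ⟨r, hr, hb⟩ := Metric.eventually_nhds_iff.1 he.flow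
  have hflow (u w : ℂ) (hu : ‖u‖ < r / 2) (hw : ‖w‖ < r / 2) (t : ℝ) (ht : t ∈ Set.Icc (0 : ℝ) 1) :
      IsInfiniteFlow A B (fun t => ξ₀ (u + t * w)) (fun t => η₀ (u + t * w)) (fun _ => w) t ∧
        HasDerivWithinAt (fun t : ℝ => t * w) w (Set.Icc 0 1) t := by
    have hd : HasDerivWithinAt (fun t : ℝ => (t : ℂ) * w) w (Set.Icc 0 1) t :=
      (((Complex.ofRealCLM.hasDerivAt (x := t)).mul_const w).congr_deriv
        (by simp)).hasDerivWithinAt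
    have hlt : dist (u + t * w) 0 < r := by
      rw [dist_zero_right]
      have h1 : ‖(t : ℂ) * w‖ ≤ ‖w‖ := by
        rw [norm_mul, Complex.norm_real, Real.norm_eq_abs, abs_of_nonneg ht.1]
        exact mul_le_of_le_one_left (norm_nonneg _) ht.2
      linarith [norm_add_le u (t * w)]
    obtain ⟨h1, h2, h3⟩ := hb hlt
    refine ⟨⟨h1, ?_, ?_⟩, hd⟩
    · exact h2.comp_hasDerivWithinAt t (hd.const_add u)
    · exact h3.comp_hasDerivWithinAt t (hd.const_add u)
  have hadd (u w : ℂ) (hu : ‖u‖ < r / 2) (hw : ‖w‖ < r / 2) :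
      ellPtInf A B (ξ₀ (u + w)) (η₀ (u + w)) =
        ellPtInf A B (ξ₀ u) (η₀ u) + ellPtInf A B (ξ₀ w) (η₀ w) := by
    -- The flows starting at u and at 0 with the same velocity undergo the same displacement, so
    -- their difference is constant; its values at the two ends give additivity.
    have key := eq_of_eventually_const
      (D := fun t : ℝ => ellPtInf A B (ξ₀ (u + t * w)) (η₀ (u + t * w)) -
        ellPtInf A B (ξ₀ (0 + t * w)) (η₀ (0 + t * w))) (fun t₀ ht₀ => by
        have h0 : ‖(0 : ℂ)‖ < r / 2 := by simpa using hr
        filter_upwards [IsInfiniteFlow.eventually_eq_add hΔ he ht₀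
            (eventually_nhdsWithin_of_forall fun t ht => hflow u w hu hw t ht),
          IsInfiniteFlow.eventually_eq_add hΔ he ht₀
            (eventually_nhdsWithin_of_forall fun t ht => hflow 0 w h0 hw t ht)] with t h1 h2
        rw [h1, h2]
        abel)
    simp only [Complex.ofReal_one, one_mul, Complex.ofReal_zero, zero_mul, add_zero, zero_add,
      he.xi_zero, ellPtInf_zero, sub_zero] at key
    rw [← key]
    abel
  obtain ⟨Φ, hΦ⟩ := exists_addMonoidHom_of_locally_additive
    (φ := fun u => ellPtInf A B (ξ₀ u) (η₀ u)) (half_pos hr) hadd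
  refine ⟨ξ₀, η₀, Φ, he, ?_⟩
  filter_upwards [ball_mem_nhds 0 (half_pos hr)] with u hu
  exact hΦ u (by simpa using hu)

/-- A curve on the elliptic curve that moves, near every time, with `dx / y = v dt` in one of the
two charts. -/
def IsFlow (A B : ℂ) (γ : ℝ → (ellCurve A B).Point) (v : ℝ → ℂ) : Prop :=
  ∀ t₀ ∈ Set.Icc (0 : ℝ) 1,
    (∃ x y, ∀ᶠ t in 𝓝[Set.Icc 0 1] t₀, IsAffineFlow A B x y v t ∧ γ t = ellPt A B (x t) (y t)) ∨
    (∃ ξ η, ∀ᶠ t in 𝓝[Set.Icc 0 1] t₀,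
      IsInfiniteFlow A B ξ η v t ∧ γ t = ellPtInf A B (ξ t) (η t))

/-- With σ a primitive of v, the difference γ - Φ ∘ σ is locally constant on [0, 1], since σ carries
the displacement in either chart. -/
theorem IsExp.apply_flow {Φ : ℂ →+ (ellCurve A B).Point} (hΔ : 4 * A ^ 3 ≠ 27 * B ^ 2)
    (h : IsExp A B ξ₀ η₀ Φ) {γ : ℝ → (ellCurve A B).Point} (hv : ContinuousOn v (Set.Icc 0 1))
    (hγ : IsFlow A B γ v) : γ 1 = γ 0 + Φ (∫ t in (0 : ℝ)..1, v t) := by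
  -- The velocity is continuous only on [0, 1]; a continuous extension to ℝ makes the primitive
  -- differentiable at the end points too.
  set w : ℝ → ℂ := Set.IccExtend (zero_le_one' ℝ) ((Set.Icc (0 : ℝ) 1).domRestrict v) with hw
  have hwc : Continuous w := (continuousOn_iff_continuous_domRestrict.1 hv).Icc_extend'
  have hwv : ∀ t ∈ Set.Icc (0 : ℝ) 1, w t = v t := fun t ht => by
    rw [hw, Set.IccExtend_of_mem _ _ ht, Set.domRestrict_apply]
  set σ : ℝ → ℂ := fun t => ∫ s in (0 : ℝ)..t, w s with hσ
  have hσd : ∀ t ∈ Set.Icc (0 : ℝ) 1, HasDerivWithinAt σ (v t) (Set.Icc 0 1) t := fun t ht => by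
    rw [← hwv t ht]
    exact (hwc.integral_hasStrictDerivAt 0 t).hasDerivAt.hasDerivWithinAt
  have hσ1 : σ 1 = ∫ t in (0 : ℝ)..1, v t := by
    refine intervalIntegral.integral_congr fun t ht => hwv t ?_
    rwa [Set.uIcc_of_le zero_le_one] at ht
  have hσ0 : σ 0 = 0 := intervalIntegral.integral_same
  have hmem : ∀ t₀ : ℝ, ∀ᶠ t in 𝓝[Set.Icc 0 1] t₀, HasDerivWithinAt σ (v t) (Set.Icc 0 1) t :=
    fun t₀ => eventually_nhdsWithin_of_forall hσd
  have key := eq_of_eventually_const (D := fun t => γ t - Φ (σ t)) (fun t₀ ht₀ => by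
    have hΦ := (tendsto_sub_self_of_hasDerivWithinAt (hσd t₀ ht₀)).eventually h.eventually_eq
    rcases hγ t₀ ht₀ with ⟨x, y, hxy⟩ | ⟨x, y, hxy⟩
    · filter_upwards [hΦ, hxy, IsAffineFlow.eventually_eq_add hΔ h.localExp ht₀
        ((hxy.and (hmem t₀)).mono fun t h => ⟨h.1.1, h.2⟩)] with t h1 h2 h3
      rw [h2.2, (hxy.self_of_nhdsWithin ht₀).2, h3, ← h1, map_sub]
      abel
    · filter_upwards [hΦ, hxy, IsInfiniteFlow.eventually_eq_add hΔ h.localExp ht₀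
        ((hxy.and (hmem t₀)).mono fun t h => ⟨h.1.1, h.2⟩)] with t h1 h2 h3
      rw [h2.2, (hxy.self_of_nhdsWithin ht₀).2, h3, ← h1, map_sub]
      abel)
  simp only [hσ0, hσ1, map_zero, sub_zero] at key
  rw [← key, sub_add_cancel]

end Flow

/-! ### Abel's theorem and the Jacobian of the elliptic curve -/

section Uniformisation

variable {A B : ℂ}

lemma eval_polyE2 (A B x : ℂ) : (polyE2 A B).eval x = x ^ 3 - A * x - B := by
  simp [polyE2]

lemma eval_derivative_polyE2 (A B x : ℂ) : (polyE2 A B).derivative.eval x = 3 * x ^ 2 - A := by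
  simp [polyE2]
  norm_num

lemma isSmoothOdd_polyE2 (hΔ : 4 * A ^ 3 ≠ 27 * B ^ 2) : IsSmoothOdd 1 (polyE2 A B) := by
  refine ⟨?_, fun x h h' => ?_⟩
  · rw [polyE2]
    compute_degree!
  · rw [eval_polyE2] at h
    rw [eval_derivative_polyE2] at h'
    have h4 : B = -2 * x ^ 3 := by linear_combination -h + x * h'
    have h3 : A = 3 * x ^ 2 := by linear_combination -h'
    exact hΔ (by rw [h4, h3]; ring)

lemma X_mul_reverse_polyE2 (hΔ : 4 * A ^ 3 ≠ 27 * B ^ 2) :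
    X * (polyE2 A B).reverse = infPoly A B := by
  refine Polynomial.funext fun ξ => ?_
  rw [eval_infPoly]
  by_cases hξ : ξ = 0
  · simp [hξ]
  · rw [(isSmoothOdd_polyE2 hΔ).eval_infinite hξ, eval_polyE2]
    field_simp
    ring

/-- The point of the Weierstrass curve. -/
noncomputable def HPoint.toEll : HPoint (polyE2 A B) → (ellCurve A B).Point
  | .aff x y _ => ellPt A B x y
  | .inf => 0

lemma HPoint.toEll_aff (x y : ℂ) (h : y ^ 2 = (polyE2 A B).eval x) :
    (HPoint.aff x y h).toEll = ellPt A B x y := rfl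

lemma HPoint.toEll_inf : (HPoint.inf : HPoint (polyE2 A B)).toEll = 0 := rfl

lemma HPoint.toEll_neg (hΔ : 4 * A ^ 3 ≠ 27 * B ^ 2) (P : HPoint (polyE2 A B)) :
    P.neg.toEll = -P.toEll := by
  cases P with
  | inf => simp [HPoint.neg, HPoint.toEll]
  | aff x y h =>
    rw [HPoint.toEll_aff, neg_ellPt hΔ (by rw [h, eval_polyE2])]
    rfl

lemma HPoint.toEll_bijective (hΔ : 4 * A ^ 3 ≠ 27 * B ^ 2) :
    Function.Bijective (HPoint.toEll (A := A) (B := B)) := by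
  constructor
  · intro P Q h
    cases P with
    | inf =>
      cases Q with
      | inf => rfl
      | aff x y hxy =>
        rw [HPoint.toEll_aff, HPoint.toEll_inf, ellPt_eq_some hΔ (by rw [hxy, eval_polyE2])] at h
        exact absurd h.symm (WeierstrassCurve.Affine.Point.some_ne_zero _)
    | aff x y hxy =>
      rw [HPoint.toEll_aff, ellPt_eq_some hΔ (by rw [hxy, eval_polyE2])] at h
      cases Q with
      | inf =>
        exact absurd h (WeierstrassCurve.Affine.Point.some_ne_zero _)
      | aff x' y' hxy' =>
        rw [HPoint.toEll_aff, ellPt_eq_some hΔ (by rw [hxy', eval_polyE2]),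
          WeierstrassCurve.Affine.Point.some.injEq] at h
        obtain ⟨rfl, rfl⟩ := h
        rfl
  · intro P
    cases P with
    | zero => exact ⟨.inf, rfl⟩
    | some x y h =>
      have h' := (ellCurve_nonsingular_iff hΔ).1 h
      exact ⟨.aff x y (by rw [h', eval_polyE2]), by rw [HPoint.toEll_aff, ellPt_eq_some hΔ h']⟩

lemma HPoint.toEll_of_inAffineChart {P : HPoint (polyE2 A B)} {x y : ℂ}
    (h : P.InAffineChart x y) : P.toEll = ellPt A B x y := by
  cases P with
  | inf => exact h.elim
  | aff a b hab =>
    obtain ⟨rfl, rfl⟩ := h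
    rfl

lemma HPoint.toEll_of_inInfiniteChart {P : HPoint (polyE2 A B)} {ξ η : ℂ}
    (h : P.InInfiniteChart 1 ξ η) : P.toEll = ellPtInf A B ξ η := by
  cases P with
  | inf =>
    obtain ⟨rfl, rfl⟩ := h
    simp [HPoint.toEll]
  | aff a b hab =>
    obtain ⟨h0, rfl, rfl⟩ := h
    rw [ellPtInf_of_ne_zero (by simpa using h0), HPoint.toEll_aff]
    congr 1 <;> field_simp

variable {ξ₀ η₀ : ℂ → ℂ} {Φ : ℂ →+ (ellCurve A B).Point}

/-- Abel's theorem for the elliptic curve. -/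
theorem IsExp.toEll_eq (hΔ : 4 * A ^ 3 ≠ 27 * B ^ 2) (he : IsExp A B ξ₀ η₀ Φ)
    {P Q : HPoint (polyE2 A B)} {I : Fin 1 → ℂ} (h : PathIntegral 1 (polyE2 A B) P Q I) :
    Q.toEll = P.toEll + Φ (I 0) := by
  induction h with
  | affine P Q x y v h hP hQ =>
    rw [P.toEll_of_inAffineChart hP, Q.toEll_of_inAffineChart hQ,
      he.apply_flow hΔ (γ := fun t => ellPt A B (x t) (y t)) h.1 fun t₀ _ => .inl ⟨x, y, ?_⟩]
    · simp
    · refine eventually_nhdsWithin_of_forall fun t ht => ⟨?_, rfl⟩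
      obtain ⟨h1, h2, h3⟩ := h.2 t ht
      rw [eval_polyE2] at h1
      rw [eval_derivative_polyE2] at h3
      exact ⟨h1, h2, h3⟩
  | infinite P Q x y v h hP hQ =>
    rw [P.toEll_of_inInfiniteChart hP, Q.toEll_of_inInfiniteChart hQ,
      he.apply_flow hΔ (γ := fun t => ellPtInf A B (x t) (y t)) h.1.neg
        fun t₀ _ => .inr ⟨x, y, ?_⟩]
    · simp
    · refine eventually_nhdsWithin_of_forall fun t ht => ⟨?_, rfl⟩
      rw [X_mul_reverse_polyE2 hΔ] at h
      obtain ⟨h1, h2, h3⟩ := h.2 t ht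
      rw [eval_infPoly] at h1
      rw [eval_derivative_infPoly] at h3
      exact ⟨h1, h2.congr_deriv (by simp), h3.congr_deriv (by simp; ring)⟩
  | trans P Q R I J _ _ hI hJ =>
    rw [hJ, hI, Pi.add_apply, map_add, add_assoc]

/-- Closed paths have Φ-trivial integrals by Abel's theorem. Conversely, an element of the kernel is
realised by a path from infinity, which has to return there. -/
theorem IsExp.mem_periodLattice_iff (hΔ : 4 * A ^ 3 ≠ 27 * B ^ 2) (he : IsExp A B ξ₀ η₀ Φ)
    (I : Fin 1 → ℂ) : I ∈ periodLattice 1 (polyE2 A B) ↔ Φ (I 0) = 0 := by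
  constructor
  · intro h
    refine AddSubgroup.closure_induction (p := fun I _ => Φ (I 0) = 0) ?_ (by simp) ?_ ?_ h
    · rintro I ⟨P, hP⟩
      simpa using he.toEll_eq hΔ hP
    · intro I J _ _ hI hJ
      rw [Pi.add_apply, map_add, hI, hJ, add_zero]
    · intro I _ hI
      rw [Pi.neg_apply, map_neg, hI, neg_zero]
  · intro h
    obtain ⟨Q, J, hJ, h0⟩ := exists_pathIntegral_apply_eq (isSmoothOdd_polyE2 hΔ) 0 .inf (I 0)
    have hQ := he.toEll_eq hΔ hJ
    rw [h0, h, add_zero] at hQ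
    obtain rfl := (HPoint.toEll_bijective hΔ).1 hQ
    have : J = I := by
      funext k
      rw [Subsingleton.elim k 0, h0]
    exact AddSubgroup.subset_closure ⟨_, this ▸ hJ⟩

/-- The Jacobian of the elliptic curve is the group of its points. -/
theorem IsExp.exists_jac_equiv (hΔ : 4 * A ^ 3 ≠ 27 * B ^ 2) (he : IsExp A B ξ₀ η₀ Φ) :
    ∃ J : Jac 1 (polyE2 A B) ≃+ (ellCurve A B).Point,
      ∀ P Q, J (abelInt 1 (polyE2 A B) P Q) = Q.toEll - P.toEll := by
  set ψ : (Fin 1 → ℂ) →+ (ellCurve A B).Point := Φ.comp (Pi.evalAddMonoidHom (fun _ => ℂ) 0) with hψ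
  have hψI (I : Fin 1 → ℂ) : ψ I = Φ (I 0) := rfl
  have hle : periodLattice 1 (polyE2 A B) ≤ ψ.ker := fun I hI =>
    (he.mem_periodLattice_iff hΔ I).1 hI
  set j := QuotientAddGroup.lift _ ψ hle with hj
  have habel (P Q) : j (abelInt 1 (polyE2 A B) P Q) = Q.toEll - P.toEll := by
    obtain ⟨I, hI⟩ := exists_pathIntegral (isSmoothOdd_polyE2 hΔ) P Q
    rw [abelInt_eq hI, he.toEll_eq hΔ hI, add_sub_cancel_left]
    rfl
  refine ⟨AddEquiv.ofBijective j ⟨?_, fun P => ?_⟩, habel⟩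
  · rw [injective_iff_map_eq_zero]
    intro u
    induction u using QuotientAddGroup.induction_on with
    | H I =>
      intro h
      exact (QuotientAddGroup.eq_zero_iff I).2 ((he.mem_periodLattice_iff hΔ I).2 h)
  · obtain ⟨Q, rfl⟩ := (HPoint.toEll_bijective hΔ).2 P
    exact ⟨_, (habel .inf Q).trans (sub_zero _)⟩

end Uniformisation

end AbelianIntegrals

/-! ## Points of order dividing six -/

lemma eq_zero_iff_of_mul_eq {K : Type*} [Field K] {a b u v : K} (hu : u ≠ 0) (hv : v ≠ 0)
    (h : u * a = v * b) : a = 0 ↔ b = 0 := by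
  constructor
  · rintro rfl
    simpa [hv] using h.symm
  · rintro rfl
    simpa [hu] using h

section Torsion

variable {A B : ℂ}

lemma ellPt_ne_zero (hΔ : 4 * A ^ 3 ≠ 27 * B ^ 2) {x y : ℂ} (h : y ^ 2 = x ^ 3 - A * x - B) :
    ellPt A B x y ≠ 0 := by
  rw [ellPt_eq_some hΔ h]
  exact WeierstrassCurve.Affine.Point.some_ne_zero _

lemma ellPt_inj (hΔ : 4 * A ^ 3 ≠ 27 * B ^ 2) {x y x' y' : ℂ} (h : y ^ 2 = x ^ 3 - A * x - B)
    (h' : y' ^ 2 = x' ^ 3 - A * x' - B) :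
    ellPt A B x y = ellPt A B x' y' ↔ x = x' ∧ y = y' := by
  rw [ellPt_eq_some hΔ h, ellPt_eq_some hΔ h', WeierstrassCurve.Affine.Point.some.injEq]

lemma two_nsmul_ellPt_eq_zero_iff (hΔ : 4 * A ^ 3 ≠ 27 * B ^ 2) {x y : ℂ}
    (h : y ^ 2 = x ^ 3 - A * x - B) : 2 • ellPt A B x y = 0 ↔ y = 0 := by
  rw [two_nsmul, add_eq_zero_iff_eq_neg, neg_ellPt hΔ h, ellPt_inj hΔ h (by rwa [neg_sq])]
  simp [eq_neg_iff_add_eq_zero, ← two_mul]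

/-- With f the cubic, the quartic is 12 x f - f'², so a common root would be a double root of f. -/
lemma Cond3.eval_ne_zero (hΔ : 4 * A ^ 3 ≠ 27 * B ^ 2) {x : ℂ} (h : Cond3 A B x) :
    x ^ 3 - A * x - B ≠ 0 := by
  rw [Cond3] at h
  intro h0
  have h1 : (3 * x ^ 2 - A) ^ 2 = 0 := by linear_combination -h + 12 * x * h0
  have h3 : A = 3 * x ^ 2 := by linear_combination -(pow_eq_zero_iff two_ne_zero).1 h1
  have h4 : B = -2 * x ^ 3 := by rw [h3] at h0; linear_combination -h0
  exact hΔ (by rw [h4, h3]; ring)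

/-- Modulo the cubic f, the polynomial of degree 12 is 3 f'⁶, so a common root would again be a
double root of f. -/
lemma Cond4.eval_ne_zero (hΔ : 4 * A ^ 3 ≠ 27 * B ^ 2) {x : ℂ} (h : Cond4 A B x) :
    x ^ 3 - A * x - B ≠ 0 := by
  rw [Cond4] at h
  intro h0
  obtain rfl : B = x ^ 3 - A * x := by linear_combination -h0
  have h1 : (3 * x ^ 2 - A) ^ 6 = 0 := by linear_combination h / 3
  have h3 : A = 3 * x ^ 2 := by linear_combination -(pow_eq_zero_iff (by norm_num)).1 h1
  exact hΔ (by rw [h3]; ring)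

lemma exists_two_nsmul_ellPt (hΔ : 4 * A ^ 3 ≠ 27 * B ^ 2) {x y : ℂ}
    (h : y ^ 2 = x ^ 3 - A * x - B) (hy : y ≠ 0) :
    ∃ x₂ y₂, y₂ ^ 2 = x₂ ^ 3 - A * x₂ - B ∧ 2 • ellPt A B x y = ellPt A B x₂ y₂ ∧
      x₂ = ((3 * x ^ 2 - A) / (2 * y)) ^ 2 - x - x ∧
      y₂ = -((3 * x ^ 2 - A) / (2 * y) * (x₂ - x) + y) := by
  obtain ⟨h1, h2⟩ := ellPt_add_self hΔ h hy (l := (3 * x ^ 2 - A) / (2 * y)) (by field_simp) rfl rfl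
  exact ⟨_, _, h1, by rw [two_nsmul, h2], rfl, rfl⟩

/-- The condition is 2P = -P. The tangent formula gives x(2P) - x(P) as minus the quartic over 4y²,
and once the abscissae agree it also gives the ordinate -y. -/
lemma three_nsmul_ellPt_eq_zero_iff (hΔ : 4 * A ^ 3 ≠ 27 * B ^ 2) {x y : ℂ}
    (h : y ^ 2 = x ^ 3 - A * x - B) : 3 • ellPt A B x y = 0 ↔ Cond3 A B x := by
  by_cases hy : y = 0
  · refine iff_of_false ?_ fun hc => hc.eval_ne_zero hΔ (by rw [← h, hy]; simp)
    rw [succ_nsmul, (two_nsmul_ellPt_eq_zero_iff hΔ h).2 hy, zero_add]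
    exact ellPt_ne_zero hΔ h
  · obtain ⟨x₂, y₂, h₂, he, hx₂, hy₂⟩ := exists_two_nsmul_ellPt hΔ h hy
    rw [succ_nsmul, he, add_eq_zero_iff_eq_neg, neg_ellPt hΔ h, ellPt_inj hΔ h₂ (by rwa [neg_sq])]
    have key : (x₂ - x) * (4 * y ^ 2) = -(3 * x ^ 4 - 6 * A * x ^ 2 - 12 * B * x - A ^ 2) := by
      rw [hx₂]
      field_simp
      linear_combination (-48 * x) * h
    constructor
    · rintro ⟨hx, -⟩
      rw [Cond3]
      rw [hx] at key
      linear_combination key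
    · intro hc
      rw [Cond3] at hc
      rw [hc, neg_zero, mul_eq_zero] at key
      have hx : x₂ = x := sub_eq_zero.1 (key.resolve_right (by simp [hy]))
      refine ⟨hx, ?_⟩
      rw [hy₂, hx]
      ring

/-- Outside (cond3), 3P = 2P + P is an affine point, and 6P = 0 says that its ordinate vanishes.
That ordinate is -y times the polynomial of degree 12 over p³, where p is the quartic. -/
lemma six_nsmul_ellPt_eq_zero_iff (hΔ : 4 * A ^ 3 ≠ 27 * B ^ 2) {x y : ℂ}
    (h : y ^ 2 = x ^ 3 - A * x - B) (hy : y ≠ 0) :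
    6 • ellPt A B x y = 0 ↔ Cond3 A B x ∨ Cond4 A B x := by
  have h6 : 6 • ellPt A B x y = 2 • 3 • ellPt A B x y := by
    rw [smul_smul]
    norm_num
  by_cases hc : Cond3 A B x
  · rw [h6, (three_nsmul_ellPt_eq_zero_iff hΔ h).2 hc]
    simp [hc]
  · obtain ⟨x₂, y₂, h₂, he, hx₂, hy₂⟩ := exists_two_nsmul_ellPt hΔ h hy
    rw [h6, succ_nsmul _ 2, he]
    simp only [hc, false_or]
    rw [Cond3] at hc
    set p := 3 * x ^ 4 - 6 * A * x ^ 2 - 12 * B * x - A ^ 2 with hp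
    have key : x₂ - x = -p / (4 * y ^ 2) := by
      rw [eq_div_iff (by simp [hy]), hx₂, hp]
      field_simp
      linear_combination (-48 * x) * h
    have hne : x₂ ≠ x := by
      rw [← sub_ne_zero, key]
      exact div_ne_zero (neg_ne_zero.2 hc) (by simp [hy])
    obtain ⟨h3, e3⟩ := ellPt_add_of_X_ne hΔ h₂ h hne
      -- The slope of the chord through 2P and P, simplified with x(2P) - x = -p / (4y²).
      (l := (16 * y ^ 4 - (3 * x ^ 2 - A) * p) / (2 * y * p)) (by
        rw [hy₂, key]
        field_simp
        ring) rfl rfl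
    rw [e3, two_nsmul_ellPt_eq_zero_iff hΔ h3, Cond4]
    have hx₂' : x₂ = x - p / (4 * y ^ 2) := by linear_combination key
    rw [hy₂, hx₂']
    -- Eliminating B by the curve equation leaves an identity in A, x, y with no side relation.
    obtain rfl : B = x ^ 3 - A * x - y ^ 2 := by linear_combination h
    refine eq_zero_iff_of_mul_eq (pow_ne_zero 3 hc) (neg_ne_zero.2 hy) ?_
    field_simp
    rw [hp]
    ring

lemma ellPt_torsion_iff (hΔ : 4 * A ^ 3 ≠ 27 * B ^ 2) {x y : ℂ}
    (h : y ^ 2 = x ^ 3 - A * x - B) :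
    6 • ellPt A B x y = 0 ∧ 2 • ellPt A B x y ≠ 0 ↔ Cond3 A B x ∨ Cond4 A B x := by
  rw [Ne, two_nsmul_ellPt_eq_zero_iff hΔ h]
  by_cases hy : y = 0
  · have h0 : x ^ 3 - A * x - B = 0 := by rw [← h, hy]; simp
    refine iff_of_false (fun h => h.2 hy) ?_
    rintro (hc | hc)
    · exact hc.eval_ne_zero hΔ h0
    · exact hc.eval_ne_zero hΔ h0
  · rw [six_nsmul_ellPt_eq_zero_iff hΔ h hy]
    simp [hy]

end Torsion

/-! ## Square root expansions -/

section SqrtExpansion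

variable {A B : ℂ}

/-- The root is √c (1 + X/c)^{1/2}, with the binomial series for the exponent 1/2. -/
lemma PowerSeries.exists_sq_eq_X_add_C {c : ℂ} (hc : c ≠ 0) :
    ∃ S : PowerSeries ℂ, S ^ 2 = PowerSeries.X + PowerSeries.C c := by
  obtain ⟨s, hs⟩ := IsAlgClosed.exists_pow_nat_eq c (n := 2) two_pos
  refine ⟨PowerSeries.C s *
    PowerSeries.rescale c⁻¹ (PowerSeries.binomialSeries ℂ (1 / 2 : ℚ)), ?_⟩
  rw [mul_pow, ← map_pow, ← map_pow, hs, sq (PowerSeries.binomialSeries _ _),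
    ← PowerSeries.binomialSeries_add, add_halves, ← Nat.cast_one,
    PowerSeries.binomialSeries_nat, pow_one, map_add, map_one, PowerSeries.rescale_X, mul_add,
    mul_one, ← mul_assoc, ← map_mul, mul_inv_cancel₀ hc, map_one, one_mul, add_comm]

/-- The roots of the cubic. -/
lemma exists_cubic_roots (A B : ℂ) : ∃ e₁ e₂ e₃ : ℂ,
    polyE2 A B = (X - C e₁) * (X - C e₂) * (X - C e₃) := by
  have h3 : (polyE2 A B).natDegree = 3 := by
    rw [polyE2]
    compute_degree!
  obtain ⟨e₁, h1⟩ := IsAlgClosed.exists_root (polyE2 A B) (by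
    rw [degree_eq_natDegree (by rintro h; simp [h] at h3), h3]; norm_num)
  have h2' : (X ^ 2 + C e₁ * X + C (e₁ ^ 2 - A)).natDegree = 2 := by compute_degree!
  obtain ⟨e₂, h2⟩ := IsAlgClosed.exists_root (X ^ 2 + C e₁ * X + C (e₁ ^ 2 - A)) (by
    rw [degree_eq_natDegree (by rintro h; rw [h, natDegree_zero] at h2'; omega), h2']; norm_num)
  rw [IsRoot, eval_polyE2] at h1
  simp only [IsRoot, eval_add, eval_pow, eval_X, eval_mul, eval_C] at h2
  refine ⟨e₁, e₂, -(e₁ + e₂), Polynomial.funext fun x => ?_⟩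
  rw [eval_polyE2]
  simp only [eval_mul, eval_sub, eval_X, eval_C]
  linear_combination h1 + (x - e₁) * h2

/-- The cubic splits into linear factors, none of which vanishes at ρ, so the binomial roots of the
factors can be multiplied. -/
lemma exists_isSqrtExpansion {ρ : ℂ} (hρ : (polyE2 A B).eval ρ ≠ 0) :
    ∃ S, IsSqrtExpansion (polyE2 A B) ρ S := by
  obtain ⟨e₁, e₂, e₃, he⟩ := exists_cubic_roots A B
  rw [he] at hρ
  simp only [eval_mul, eval_sub, eval_X, eval_C, mul_ne_zero_iff] at hρ
  obtain ⟨S₁, h1⟩ := PowerSeries.exists_sq_eq_X_add_C hρ.1.1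
  obtain ⟨S₂, h2⟩ := PowerSeries.exists_sq_eq_X_add_C hρ.1.2
  obtain ⟨S₃, h3⟩ := PowerSeries.exists_sq_eq_X_add_C hρ.2
  refine ⟨S₁ * S₂ * S₃, ?_⟩
  rw [IsSqrtExpansion, mul_pow, mul_pow, h1, h2, h3, he]
  simp only [taylor_mul, map_sub, taylor_X, taylor_C, Polynomial.coe_mul, Polynomial.coe_sub,
    Polynomial.coe_add, Polynomial.coe_X, Polynomial.coe_C]
  ring

lemma taylor_polyE2 (A B ρ : ℂ) : taylor ρ (polyE2 A B) =
    X ^ 3 + C (3 * ρ) * X ^ 2 + C (3 * ρ ^ 2 - A) * X + C (ρ ^ 3 - A * ρ - B) := by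
  refine Polynomial.funext fun x => ?_
  rw [taylor_eval, eval_polyE2]
  simp only [eval_add, eval_mul, eval_C, eval_pow, eval_X]
  ring

lemma Matrix.rank_lt_two_iff (M : Matrix (Fin 2) (Fin 2) ℂ) : M.rank < 2 ↔ M.det = 0 := by
  constructor
  · intro h
    by_contra hd
    rw [Matrix.rank_of_det_ne_zero hd] at h
    simp at h
  · intro h
    refine lt_of_le_of_ne (by simpa using M.rank_le_card_width) fun hr => ?_
    have htop : LinearMap.range M.mulVecLin = ⊤ :=
      Submodule.eq_top_of_finrank_eq (by simpa [Matrix.rank] using hr)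
    have := (Matrix.mulVec_surjective_iff_isUnit (A := M)).1 (LinearMap.range_eq_top.1 htop)
    rw [Matrix.isUnit_iff_isUnit_det, h] at this
    simp at this

/-- Comparing coefficients in S² = f determines S₁, …, S₅ recursively as rational functions of ρ, A
and y = S₀, and the determinant then factors. -/
lemma IsSqrtExpansion.rank_lt_two_iff {ρ : ℂ} (hρ : (polyE2 A B).eval ρ ≠ 0) {S : PowerSeries ℂ}
    (hS : IsSqrtExpansion (polyE2 A B) ρ S) :
    (cayleyMatrix S).rank < 2 ↔ Cond3 A B ρ ∨ Cond4 A B ρ := by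
  rw [Matrix.rank_lt_two_iff, cayleyMatrix, Matrix.det_fin_two_of, Cond3, Cond4, ← mul_eq_zero]
  rw [IsSqrtExpansion, taylor_polyE2, sq] at hS
  have hc (n : ℕ) := congrArg (PowerSeries.coeff n) hS
  have h0 := hc 0
  have h1 := hc 1
  have h2 := hc 2
  have h3 := hc 3
  have h4 := hc 4
  have h5 := hc 5
  simp only [PowerSeries.coeff_mul, Finset.Nat.sum_antidiagonal_eq_sum_range_succ_mk,
    Finset.sum_range_succ, Finset.sum_range_zero, Polynomial.coeff_coe, coeff_add, coeff_C_mul,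
    coeff_X_pow, coeff_X, coeff_C] at h0 h1 h2 h3 h4 h5
  norm_num at h0 h1 h2 h3 h4 h5
  generalize PowerSeries.constantCoeff S = y at *
  generalize PowerSeries.coeff 1 S = s₁ at *
  generalize PowerSeries.coeff 2 S = s₂ at *
  generalize PowerSeries.coeff 3 S = s₃ at *
  generalize PowerSeries.coeff 4 S = s₄ at *
  generalize PowerSeries.coeff 5 S = s₅ at *
  rw [eval_polyE2] at hρ
  have hy : y ≠ 0 := by
    rintro rfl
    exact hρ (by linear_combination -h0)
  obtain rfl : B = ρ ^ 3 - A * ρ - y ^ 2 := by linear_combination h0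
  have e1 : s₁ = (3 * ρ ^ 2 - A) / (2 * y) := by
    rw [eq_div_iff (by simp [hy])]
    linear_combination h1
  have e2 : s₂ = (3 * ρ - s₁ ^ 2) / (2 * y) := by
    rw [eq_div_iff (by simp [hy])]
    linear_combination h2
  have e3 : s₃ = (1 - 2 * s₁ * s₂) / (2 * y) := by
    rw [eq_div_iff (by simp [hy])]
    linear_combination h3
  have e4 : s₄ = (-2 * s₁ * s₃ - s₂ ^ 2) / (2 * y) := by
    rw [eq_div_iff (by simp [hy])]
    linear_combination h4
  have e5 : s₅ = (-2 * s₁ * s₄ - 2 * s₂ * s₃) / (2 * y) := by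
    rw [eq_div_iff (by simp [hy])]
    linear_combination h5
  rw [e1] at e2
  rw [e1, e2] at e3
  rw [e1, e2, e3] at e4
  rw [e1, e2, e3, e4] at e5
  -- The factor is (2y)¹⁴, the common denominator of the determinant.
  refine eq_zero_iff_of_mul_eq (u := 16384 * y ^ 14) (by simp [hy]) one_ne_zero ?_
  rw [e3, e4, e5]
  field_simp
  ring

end SqrtExpansion

/-! ## Counting torsion points -/

lemma ncard_six_torsion {G : Type*} [AddCommGroup G] (h2 : {x : G | 2 • x = 0}.ncard = 4)
    (h3 : {x : G | 3 • x = 0}.ncard = 9) : {x : G | 6 • x = 0}.ncard = 36 := by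
  have himage : {x : G | 6 • x = 0} =
      (fun p : G × G => p.1 + p.2) '' ({x : G | 2 • x = 0} ×ˢ {x : G | 3 • x = 0}) := by
    ext x
    constructor
    · intro hx
      have hx' : 6 • x = 0 := hx
      -- The splitting into 2-torsion and 3-torsion comes from 1 = 3 - 2.
      refine ⟨(3 • x, -(2 • x)), ⟨?_, ?_⟩, ?_⟩
      · change 2 • 3 • x = 0
        rw [smul_smul]
        exact hx'
      · change 3 • -(2 • x) = 0
        rw [smul_neg, smul_smul, neg_eq_zero]
        exact hx'
      · change 3 • x + -(2 • x) = x
        rw [succ_nsmul]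
        abel
    · rintro ⟨⟨a, b⟩, ⟨ha, hb⟩, rfl⟩
      have ha' : 2 • a = 0 := ha
      have hb' : 3 • b = 0 := hb
      change 6 • (a + b) = 0
      rw [smul_add, show 6 • a = 3 • 2 • a by rw [smul_smul]; norm_num,
        show 6 • b = 2 • 3 • b by rw [smul_smul]; norm_num, ha', hb']
      simp
  rw [himage, Set.InjOn.ncard_image, Set.ncard_prod, h2, h3]
  rintro ⟨a, b⟩ ⟨ha, hb⟩ ⟨a', b'⟩ ⟨ha', hb'⟩ h
  have ha : 2 • a = 0 := ha
  have hb : 3 • b = 0 := hb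
  have ha' : 2 • a' = 0 := ha'
  have hb' : 3 • b' = 0 := hb'
  have h : a + b = a' + b' := h
  have e : a = a' := by
    have h1 := congrArg (3 • ·) h
    simp only [smul_add, hb, hb', add_zero] at h1
    rwa [succ_nsmul a 2, succ_nsmul a' 2, ha, ha', zero_add, zero_add] at h1
  subst e
  rw [add_left_cancel h]

section Count

variable {A B : ℂ}

lemma cubic_separable (hΔ : 4 * A ^ 3 ≠ 27 * B ^ 2) : (polyE2 A B).Separable := by
  rw [Polynomial.Separable, Polynomial.isCoprime_iff_aeval_ne_zero_of_isAlgClosed (K := ℂ) (k := ℂ)]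
  intro a
  by_cases h : (polyE2 A B).eval a = 0
  · exact .inr (by simpa using (isSmoothOdd_polyE2 hΔ).smooth a h)
  · exact .inl (by simpa using h)

lemma ncard_roots_of_separable {p : ℂ[X]} (hp : p.Separable) :
    {x | p.eval x = 0}.ncard = p.natDegree := by
  classical
  have h : {x | p.eval x = 0} = (p.roots.toFinset : Set ℂ) := by
    ext x
    simp [hp.ne_zero]
  rw [h, Set.ncard_coe_finset, Multiset.toFinset_card_of_nodup (nodup_roots hp)]
  exact (IsAlgClosed.splits p).natDegree_eq_card_roots.symm

lemma ncard_two_torsion (hΔ : 4 * A ^ 3 ≠ 27 * B ^ 2) :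
    {P : (ellCurve A B).Point | 2 • P = 0}.ncard = 4 := by
  have h : {P : (ellCurve A B).Point | 2 • P = 0} =
      insert 0 ((fun x => ellPt A B x 0) '' {x | (polyE2 A B).eval x = 0}) := by
    ext P
    obtain ⟨Q, rfl⟩ := (HPoint.toEll_bijective hΔ).2 P
    cases Q with
    | inf => simp [HPoint.toEll_inf]
    | aff x y hxy =>
      have hxy' := hxy
      rw [eval_polyE2] at hxy'
      simp only [HPoint.toEll_aff, Set.mem_ofPred_eq, two_nsmul_ellPt_eq_zero_iff hΔ hxy',
        Set.mem_insert_iff, ellPt_ne_zero hΔ hxy', false_or, Set.mem_image]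
      constructor
      · rintro rfl
        exact ⟨x, by simpa using hxy.symm, rfl⟩
      · rintro ⟨x', h0, he⟩
        rw [eval_polyE2] at h0
        exact ((ellPt_inj hΔ (by simp [h0]) hxy').1 he).2.symm
  have hinj : Set.InjOn (fun x => ellPt A B x 0) {x | (polyE2 A B).eval x = 0} := by
    intro x hx x' hx' he
    rw [Set.mem_ofPred_eq, eval_polyE2] at hx hx'
    exact ((ellPt_inj hΔ (by simp [hx]) (by simp [hx'])).1 he).1
  have hn : {x | (polyE2 A B).eval x = 0}.ncard = 3 := by
    rw [ncard_roots_of_separable (cubic_separable hΔ), (isSmoothOdd_polyE2 hΔ).natDegree_eq]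
  have hfin : {x | (polyE2 A B).eval x = 0}.Finite := Set.finite_of_ncard_ne_zero (by omega)
  rw [h, Set.ncard_insert_of_notMem _ (hfin.image _), hinj.ncard_image, hn]
  rintro ⟨x, hx, he⟩
  rw [Set.mem_ofPred_eq, eval_polyE2] at hx
  exact ellPt_ne_zero hΔ (by simp [hx]) he

/-- Two points lie over every `x` that is not a branch point. -/
lemma ncard_points_over (hΔ : 4 * A ^ 3 ≠ 27 * B ^ 2) {R : Set ℂ} (hR : R.Finite)
    (h0 : ∀ x ∈ R, x ^ 3 - A * x - B ≠ 0) :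
    {P : (ellCurve A B).Point | ∃ x ∈ R, ∃ y, y ^ 2 = x ^ 3 - A * x - B ∧
      P = ellPt A B x y}.ncard = 2 * R.ncard := by
  have hs (x : ℂ) : ∃ s, s ^ 2 = x ^ 3 - A * x - B := IsAlgClosed.exists_pow_nat_eq _ two_pos
  choose s hs using hs
  have hs' (x : ℂ) : (-s x) ^ 2 = x ^ 3 - A * x - B := by rw [neg_sq, hs]
  have hunion : {P : (ellCurve A B).Point | ∃ x ∈ R, ∃ y, y ^ 2 = x ^ 3 - A * x - B ∧
      P = ellPt A B x y} =
      (fun x => ellPt A B x (s x)) '' R ∪ (fun x => ellPt A B x (-s x)) '' R := by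
    ext P
    constructor
    · rintro ⟨x, hx, y, hy, rfl⟩
      rcases sq_eq_sq_iff_eq_or_eq_neg.1 (hy.trans (hs x).symm) with rfl | rfl
      · exact .inl ⟨x, hx, rfl⟩
      · exact .inr ⟨x, hx, rfl⟩
    · rintro (⟨x, hx, rfl⟩ | ⟨x, hx, rfl⟩)
      · exact ⟨x, hx, _, hs x, rfl⟩
      · exact ⟨x, hx, _, hs' x, rfl⟩
  rw [hunion, Set.ncard_union_eq _ (hR.image _) (hR.image _), Set.InjOn.ncard_image,
    Set.InjOn.ncard_image, two_mul]
  · exact fun x _ x' _ h => ((ellPt_inj hΔ (hs' x) (hs' x')).1 h).1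
  · exact fun x _ x' _ h => ((ellPt_inj hΔ (hs x) (hs x')).1 h).1
  · rw [Set.disjoint_left]
    rintro _ ⟨x, hx, rfl⟩ ⟨x', hx', h⟩
    obtain ⟨rfl, h⟩ := (ellPt_inj hΔ (hs' x') (hs x)).1 h
    refine h0 x' hx (by rw [← hs, self_eq_neg.1 h.symm]; simp)

/-- The third division polynomial. -/
noncomputable def quarticPoly (A B : ℂ) : ℂ[X] :=
  C 3 * X ^ 4 - C (6 * A) * X ^ 2 - C (12 * B) * X - C (A ^ 2)

lemma eval_quarticPoly_eq_zero_iff (x : ℂ) : (quarticPoly A B).eval x = 0 ↔ Cond3 A B x := by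
  simp [quarticPoly, Cond3]

/-- The derivative of the quartic is 12 times the cubic, which does not vanish at the roots of the
quartic; these are therefore simple. -/
lemma ncard_cond3 (hΔ : 4 * A ^ 3 ≠ 27 * B ^ 2) : {x | Cond3 A B x}.ncard = 4 := by
  have hs : (quarticPoly A B).Separable := by
    rw [Polynomial.Separable,
      Polynomial.isCoprime_iff_aeval_ne_zero_of_isAlgClosed (K := ℂ) (k := ℂ)]
    intro a
    by_cases h : (quarticPoly A B).eval a = 0
    · refine .inr ?_
      have := ((eval_quarticPoly_eq_zero_iff a).1 h).eval_ne_zero hΔ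
      have e : (quarticPoly A B).derivative.eval a = 12 * (a ^ 3 - A * a - B) := by
        simp [quarticPoly, -map_pow]
        ring
      simpa [e] using this
    · exact .inl (by simpa using h)
  simp_rw [← eval_quarticPoly_eq_zero_iff]
  rw [ncard_roots_of_separable hs, quarticPoly]
  compute_degree!

lemma ncard_three_torsion (hΔ : 4 * A ^ 3 ≠ 27 * B ^ 2) :
    {P : (ellCurve A B).Point | 3 • P = 0}.ncard = 9 := by
  have hfin : {x | Cond3 A B x}.Finite :=
    Set.finite_of_ncard_ne_zero (by rw [ncard_cond3 hΔ]; norm_num)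
  have hcard := ncard_points_over hΔ hfin fun x hx => Cond3.eval_ne_zero hΔ hx
  rw [ncard_cond3 hΔ] at hcard
  have h : {P : (ellCurve A B).Point | 3 • P = 0} =
      insert 0 {P | ∃ x ∈ {x | Cond3 A B x}, ∃ y, y ^ 2 = x ^ 3 - A * x - B ∧
        P = ellPt A B x y} := by
    ext P
    obtain ⟨Q, rfl⟩ := (HPoint.toEll_bijective hΔ).2 P
    cases Q with
    | inf => simp [HPoint.toEll_inf]
    | aff x y hxy =>
      rw [eval_polyE2] at hxy
      simp only [HPoint.toEll_aff, Set.mem_ofPred_eq, three_nsmul_ellPt_eq_zero_iff hΔ hxy,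
        Set.mem_insert_iff, ellPt_ne_zero hΔ hxy, false_or]
      constructor
      · exact fun hc => ⟨x, hc, y, hxy, rfl⟩
      · rintro ⟨x', hc, y', hy', he⟩
        rwa [((ellPt_inj hΔ hxy hy').1 he).1]
  rw [h, Set.ncard_insert_of_notMem _ (Set.finite_of_ncard_ne_zero (by omega)), hcard]
  rintro ⟨x, -, y, hy, he⟩
  exact ellPt_ne_zero hΔ hy he.symm

lemma ncard_exact_torsion {G : Type*} [AddCommGroup G] (h2 : {x : G | 2 • x = 0}.ncard = 4)
    (h6 : {x : G | 6 • x = 0}.ncard = 36) : {x : G | 6 • x = 0 ∧ 2 • x ≠ 0}.ncard = 32 := by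
  have h : {x : G | 6 • x = 0 ∧ 2 • x ≠ 0} = {x : G | 6 • x = 0} \ {x : G | 2 • x = 0} := rfl
  rw [h, Set.ncard_sdiff _ (Set.finite_of_ncard_ne_zero (by omega)), h2, h6]
  intro x (hx : 2 • x = 0)
  change 6 • x = 0
  rw [show 6 • x = 3 • 2 • x by rw [smul_smul]; norm_num, hx, smul_zero]

lemma mem_rootPoints_iff (hΔ : 4 * A ^ 3 ≠ 27 * B ^ 2) (P : HPoint (polyE2 A B)) :
    P ∈ rootPoints A B ↔ 6 • P.toEll = 0 ∧ 2 • P.toEll ≠ 0 := by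
  cases P with
  | inf =>
    refine iff_of_false ?_ (by simp [HPoint.toEll_inf])
    rintro ⟨ρ, σ, h, he, -⟩
    cases he
  | aff x y hxy =>
    have hxy' := hxy
    rw [eval_polyE2] at hxy'
    rw [HPoint.toEll_aff, ellPt_torsion_iff hΔ hxy']
    constructor
    · rintro ⟨ρ, σ, h, he, hc⟩
      cases he
      exact hc
    · exact fun hc => ⟨x, y, hxy, rfl, hc⟩

lemma ncard_rootPoints (hΔ : 4 * A ^ 3 ≠ 27 * B ^ 2) : (rootPoints A B).ncard = 32 := by
  have h6 := ncard_six_torsion (ncard_two_torsion hΔ) (ncard_three_torsion hΔ)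
  rw [← ncard_exact_torsion (ncard_two_torsion hΔ) h6,
    ← Set.ncard_image_of_injective _ (HPoint.toEll_bijective hΔ).1]
  congr 1
  ext P
  obtain ⟨Q, rfl⟩ := (HPoint.toEll_bijective hΔ).2 P
  rw [(HPoint.toEll_bijective hΔ).1.mem_set_image]
  exact mem_rootPoints_iff hΔ Q

/-- The count runs from points to roots: each root carries exactly two of the 32 points. -/
lemma ncard_cond (hΔ : 4 * A ^ 3 ≠ 27 * B ^ 2) :
    {ρ | Cond3 A B ρ ∨ Cond4 A B ρ}.ncard = 16 := by
  set R := {ρ | Cond3 A B ρ ∨ Cond4 A B ρ} with hR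
  have h0 : ∀ x ∈ R, x ^ 3 - A * x - B ≠ 0 := by
    rintro x (hx | hx)
    · exact hx.eval_ne_zero hΔ
    · exact hx.eval_ne_zero hΔ
  have hset : {P : (ellCurve A B).Point | ∃ x ∈ R, ∃ y, y ^ 2 = x ^ 3 - A * x - B ∧
      P = ellPt A B x y} = HPoint.toEll '' rootPoints A B := by
    ext P
    constructor
    · rintro ⟨x, hx, y, hy, rfl⟩
      exact ⟨.aff x y (by rw [hy, eval_polyE2]), ⟨x, y, _, rfl, hx⟩, rfl⟩
    · rintro ⟨_, ⟨x, y, h, rfl, hx⟩, rfl⟩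
      exact ⟨x, hx, y, by rw [h, eval_polyE2], rfl⟩
  have hcard : (HPoint.toEll '' rootPoints A B).ncard = 32 := by
    rw [Set.ncard_image_of_injective _ (HPoint.toEll_bijective hΔ).1, ncard_rootPoints hΔ]
  -- Choosing one point over each root embeds the roots into the 32 points; finiteness has to come
  -- first, as `ncard` is 0 on infinite sets.
  have hfin : R.Finite := by
    have hs (x : ℂ) : ∃ s, s ^ 2 = x ^ 3 - A * x - B := IsAlgClosed.exists_pow_nat_eq _ two_pos
    choose s hs using hs
    refine Set.Finite.of_finite_image (f := fun x => ellPt A B x (s x))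
      ((Set.finite_of_ncard_ne_zero (by rw [hcard]; norm_num)).subset ?_)
      fun x _ x' _ h => ((ellPt_inj hΔ (hs x) (hs x')).1 h).1
    rw [← hset]
    rintro _ ⟨x, hx, rfl⟩
    exact ⟨x, hx, _, hs x, rfl⟩
  have := ncard_points_over hΔ hfin h0
  rw [hset, hcard] at this
  omega

end Count

section Covering

open Filter Topology Metric

/-! ## The 3:1 covering -/

/-- The discriminant of ℰ₂ factors through g₂ and g₂³ - 27g₃², so the hypotheses on H make ℰ₂
smooth. -/
lemma modG_disc_ne {g2 g3 : ℂ} (hg2 : g2 ≠ 0) (hg3 : g2 ^ 3 ≠ 27 * g3 ^ 2) :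
    4 * modG2 g2 g3 ^ 3 ≠ 27 * modG3 g2 g3 ^ 2 := by
  rw [← sub_ne_zero]
  have : 4 * modG2 g2 g3 ^ 3 - 27 * modG3 g2 g3 ^ 2 =
      19683 / 1024 * (g2 ^ 3 * (g2 ^ 3 - 27 * g3 ^ 2) ^ 2) := by
    rw [modG2, modG3]
    ring
  rw [this]
  exact mul_ne_zero (by norm_num)
    (mul_ne_zero (pow_ne_zero 3 hg2) (pow_ne_zero 2 (sub_ne_zero.2 hg3)))

/-- The second coordinate of the covering. -/
noncomputable def coverW (g2 z w : ℂ) : ℂ := -w * (z ^ 2 - 3 / 4 * g2)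

section Cover

variable {g2 g3 : ℂ}

lemma eval_polyH (z : ℂ) : (polyH g2 g3).eval z =
    -1 / 4 * (4 * z ^ 3 - 9 * g2 * z - 27 * g3) * (z ^ 2 - 3 * g2) := by
  simp [polyH]

lemma eval_derivative_polyH (z : ℂ) : (polyH g2 g3).derivative.eval z =
    -1 / 4 * ((12 * z ^ 2 - 9 * g2) * (z ^ 2 - 3 * g2) +
      (4 * z ^ 3 - 9 * g2 * z - 27 * g3) * (2 * z)) := by
  simp [polyH, derivative_mul]
  ring

/-- A double root is a common root of the cubic and quadratic factors, or a double root of one of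
them. The quadratic gives g₂ = 0; the other two cases give g₂³ = 27g₃². -/
lemma polyH_smooth (hg2 : g2 ≠ 0) (hg3 : g2 ^ 3 ≠ 27 * g3 ^ 2) {z : ℂ}
    (h : (polyH g2 g3).eval z = 0) : (polyH g2 g3).derivative.eval z ≠ 0 := by
  rw [eval_polyH] at h
  rw [eval_derivative_polyH]
  intro h'
  have common (hp : 4 * z ^ 3 - 9 * g2 * z - 27 * g3 = 0) (hq : z ^ 2 - 3 * g2 = 0) : False := by
    have h1 : g2 * z = 9 * g3 := by linear_combination hp / 3 - 4 / 3 * z * hq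
    refine hg3 ?_
    linear_combination (1 / 3 * (g2 * z) + 3 * g3) * h1 - 1 / 3 * g2 ^ 2 * hq
  have h0 : (4 * z ^ 3 - 9 * g2 * z - 27 * g3) * (z ^ 2 - 3 * g2) = 0 := by
    linear_combination -4 * h
  rcases mul_eq_zero.1 h0 with hp | hq
  · have h1 : (12 * z ^ 2 - 9 * g2) * (z ^ 2 - 3 * g2) = 0 := by
      linear_combination -4 * h' - 2 * z * hp
    rcases mul_eq_zero.1 h1 with hp' | hq
    · have h2 : g2 * z = -9 / 2 * g3 := by linear_combination -hp / 6 + z * hp' / 18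
      refine hg3 ?_
      linear_combination (4 / 3 * (g2 * z) - 6 * g3) * h2 - 1 / 9 * g2 ^ 2 * hp'
    · exact common hp hq
  · have h1 : (4 * z ^ 3 - 9 * g2 * z - 27 * g3) * (2 * z) = 0 := by
      linear_combination -4 * h' - (12 * z ^ 2 - 9 * g2) * hq
    rcases mul_eq_zero.1 h1 with hp | hz
    · exact common hp hq
    · have hz : z = 0 := by linear_combination hz / 2
      rw [hz] at hq
      exact hg2 (by linear_combination -hq / 3)

lemma cover_eqn {z w : ℂ} (h : w ^ 2 = (polyH g2 g3).eval z) :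
    coverW g2 z w ^ 2 = coverZ g2 g3 z ^ 3 - modG2 g2 g3 * coverZ g2 g3 z - modG3 g2 g3 := by
  rw [eval_polyH] at h
  rw [coverW, coverZ, modG2, modG3]
  linear_combination (z ^ 2 - 3 / 4 * g2) ^ 2 * h

/-- The differential `dZ / W` pulls back to `3 dz / w`. -/
lemma isAffineFlow_cover {z w v : ℝ → ℂ} {t : ℝ} (h : w t ^ 2 = (polyH g2 g3).eval (z t))
    (hz : HasDerivWithinAt z (w t * v t) (Set.Icc 0 1) t)
    (hw : HasDerivWithinAt w ((polyH g2 g3).derivative.eval (z t) / 2 * v t) (Set.Icc 0 1) t) :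
    IsAffineFlow (modG2 g2 g3) (modG3 g2 g3) (fun t => coverZ g2 g3 (z t))
      (fun t => coverW g2 (z t) (w t)) (fun t => 3 * v t) t := by
  refine ⟨cover_eqn h, ?_, ?_⟩
  · have := (((hz.pow 3).sub (hz.const_mul (9 / 4 * g2))).sub_const (9 / 4 * g3)).neg
    refine this.congr_deriv ?_
    rw [coverW]
    push_cast
    ring
  · have := hw.neg.mul ((hz.pow 2).sub_const (3 / 4 * g2))
    refine this.congr_deriv ?_
    rw [eval_polyH] at h
    rw [eval_derivative_polyH, coverZ, modG2]
    simp only [Pi.pow_apply, Pi.neg_apply]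
    push_cast
    linear_combination (-2 * z t * v t) * h

/-! The covering near the point `z = ∞`, in the coordinate `l = 1 / (z - β)`. -/

/-- `- l ^ 3 Z` in terms of `l = 1 / (z - β)`. -/
noncomputable def coverN (g2 g3 β l : ℂ) : ℂ :=
  (1 + β * l) ^ 3 - 9 / 4 * g2 * l ^ 2 * (1 + β * l) - 9 / 4 * g3 * l ^ 3

/-- `l ^ 2 (z ^ 2 - 3 / 4 g₂)` in terms of `l = 1 / (z - β)`. -/
noncomputable def coverM (g2 β l : ℂ) : ℂ := (1 + β * l) ^ 2 - 3 / 4 * g2 * l ^ 2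

/-- The polynomial of `H` in the variable `l = 1 / (z - β)`. -/
noncomputable def polyHInv (g2 g3 β : ℂ) : ℂ[X] :=
  C (-1 / 4) * (4 * (1 + C β * X) ^ 3 - C (9 * g2) * X ^ 2 * (1 + C β * X) - C (27 * g3) * X ^ 3) *
    ((1 + C β * X) ^ 2 - C (3 * g2) * X ^ 2)

lemma eval_polyHInv (β l : ℂ) : (polyHInv g2 g3 β).eval l =
    -1 / 4 * (4 * (1 + β * l) ^ 3 - 9 * g2 * l ^ 2 * (1 + β * l) - 27 * g3 * l ^ 3) *
      ((1 + β * l) ^ 2 - 3 * g2 * l ^ 2) := by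
  simp [polyHInv]

lemma eval_derivative_polyHInv (β l : ℂ) : (polyHInv g2 g3 β).derivative.eval l =
    -1 / 4 * ((12 * β * (1 + β * l) ^ 2 - 18 * g2 * l * (1 + β * l) - 9 * g2 * β * l ^ 2
        - 81 * g3 * l ^ 2) * ((1 + β * l) ^ 2 - 3 * g2 * l ^ 2) +
      (4 * (1 + β * l) ^ 3 - 9 * g2 * l ^ 2 * (1 + β * l) - 27 * g3 * l ^ 3) *
      (2 * β * (1 + β * l) - 6 * g2 * l)) := by
  simp [polyHInv, derivative_mul, derivative_pow]
  ring

lemma eval_polyHInv_of_ne_zero {β l : ℂ} (hl : l ≠ 0) :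
    (polyHInv g2 g3 β).eval l = l ^ 5 * (polyH g2 g3).eval (1 / l + β) := by
  rw [eval_polyHInv, eval_polyH]
  field_simp

/-- In the coordinate l the covering has ξ = 1/Z = -l³/N with N(0) = 1, regular at l = 0, so paths
through the ramification point over infinity are followed without a break. -/
lemma isInfiniteFlow_cover {β κ : ℂ} (hκ : κ ≠ 0) {l m v : ℝ → ℂ} {t : ℝ}
    (hN : coverN g2 g3 β (l t) ≠ 0)
    (h : m t ^ 2 = κ ^ 2 * (l t * (polyHInv g2 g3 β).eval (l t)))
    (hl : HasDerivWithinAt l (m t * v t) (Set.Icc 0 1) t)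
    (hm : HasDerivWithinAt m (κ ^ 2 * ((polyHInv g2 g3 β).eval (l t) +
      l t * (polyHInv g2 g3 β).derivative.eval (l t)) / 2 * v t) (Set.Icc 0 1) t) :
    IsInfiniteFlow (modG2 g2 g3) (modG3 g2 g3) (fun t => -l t ^ 3 / coverN g2 g3 β (l t))
      (fun t => -(m t * coverM g2 β (l t) * l t) / (κ * coverN g2 g3 β (l t) ^ 2))
      (fun t => -3 * κ * (l t * v t)) t := by
  have du := (hl.const_mul β).const_add 1
  have dN : HasDerivWithinAt (fun t => coverN g2 g3 β (l t))
      ((3 * β * (1 + β * l t) ^ 2 - 9 / 2 * g2 * l t * (1 + β * l t) - 9 / 4 * g2 * l t ^ 2 * β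
        - 27 / 4 * g3 * l t ^ 2) * (m t * v t)) (Set.Icc 0 1) t := by
    have := ((du.pow 3).sub (((hl.pow 2).const_mul (9 / 4 * g2)).mul du)).sub
      ((hl.pow 3).const_mul (9 / 4 * g3))
    refine this.congr_deriv ?_
    simp only [Pi.pow_apply]
    push_cast
    ring
  have dM : HasDerivWithinAt (fun t => coverM g2 β (l t))
      ((2 * β * (1 + β * l t) - 3 / 2 * g2 * l t) * (m t * v t)) (Set.Icc 0 1) t := by
    have := (du.pow 2).sub ((hl.pow 2).const_mul (3 / 4 * g2))
    refine this.congr_deriv ?_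
    push_cast
    ring
  rw [eval_polyHInv] at h
  rw [eval_polyHInv, eval_derivative_polyHInv] at hm
  have hκN : κ * coverN g2 g3 β (l t) ^ 2 ≠ 0 := mul_ne_zero hκ (pow_ne_zero 2 hN)
  refine ⟨?_, ?_, ?_⟩
  · field_simp
    rw [h, modG2, modG3, coverM, coverN]
    ring
  · refine (((hl.pow 3).neg).div dN hN).congr_deriv ?_
    simp only [Pi.pow_apply, Pi.neg_apply]
    push_cast
    field_simp
    rw [coverM, coverN]
    ring
  · refine (((hm.mul dM).mul hl).neg.div ((dN.pow 2).const_mul κ) hκN).congr_deriv ?_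
    simp only [Pi.pow_apply, Pi.neg_apply, Pi.mul_apply]
    push_cast
    rw [div_eq_iff (pow_ne_zero 2 hκN)]
    -- Clearing N first leaves a polynomial identity modulo the equation of Γ.
    have hr : -(1 - 3 * modG2 g2 g3 * (-l t ^ 3 / coverN g2 g3 β (l t)) ^ 2 -
        4 * modG3 g2 g3 * (-l t ^ 3 / coverN g2 g3 β (l t)) ^ 3) / 2 * (-3 * κ * (l t * v t)) *
        (κ * coverN g2 g3 β (l t) ^ 2) ^ 2 = 3 / 2 * κ ^ 3 * l t * v t *
        (coverN g2 g3 β (l t) ^ 4 - 3 * modG2 g2 g3 * l t ^ 6 * coverN g2 g3 β (l t) ^ 2 +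
          4 * modG3 g2 g3 * l t ^ 9 * coverN g2 g3 β (l t)) := by
      field_simp
      ring
    rw [hr, modG2, modG3, coverM, coverN]
    linear_combination v t * κ * ((1 + β * l t) ^ 3 - 9 / 4 * g2 * l t ^ 2 * (1 + β * l t) -
      9 / 4 * g3 * l t ^ 3) * (2 * ((1 + β * l t) ^ 2 - 3 / 4 * g2 * l t ^ 2) * l t *
      (3 * β * (1 + β * l t) ^ 2 - 9 / 2 * g2 * l t * (1 + β * l t) - 9 / 4 * g2 * l t ^ 2 * β
        - 27 / 4 * g3 * l t ^ 2) - ((2 * β * (1 + β * l t) - 3 / 2 * g2 * l t) * l t +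
      ((1 + β * l t) ^ 2 - 3 / 4 * g2 * l t ^ 2)) * ((1 + β * l t) ^ 3 - 9 / 4 * g2 * l t ^ 2 *
      (1 + β * l t) - 9 / 4 * g3 * l t ^ 3)) * h

end Cover

/-! ### The covering of the elliptic curve by Γ -/

section Gamma

variable {g2 g3 β κ c : ℂ} {a : Fin 3 → ℂ}

/-- The constant κ² = a₁a₂a₃c is the normalisation for which μ = κ w / (z - β)³. -/
lemma polyGamma_eq (h : IsThreeToOneCase g2 g3 β a c) (hκ : κ ^ 2 = a 0 * a 1 * a 2 * c) :
    polyGamma a c = C (κ ^ 2) * (X * polyHInv g2 g3 β) := by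
  obtain ⟨ha, hc, hH⟩ := h
  have h0 := ha 0
  have h1 := ha 1
  have h2 := ha 2
  refine Polynomial.funext fun l => ?_
  rw [eval_mul, eval_mul, eval_X, eval_C]
  by_cases hl : l = 0
  · simp [hl, polyGamma]
  · rw [eval_polyHInv_of_ne_zero hl, hH, hκ, polyGamma]
    simp only [Fin.prod_univ_three, eval_neg, eval_mul, eval_sub, eval_X, eval_C]
    field_simp
    ring

lemma isSmoothOdd_polyGamma (hg2 : g2 ≠ 0) (hg3 : g2 ^ 3 ≠ 27 * g3 ^ 2)
    (h : IsThreeToOneCase g2 g3 β a c) : IsSmoothOdd 2 (polyGamma a c) := by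
  obtain ⟨κ, hκ⟩ := IsAlgClosed.exists_pow_nat_eq (a 0 * a 1 * a 2 * c) (n := 2) two_pos
  have hK : κ ^ 2 ≠ 0 := by
    rw [hκ]
    simp [h.1, h.2.1]
  refine ⟨?_, fun l hl hl' => ?_⟩
  · rw [polyGamma, Fin.prod_univ_three, natDegree_neg]
    compute_degree!
  · rw [polyGamma_eq h hκ] at hl hl'
    rw [eval_mul, eval_C, mul_eq_zero, or_iff_right hK, eval_mul, eval_X] at hl
    rw [derivative_C_mul, eval_mul, eval_C, mul_eq_zero, or_iff_right hK, derivative_mul,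
      derivative_X, one_mul, eval_add, eval_mul, eval_X] at hl'
    by_cases h0 : l = 0
    -- At l = 0 the factor `polyHInv` has the value -1, so this root is simple.
    · rw [h0, zero_mul, add_zero, eval_polyHInv] at hl'
      norm_num at hl'
    · have hz : (polyHInv g2 g3 β).eval l = 0 := (mul_eq_zero.1 hl).resolve_left h0
      rw [hz, zero_add, mul_eq_zero, or_iff_right h0] at hl'
      have hH := hz
      rw [eval_polyHInv_of_ne_zero h0, mul_eq_zero, or_iff_right (pow_ne_zero 5 h0)] at hH
      refine polyH_smooth hg2 hg3 hH ?_
      -- Differentiating `polyHInv l = l ^ 5 * polyH (1 / l + β)` at a root shows that the two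
      -- derivatives vanish together.
      have d1 : HasDerivAt (fun l => (polyH g2 g3).eval (1 / l + β))
          ((polyH g2 g3).derivative.eval (1 / l + β) * (-(l ^ 2)⁻¹)) l := by
        have := (polyH g2 g3).hasDerivAt (1 / l + β)
        have e : HasDerivAt (fun l : ℂ => 1 / l + β) (-(l ^ 2)⁻¹) l := by
          simpa using (hasDerivAt_inv h0).add_const β
        exact this.comp l e
      have d2 := (hasDerivAt_pow 5 l).mul d1
      have d3 := (polyHInv g2 g3 β).hasDerivAt l
      have heq : (fun l => (polyHInv g2 g3 β).eval l) =ᶠ[𝓝 l]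
          (fun l => l ^ 5) * fun l => (polyH g2 g3).eval (1 / l + β) := by
        filter_upwards [isOpen_ne.mem_nhds h0] with l' hl'
        exact eval_polyHInv_of_ne_zero hl'
      have := d3.unique (d2.congr_of_eventuallyEq heq)
      rw [hl', hH, mul_zero, zero_add] at this
      simpa [h0] using this.symm

/-- The coordinate at infinity of Γ is ξ = 1/λ = z - β, so this chart is the affine curve H,
translated and rescaled. -/
lemma X_mul_reverse_polyGamma (hf : IsSmoothOdd 2 (polyGamma a c))
    (h : IsThreeToOneCase g2 g3 β a c) (hκ : κ ^ 2 = a 0 * a 1 * a 2 * c) :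
    X * (polyGamma a c).reverse = C (κ ^ 2) * (polyH g2 g3).comp (X + C β) := by
  refine Polynomial.funext fun ξ => ?_
  rw [eval_mul (p := C _), eval_C, eval_comp, eval_add, eval_X, eval_C]
  by_cases hξ : ξ = 0
  · rw [hξ, h.2.2]
    simp
  · have hi : (1 : ℂ) / ξ ≠ 0 := by simpa using hξ
    rw [hf.eval_infinite hξ, polyGamma_eq h hκ, eval_mul, eval_mul, eval_C, eval_X,
      eval_polyHInv_of_ne_zero hi, one_div_one_div]
    field_simp
    ring

open Classical in
/-- The image on the elliptic curve of the point `(l, m)` of `Γ`, where `l = 1 / (z - β)` and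
`m = κ w / (z - β) ^ 3`. -/
noncomputable def coverPt (g2 g3 β κ l m : ℂ) : (ellCurve (modG2 g2 g3) (modG3 g2 g3)).Point :=
  if l = 0 then 0 else
    ellPt _ _ (coverZ g2 g3 (1 / l + β)) (coverW g2 (1 / l + β) (m / (κ * l ^ 3)))

/-- The image on the elliptic curve of the point at infinity of `Γ` and of the points near it. -/
noncomputable def coverPtInf (g2 g3 β κ ξ η : ℂ) :
    (ellCurve (modG2 g2 g3) (modG3 g2 g3)).Point :=
  ellPt _ _ (coverZ g2 g3 (ξ + β)) (coverW g2 (ξ + β) (η / κ))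

/-- The 3:1 covering of the elliptic curve by `Γ`. -/
noncomputable def cover (g2 g3 β κ : ℂ) {a : Fin 3 → ℂ} {c : ℂ} :
    HPoint (polyGamma a c) → (ellCurve (modG2 g2 g3) (modG3 g2 g3)).Point
  | .aff l m _ => coverPt g2 g3 β κ l m
  | .inf => coverPtInf g2 g3 β κ 0 0

lemma cover_of_inAffineChart {P : HPoint (polyGamma a c)} {l m : ℂ} (h : P.InAffineChart l m) :
    cover g2 g3 β κ P = coverPt g2 g3 β κ l m := by
  cases P with
  | inf => exact h.elim
  | aff x y hxy =>
    obtain ⟨rfl, rfl⟩ := h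
    rfl

lemma cover_of_inInfiniteChart {P : HPoint (polyGamma a c)} {ξ η : ℂ}
    (h : P.InInfiniteChart 2 ξ η) : cover g2 g3 β κ P = coverPtInf g2 g3 β κ ξ η := by
  cases P with
  | inf =>
    obtain ⟨rfl, rfl⟩ := h
    rfl
  | aff x y hxy =>
    obtain ⟨h0, rfl, rfl⟩ := h
    rw [cover, coverPt, if_neg h0, coverPtInf, div_div, mul_comm κ]

lemma polyGamma_point_eqn (h : IsThreeToOneCase g2 g3 β a c) (hκ : κ ^ 2 = a 0 * a 1 * a 2 * c)
    (hκ0 : κ ≠ 0) {l m : ℂ} (hl : l ≠ 0) (hm : m ^ 2 = (polyGamma a c).eval l) :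
    (m / (κ * l ^ 3)) ^ 2 = (polyH g2 g3).eval (1 / l + β) := by
  rw [polyGamma_eq h hκ, eval_mul, eval_mul, eval_C, eval_X, eval_polyHInv_of_ne_zero hl] at hm
  rw [div_pow, hm]
  field_simp

/-- Near a time with l = 0 the image is followed in the chart at infinity, and at other times in the
affine chart; both give the velocity -3κ l v. -/
lemma isFlow_coverPt (h : IsThreeToOneCase g2 g3 β a c) (hκ : κ ^ 2 = a 0 * a 1 * a 2 * c)
    (hκ0 : κ ≠ 0) {l m v : ℝ → ℂ} (hp : IsChartPath (polyGamma a c) l m v) :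
    IsFlow (modG2 g2 g3) (modG3 g2 g3) (fun t => coverPt g2 g3 β κ (l t) (m t))
      (fun t => -3 * κ * (l t * v t)) := by
  intro t₀ ht₀
  have hlc : ContinuousWithinAt l (Set.Icc 0 1) t₀ := (hp.2 t₀ ht₀).2.1.continuousWithinAt
  by_cases hl₀ : l t₀ = 0
  · right
    have hN : ∀ᶠ t in 𝓝[Set.Icc 0 1] t₀, coverN g2 g3 β (l t) ≠ 0 := by
      have hc : ContinuousAt (coverN g2 g3 β) (l t₀) := by
        have : Continuous (coverN g2 g3 β) := by
          unfold coverN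
          fun_prop
        exact this.continuousAt
      refine (hc.comp_continuousWithinAt hlc).eventually_ne ?_
      simp [coverN, hl₀]
    refine ⟨fun t => -l t ^ 3 / coverN g2 g3 β (l t),
      fun t => -(m t * coverM g2 β (l t) * l t) / (κ * coverN g2 g3 β (l t) ^ 2), ?_⟩
    filter_upwards [hN, self_mem_nhdsWithin] with t hN ht
    obtain ⟨h1, h2, h3⟩ := hp.2 t ht
    constructor
    · refine isInfiniteFlow_cover hκ0 hN ?_ h2 ?_
      · rw [h1, polyGamma_eq h hκ]
        simp
      · refine h3.congr_deriv ?_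
        rw [polyGamma_eq h hκ, derivative_C_mul, derivative_mul, derivative_X, one_mul]
        simp
    · by_cases hl : l t = 0
      · rw [coverPt, if_pos hl, hl]
        simp
      · rw [coverPt, if_neg hl, ellPtInf_of_ne_zero (by simp [hl, hN])]
        congr 1
        · rw [coverZ]
          rw [coverN] at hN ⊢
          field_simp
        · rw [coverW, coverM]
          field_simp
  · left
    refine ⟨fun t => coverZ g2 g3 (1 / l t + β),
      fun t => coverW g2 (1 / l t + β) (m t / (κ * l t ^ 3)), ?_⟩
    filter_upwards [hlc.eventually_ne hl₀, self_mem_nhdsWithin] with t hl ht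
    refine ⟨?_, if_neg hl⟩
    obtain ⟨h1, h2, h3⟩ := hp.2 t ht
    have hw := polyGamma_point_eqn h hκ hκ0 hl h1
    have key := isAffineFlow_cover (g2 := g2) (g3 := g3) (z := fun t => 1 / l t + β)
      (w := fun t => m t / (κ * l t ^ 3)) (v := fun t => -κ * (l t * v t)) (t := t) hw ?_ ?_
    · convert key using 2
      ring
    · have := (h2.inv hl).add_const β
      simp only [one_div]
      refine this.congr_deriv ?_
      field_simp
    · refine (h3.div ((h2.pow 3).const_mul κ)
        (mul_ne_zero hκ0 (pow_ne_zero 3 hl))).congr_deriv ?_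
      have hm := h1
      rw [polyGamma_eq h hκ, eval_mul, eval_mul, eval_C, eval_X, eval_polyHInv] at hm
      rw [polyGamma_eq h hκ, derivative_C_mul, derivative_mul, derivative_X, one_mul, eval_mul,
        eval_add, eval_mul, eval_C, eval_X, eval_polyHInv, eval_derivative_polyHInv,
        eval_derivative_polyH]
      simp only [Pi.pow_apply]
      rw [div_eq_iff (pow_ne_zero 2 (mul_ne_zero hκ0 (pow_ne_zero 3 hl)))]
      push_cast
      field_simp
      linear_combination (-24 * v t) * hm

lemma isFlow_coverPtInf (hf : IsSmoothOdd 2 (polyGamma a c)) (h : IsThreeToOneCase g2 g3 β a c)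
    (hκ : κ ^ 2 = a 0 * a 1 * a 2 * c) (hκ0 : κ ≠ 0) {ξ η v : ℝ → ℂ}
    (hp : IsChartPath (X * (polyGamma a c).reverse) ξ η v) :
    IsFlow (modG2 g2 g3) (modG3 g2 g3) (fun t => coverPtInf g2 g3 β κ (ξ t) (η t))
      (fun t => 3 * (κ * v t)) := by
  rw [X_mul_reverse_polyGamma hf h hκ] at hp
  refine fun t₀ _ => .inl ⟨fun t => coverZ g2 g3 (ξ t + β), fun t => coverW g2 (ξ t + β) (η t / κ),
    eventually_nhdsWithin_of_forall fun t ht => ⟨?_, rfl⟩⟩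
  obtain ⟨h1, h2, h3⟩ := hp.2 t ht
  rw [eval_mul, eval_C, eval_comp, eval_add, eval_X, eval_C] at h1
  rw [derivative_C_mul, derivative_comp, eval_mul, eval_mul, eval_C, eval_comp] at h3
  simp only [derivative_add, derivative_X, derivative_C, add_zero, eval_one, one_mul, eval_add,
    eval_X, eval_C] at h3
  refine isAffineFlow_cover ?_ ((h2.add_const β).congr_deriv ?_) ((h3.div_const κ).congr_deriv ?_)
  · rw [div_pow, h1]
    field_simp
  · field_simp
  · field_simp

variable {ξ₀ η₀ : ℂ → ℂ} {Φ : ℂ →+ (ellCurve (modG2 g2 g3) (modG3 g2 g3)).Point}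

/-- The covering maps the integrals of `λ dλ / μ` to the elliptic integrals. -/
theorem cover_eq_add (hg2 : g2 ≠ 0) (hg3 : g2 ^ 3 ≠ 27 * g3 ^ 2)
    (h : IsThreeToOneCase g2 g3 β a c) (hκ : κ ^ 2 = a 0 * a 1 * a 2 * c) (hκ0 : κ ≠ 0)
    (he : IsExp (modG2 g2 g3) (modG3 g2 g3) ξ₀ η₀ Φ) {P Q : HPoint (polyGamma a c)}
    {I : Fin 2 → ℂ} (hI : PathIntegral 2 (polyGamma a c) P Q I) :
    cover g2 g3 β κ Q = cover g2 g3 β κ P + Φ (-3 * κ * I 1) := by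
  have hΔ := modG_disc_ne hg2 hg3
  induction hI with
  | affine P Q x y v hp hP hQ =>
    rw [cover_of_inAffineChart hP, cover_of_inAffineChart hQ,
      he.apply_flow hΔ (γ := fun t => coverPt g2 g3 β κ (x t) (y t)) ?_
        (isFlow_coverPt h hκ hκ0 hp)]
    · congr 2
      rw [intervalIntegral.integral_const_mul]
      simp
    · refine continuousOn_const.mul (ContinuousOn.mul (fun t ht => ?_) hp.1)
      exact (hp.2 t ht).2.1.continuousWithinAt
  | infinite P Q x y v hp hP hQ =>
    rw [cover_of_inInfiniteChart hP, cover_of_inInfiniteChart hQ,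
      he.apply_flow hΔ (γ := fun t => coverPtInf g2 g3 β κ (x t) (y t)) ?_
        (isFlow_coverPtInf (isSmoothOdd_polyGamma hg2 hg3 h) h hκ hκ0 hp)]
    · congr 2
      rw [intervalIntegral.integral_const_mul, intervalIntegral.integral_const_mul]
      -- In genus 2 the differential λ dλ/μ is -dξ/η at infinity, which supplies the sign.
      have : ((1 : Fin 2).rev : ℕ) = 0 := rfl
      simp only [this, pow_zero, one_mul]
      ring
    · exact continuousOn_const.mul (continuousOn_const.mul hp.1)
  | trans P Q R I J _ _ hI hJ =>
    rw [hJ, hI, Pi.add_apply, mul_add, map_add, add_assoc]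

end Gamma

end Covering

/-! ## The Jacobian of the elliptic curve -/

section JacobianEll

variable {A B : ℂ}

lemma exists_jac_equiv (hΔ : 4 * A ^ 3 ≠ 27 * B ^ 2) :
    ∃ J : Jac 1 (polyE2 A B) ≃+ (ellCurve A B).Point,
      ∀ P Q, J (abelInt 1 (polyE2 A B) P Q) = Q.toEll - P.toEll :=
  let ⟨_, _, _, he⟩ := exists_isExp hΔ
  he.exists_jac_equiv hΔ

/-- The end points are opposite, so the integral has class 2E_{ρ+}; this is how the factor 2 and,
for m = 3, the sixth order points arise. -/
lemma nsmul_intRho_eq_zero_iff (hΔ : 4 * A ^ 3 ≠ 27 * B ^ 2) {ρ σ : ℂ}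
    (h : σ ^ 2 = (polyE2 A B).eval ρ) (m : ℕ) :
    m • intRho A B ρ σ h = 0 ↔ (m * 2) • ellPt A B ρ σ = 0 := by
  obtain ⟨J, hJ⟩ := exists_jac_equiv hΔ
  rw [← map_eq_zero_iff J J.injective, map_nsmul, intRho, hJ, HPoint.toEll_neg hΔ, sub_neg_eq_add,
    ← two_nsmul, smul_smul, HPoint.toEll_aff]

lemma ncard_jac_torsion (hΔ : 4 * A ^ 3 ≠ 27 * B ^ 2) (n : ℕ) :
    {x : Jac 1 (polyE2 A B) | n • x = 0}.ncard =
      {P : (ellCurve A B).Point | n • P = 0}.ncard := by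
  obtain ⟨J, -⟩ := exists_jac_equiv hΔ
  rw [← Set.ncard_image_of_injective _ J.injective]
  congr 1
  ext P
  obtain ⟨x, rfl⟩ := J.surjective P
  rw [J.injective.mem_set_image, Set.mem_ofPred_eq, Set.mem_ofPred_eq, ← map_nsmul,
    map_eq_zero_iff J J.injective]

/-- A Weierstrass point has 2O = 0, so replacing P by P - O changes neither 2P nor 6P. -/
lemma bijOn_abelInt_rootPoints (hΔ : 4 * A ^ 3 ≠ 27 * B ^ 2) {O : HPoint (polyE2 A B)}
    (hO : O.IsWeierstrass) :
    Set.BijOn (fun P => abelInt 1 (polyE2 A B) O P) (rootPoints A B)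
      {x | 6 • x = 0 ∧ 2 • x ≠ 0} := by
  obtain ⟨J, hJ⟩ := exists_jac_equiv hΔ
  have h2 : 2 • O.toEll = 0 := by
    have h := HPoint.toEll_neg hΔ O
    rw [hO] at h
    rw [two_nsmul]
    nth_rw 1 [h]
    exact neg_add_cancel _
  have h6 : 6 • O.toEll = 0 := by
    rw [show 6 • O.toEll = 3 • 2 • O.toEll from mul_nsmul' _ 3 2, h2, nsmul_zero]
  have hmem (P) : abelInt 1 (polyE2 A B) O P ∈ {x : Jac 1 (polyE2 A B) | 6 • x = 0 ∧ 2 • x ≠ 0} ↔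
      P ∈ rootPoints A B := by
    rw [mem_rootPoints_iff hΔ, Set.mem_ofPred_eq, Ne, ← map_eq_zero_iff J J.injective,
      ← map_eq_zero_iff J J.injective (x := 2 • _), map_nsmul, map_nsmul, hJ, nsmul_sub, nsmul_sub,
      h2, h6, sub_zero, sub_zero]
  refine ⟨fun P hP => (hmem P).2 hP, fun P _ Q _ h => ?_, fun x hx => ?_⟩
  · have := congrArg J h
    simp only [hJ] at this
    exact (HPoint.toEll_bijective hΔ).1 (sub_left_injective this)
  · obtain ⟨P, hP⟩ := (HPoint.toEll_bijective hΔ).2 (J x + O.toEll)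
    have hx' : abelInt 1 (polyE2 A B) O P = x := J.injective (by rw [hJ, hP, add_sub_cancel_right])
    exact ⟨P, (hmem P).1 (by rwa [hx']), hx'⟩

lemma rootPoints_neg_ne (hΔ : 4 * A ^ 3 ≠ 27 * B ^ 2) {P : HPoint (polyE2 A B)}
    (hP : P ∈ rootPoints A B) : P.neg ≠ P := by
  intro h
  refine ((mem_rootPoints_iff hΔ P).1 hP).2 ?_
  have h' := HPoint.toEll_neg hΔ P
  rw [h] at h'
  rw [two_nsmul]
  nth_rw 1 [h']
  exact neg_add_cancel _

end JacobianEll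

/-! ## The billiard map on geodesics -/

section Billiard

variable {f : ℂ[X]}

/-- The u₁-direction is divided out, so vectors that differ only in the first coordinate give one
geodesic. -/
lemma geodesic_mk_eq {v w : Fin 2 → ℂ} (h : v 1 = w 1) :
    (QuotientAddGroup.mk (QuotientAddGroup.mk v : Jac 2 f) : Geodesic f) =
      QuotientAddGroup.mk (QuotientAddGroup.mk w : Jac 2 f) := by
  rw [QuotientAddGroup.eq]
  refine ⟨-v 0 + w 0, ?_⟩
  rw [u1Flow, AddMonoidHom.comp_apply, QuotientAddGroup.mk'_apply, ← QuotientAddGroup.mk_neg,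
    ← QuotientAddGroup.mk_add]
  congr 1
  funext i
  fin_cases i
  · simp
  · simp [h]

lemma geodesic_mk_add_u1Flow (u : Jac 2 f) (s : ℂ) :
    (QuotientAddGroup.mk (u + u1Flow f s) : Geodesic f) = QuotientAddGroup.mk u :=
  by
  refine (QuotientAddGroup.eq.2 ?_).symm
  rw [neg_add_cancel_left]
  exact ⟨s, rfl⟩

/-- Every geodesic meets the translated theta-divisor. -/
lemma exists_mem_thetaDivisor (hf : IsSmoothOdd 2 f) (E : HPoint f) (γ : Geodesic f) :
    ∃ u ∈ thetaDivisor f E, (QuotientAddGroup.mk u : Geodesic f) = γ := by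
  induction γ using QuotientAddGroup.induction_on with
  | H u =>
    induction u using QuotientAddGroup.induction_on with
    | H I =>
      obtain ⟨K, hK⟩ := exists_pathIntegral hf .inf E
      obtain ⟨P, J, hJ, h1⟩ := exists_pathIntegral_apply_eq hf 1 .inf (I 1 - K 1)
      refine ⟨_, ⟨P, rfl⟩, ?_⟩
      rw [abelInt_eq hJ, abelInt_eq hK, ← QuotientAddGroup.mk_add]
      exact geodesic_mk_eq (by rw [Pi.add_apply, h1, sub_add_cancel])

/-- The billiard acts on the geodesics as the translation by `∫_{E_{d-}}^{E_{d+}}`. -/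
theorem billiardOnGeodesics_iff (hf : IsSmoothOdd 2 f) (E : HPoint f) (γ γ' : Geodesic f) :
    BilliardOnGeodesics f E γ γ' ↔ γ + QuotientAddGroup.mk (abelInt 2 f E.neg E) = γ' := by
  constructor
  · rintro ⟨u, u', ⟨-, -, s, -, rfl⟩, rfl, rfl⟩
    rw [QuotientAddGroup.mk_add, geodesic_mk_add_u1Flow]
  · rintro rfl
    obtain ⟨u, hu, rfl⟩ := exists_mem_thetaDivisor hf E γ
    -- Any intersection of the geodesic with Θ_{d-} may serve as the next impact; the choice changes
    -- the point but not the resulting geodesic.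
    obtain ⟨w, ⟨P, rfl⟩, hw⟩ := exists_mem_thetaDivisor hf E.neg (QuotientAddGroup.mk u)
    obtain ⟨s, hs⟩ := QuotientAddGroup.eq.1 hw.symm
    have hs' : u + u1Flow f s = abelInt 2 f .inf P + abelInt 2 f .inf E.neg := by
      rw [hs]
      abel
    refine ⟨u, u + u1Flow f s + abelInt 2 f E.neg E, ⟨hu, ⟨P, ?_⟩, s, ⟨P, hs'⟩, rfl⟩, rfl, ?_⟩
    · rw [hs', add_assoc, abelInt_add_abelInt hf]
    · rw [QuotientAddGroup.mk_add, geodesic_mk_add_u1Flow]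

end Billiard

/-! ### Periodicity from neutrality on the elliptic curve -/

section Periodicity

variable {g2 g3 β c : ℂ} {a : Fin 3 → ℂ}

/-- The only point of `Γ` over the point at infinity of the elliptic curve is `(0, 0)`. -/
lemma cover_eq_zero (hg2 : g2 ≠ 0) (hg3 : g2 ^ 3 ≠ 27 * g3 ^ 2) {κ : ℂ}
    (h : IsThreeToOneCase g2 g3 β a c) (hκ : κ ^ 2 = a 0 * a 1 * a 2 * c) (hκ0 : κ ≠ 0)
    {Q : HPoint (polyGamma a c)} (hQ : cover g2 g3 β κ Q = 0) :
    Q = .aff 0 0 (by simp [polyGamma]) := by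
  have hΔ := modG_disc_ne hg2 hg3
  cases Q with
  | inf =>
    refine absurd hQ (ellPt_ne_zero hΔ (cover_eqn ?_))
    rw [h.2.2]
    simp
  | aff l m hlm =>
    by_cases hl : l = 0
    · subst hl
      have hm : m = 0 := by simpa [polyGamma] using hlm
      subst hm
      rfl
    · rw [cover, coverPt, if_neg hl] at hQ
      exact absurd hQ (ellPt_ne_zero hΔ (cover_eqn (polyGamma_point_eqn h hκ hκ0 hl hlm)))

/-- Only the second component of m times the shift must be that of a period. Neutrality kills its
image under Φ, and since infinity has a single preimage on Γ, a path issuing from that preimage with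
this second integral is closed. -/
theorem nsmul_geodesic_shift_eq_zero (hg2 : g2 ≠ 0) (hg3 : g2 ^ 3 ≠ 27 * g3 ^ 2)
    (h : IsThreeToOneCase g2 g3 β a c) {d μ : ℂ} (hd : d ≠ 0)
    (hμ : μ ^ 2 = (polyGamma a c).eval d) {σ : ℂ}
    (hσ : σ ^ 2 = (polyE2 (modG2 g2 g3) (modG3 g2 g3)).eval (coverZ g2 g3 (1 / d + β))) {m : ℕ}
    (hm : m • intRho (modG2 g2 g3) (modG3 g2 g3) (coverZ g2 g3 (1 / d + β)) σ hσ = 0) :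
    m • (QuotientAddGroup.mk (abelInt 2 (polyGamma a c) (HPoint.aff d μ hμ).neg
      (HPoint.aff d μ hμ)) : Geodesic (polyGamma a c)) = 0 := by
  have hΔ := modG_disc_ne hg2 hg3
  have hf := isSmoothOdd_polyGamma hg2 hg3 h
  obtain ⟨κ, hκ⟩ := IsAlgClosed.exists_pow_nat_eq (a 0 * a 1 * a 2 * c) (n := 2) two_pos
  have hκ0 : κ ≠ 0 := by
    rintro rfl
    simp [h.1, h.2.1] at hκ
  obtain ⟨ξ₀, η₀, Φ, he⟩ := exists_isExp hΔ
  set E : HPoint (polyGamma a c) := .aff d μ hμ with hE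
  obtain ⟨I, hI⟩ := exists_pathIntegral hf E.neg E
  have hcov := cover_eq_add hg2 hg3 h hκ hκ0 he hI
  set w := coverW g2 (1 / d + β) (μ / (κ * d ^ 3)) with hw
  have hweq := cover_eqn (polyGamma_point_eqn h hκ hκ0 hd hμ)
  rw [← hw] at hweq
  have hcE : cover g2 g3 β κ E = ellPt _ _ (coverZ g2 g3 (1 / d + β)) w := if_neg hd
  have hcE' : cover g2 g3 β κ E.neg = -ellPt _ _ (coverZ g2 g3 (1 / d + β)) w := by
    rw [neg_ellPt hΔ hweq]
    refine (if_neg hd).trans ?_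
    congr 1
    rw [hw, coverW, coverW]
    ring
  rw [hcE, hcE'] at hcov
  have hΦ : Φ (-3 * κ * I 1) = 2 • ellPt _ _ (coverZ g2 g3 (1 / d + β)) w := by
    rw [two_nsmul]
    nth_rw 1 [hcov]
    abel
  have hmw : (m * 2) • ellPt (modG2 g2 g3) (modG3 g2 g3) (coverZ g2 g3 (1 / d + β)) w = 0 := by
    have h1 := (nsmul_intRho_eq_zero_iff hΔ hσ m).1 hm
    rw [eval_polyE2] at hσ
    -- The sign of the square root σ is immaterial, because P and -P have the same order.
    rcases sq_eq_sq_iff_eq_or_eq_neg.1 (hweq.trans hσ.symm) with hwσ | hwσ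
    · rwa [hwσ]
    · rw [hwσ, ← neg_ellPt hΔ hσ, neg_nsmul, h1, neg_zero]
  -- Only the second integral is prescribed; the first one is whatever the path gives, and is lost
  -- in the quotient.
  obtain ⟨Q, J, hJ, hJ1⟩ := exists_pathIntegral_apply_eq hf 1
    (HPoint.aff 0 0 (by simp [polyGamma])) (m * I 1)
  have hcQ := cover_eq_add hg2 hg3 h hκ hκ0 he hJ
  have hQ0 : cover g2 g3 β κ Q = 0 := by
    have h0 : cover g2 g3 β κ (HPoint.aff 0 0 (by simp [polyGamma]) : HPoint (polyGamma a c)) = 0 :=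
      if_pos rfl
    rw [hcQ, h0, zero_add, hJ1, show -3 * κ * (m * I 1) = m • (-3 * κ * I 1) by
      rw [nsmul_eq_mul]; ring, map_nsmul, hΦ, smul_smul, hmw]
  obtain rfl := cover_eq_zero hg2 hg3 h hκ hκ0 hQ0
  have hJmem : J ∈ periodLattice 2 (polyGamma a c) := AddSubgroup.subset_closure ⟨_, hJ⟩
  rw [abelInt_eq hI, ← QuotientAddGroup.mk_nsmul, ← QuotientAddGroup.mk_nsmul,
    geodesic_mk_eq (v := m • I) (w := J) (by rw [hJ1, Pi.smul_apply, nsmul_eq_mul]),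
    (QuotientAddGroup.eq_zero_iff J).2 hJmem, QuotientAddGroup.mk_zero]

end Periodicity

/-! ### The main theorem -/

lemma Equiv.addRight_pow {G : Type*} [AddGroup G] (a : G) (m : ℕ) :
    (Equiv.addRight a : Equiv.Perm G) ^ m = Equiv.addRight (m • a) := by
  induction m with
  | zero =>
    ext x
    simp
  | succ m ih =>
    ext x
    rw [pow_succ', Equiv.Perm.mul_apply, ih, succ_nsmul]
    exact add_assoc _ _ _

theorem mainTheorem6 (g2 g3 : ℂ) (hg2 : g2 ≠ 0) (hg3 : g2 ^ 3 ≠ 27 * g3 ^ 2) :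
    -- periodicity of the map induced by the billiard on the geodesics
    (∀ (β : ℂ) (a : Fin 3 → ℂ) (c : ℂ), IsThreeToOneCase g2 g3 β a c →
      ∀ d : ℂ, d ≠ 0 → (∀ i, d ≠ a i) → d ≠ c →
      ∀ (μ : ℂ) (hμ : μ ^ 2 = (polyGamma a c).eval d),
      ∃ F : Equiv.Perm (Geodesic (polyGamma a c)),
        (∀ γ γ', BilliardOnGeodesics (polyGamma a c) (HPoint.aff d μ hμ) γ γ' ↔ F γ = γ') ∧
        ∀ ρ : ℂ, ρ = coverZ g2 g3 (1 / d + β) →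
          (∀ (σ : ℂ) (hσ : σ ^ 2 = (polyE2 (modG2 g2 g3) (modG3 g2 g3)).eval ρ) (m : ℕ), 0 < m →
            m • intRho (modG2 g2 g3) (modG3 g2 g3) ρ σ hσ = 0 → F ^ m = 1) ∧
          (Cond3 (modG2 g2 g3) (modG3 g2 g3) ρ ∨ Cond4 (modG2 g2 g3) (modG3 g2 g3) ρ →
            F ^ 3 = 1)) ∧
    -- the case `m = 3` of the neutrality condition
    (∀ (ρ σ : ℂ) (hσ : σ ^ 2 = (polyE2 (modG2 g2 g3) (modG3 g2 g3)).eval ρ), σ ≠ 0 →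
      (∃ S, IsSqrtExpansion (polyE2 (modG2 g2 g3) (modG3 g2 g3)) ρ S) ∧
      ∀ S, IsSqrtExpansion (polyE2 (modG2 g2 g3) (modG3 g2 g3)) ρ S →
        (3 • intRho (modG2 g2 g3) (modG3 g2 g3) ρ σ hσ = 0 ↔ (cayleyMatrix S).rank < 2) ∧
        ((cayleyMatrix S).rank < 2 ↔
          Cond3 (modG2 g2 g3) (modG3 g2 g3) ρ ∨ Cond4 (modG2 g2 g3) (modG3 g2 g3) ρ)) ∧
    -- the roots and the sixth order points
    {ρ | Cond3 (modG2 g2 g3) (modG3 g2 g3) ρ ∨ Cond4 (modG2 g2 g3) (modG3 g2 g3) ρ}.ncard = 16 ∧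
    (rootPoints (modG2 g2 g3) (modG3 g2 g3)).ncard = 32 ∧
    (∀ P ∈ rootPoints (modG2 g2 g3) (modG3 g2 g3), P.neg ≠ P) ∧
    (∀ O : HPoint (polyE2 (modG2 g2 g3) (modG3 g2 g3)), O.IsWeierstrass →
      Set.BijOn (fun P => abelInt 1 (polyE2 (modG2 g2 g3) (modG3 g2 g3)) O P)
        (rootPoints (modG2 g2 g3) (modG3 g2 g3)) {x | 6 • x = 0 ∧ 2 • x ≠ 0}) ∧
    {x : Jac 1 (polyE2 (modG2 g2 g3) (modG3 g2 g3)) | 6 • x = 0}.ncard = 36 ∧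
    {x : Jac 1 (polyE2 (modG2 g2 g3) (modG3 g2 g3)) | 2 • x = 0}.ncard = 4 := by
  have hΔ := modG_disc_ne hg2 hg3
  have hthree (ρ σ : ℂ) (hσ : σ ^ 2 = (polyE2 (modG2 g2 g3) (modG3 g2 g3)).eval ρ) (hσ0 : σ ≠ 0) :
      3 • intRho (modG2 g2 g3) (modG3 g2 g3) ρ σ hσ = 0 ↔
        Cond3 (modG2 g2 g3) (modG3 g2 g3) ρ ∨ Cond4 (modG2 g2 g3) (modG3 g2 g3) ρ := by
    rw [nsmul_intRho_eq_zero_iff hΔ hσ, eval_polyE2] at *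
    exact six_nsmul_ellPt_eq_zero_iff hΔ hσ hσ0
  refine ⟨fun β a c h d hd _ _ μ hμ => ?_, fun ρ σ hσ hσ0 => ?_, ncard_cond hΔ,
    ncard_rootPoints hΔ, fun P hP => rootPoints_neg_ne hΔ hP,
    fun O hO => bijOn_abelInt_rootPoints hΔ hO, ?_, ?_⟩
  · have hf := isSmoothOdd_polyGamma hg2 hg3 h
    refine ⟨Equiv.addRight (QuotientAddGroup.mk (abelInt 2 (polyGamma a c)
      (HPoint.aff d μ hμ).neg (HPoint.aff d μ hμ))),
      fun γ γ' => billiardOnGeodesics_iff hf _ γ γ', ?_⟩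
    rintro ρ rfl
    have hper (σ : ℂ) (hσ : σ ^ 2 = (polyE2 (modG2 g2 g3) (modG3 g2 g3)).eval
        (coverZ g2 g3 (1 / d + β))) (m : ℕ)
        (hm : m • intRho (modG2 g2 g3) (modG3 g2 g3) (coverZ g2 g3 (1 / d + β)) σ hσ = 0) :
        (Equiv.addRight (QuotientAddGroup.mk (abelInt 2 (polyGamma a c) (HPoint.aff d μ hμ).neg
          (HPoint.aff d μ hμ)) : Geodesic (polyGamma a c))) ^ m = 1 := by
      refine (Equiv.addRight_pow _ m).trans ?_
      rw [nsmul_geodesic_shift_eq_zero hg2 hg3 h hd hμ hσ hm]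
      exact Equiv.ext fun x => add_zero x
    refine ⟨fun σ hσ m _ hm => hper σ hσ m hm, fun hc => ?_⟩
    obtain ⟨σ, hσ⟩ := IsAlgClosed.exists_pow_nat_eq
      ((polyE2 (modG2 g2 g3) (modG3 g2 g3)).eval (coverZ g2 g3 (1 / d + β))) (n := 2) two_pos
    refine hper σ hσ 3 ((hthree _ σ hσ ?_).2 hc)
    -- The value σ = 0 would make ρ a root of the cubic, which (cond3) and (cond4) exclude.
    rintro rfl
    rw [eval_polyE2] at hσ
    have h0 := hσ.symm.trans (zero_pow two_ne_zero)
    exact hc.elim (fun hc => hc.eval_ne_zero hΔ h0) fun hc => hc.eval_ne_zero hΔ h0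
  · have h0 : (polyE2 (modG2 g2 g3) (modG3 g2 g3)).eval ρ ≠ 0 := by
      rw [← hσ]
      exact pow_ne_zero 2 hσ0
    refine ⟨exists_isSqrtExpansion h0, fun S hS => ?_⟩
    rw [hthree ρ σ hσ hσ0, hS.rank_lt_two_iff h0]
    exact ⟨Iff.rfl, Iff.rfl⟩
  · rw [ncard_jac_torsion hΔ, ncard_six_torsion (ncard_two_torsion hΔ) (ncard_three_torsion hΔ)]
  · rw [ncard_jac_torsion hΔ, ncard_two_torsion hΔ]
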